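/- Let $d\ge 1$. For $f$ on $\mathbb R^d$ let $\hat f(\xi)=\int_{\mathbb R^d}e^{-ix\cdot\xi}f(x)\,dx$ (extended to $L^2$ and to tempered distributions), let $\mathcal F_{s\to\nu}$ be the analogous transform in one real variable $s$, and let $e^{it|D|}$ be the Fourier multiplier with symbol $e^{it|\xi|}$. Put $\tau=\frac{d-1}{4}\pi$ and $c_0=\big(2(2\pi)^{d-1}\big)^{-1/2}$. For $f\in L^2(\mathbb R^d)$ and almost every $\omega\in\mathbb S^{d-1}$, let $f_\omega^-\in L^2(\mathbb R)$ be the function with $\mathcal F_{s\to\nu}(f_\omega^-)(\nu)=\mathbf 1_{\nu\le 0}|\nu|^{\frac{d-1}{2}}\hat f(\nu\omega)$ (chosen jointly measurable in $(s,\omega)$). Let $\mathcal T v$ be the function on $\mathbb R\times\mathbb S^{d-1}$ defined by $$\mathcal F_{s\to\nu}(\mathcal T v)(\nu,\omega)=c_0|\nu|^{\frac{d-1}{2}}\big(e^{i\tau}\mathbf 1_{\nu<0}+e^{-i\tau}\mathbf 1_{\nu\ge0}\big)\hat v(\nu\omega)\qquad (v\in L^2(\mathbb R^d)),$$ and for $v\in\dot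 H^1(\mathbb R^d)$ let $\partial_s\mathcal T v$ be the function on $\mathbb R\times\mathbb S^{d-1}$ whose Fourier transform in $s$ is $i\nu$ times the right-hand side. Here $\dot H^1(\mathbb R^d)$ is the space of complex tempered distributions whose gradient is in $L^2$ (the Fourier transform of such a distribution is a locally integrable function on $\mathbb R^d\setminus\{0\}$). All these functions exist and are unique up to almost everywhere equality. 1) (Half-wave equation) Let $f\in L^2(\mathbb R^d)$. Then, as $t\to+\infty$, $$(e^{it|D|}f)(x)-\frac{e^{i\tau}}{(2\pi|x|)^{\frac{d-1}{2}}}\,f^-_{x/|x|}(|x|-t)\to0\quad\text{in }L^2(\mathbb R^d).$$ Furthermore, for each choice of sign, $$\limsup_{t\to\pm\infty}\|e^{it|D|}f\|_{L^2(||x|-|t||\ge R)}\to0\quad\text{as }R\to+\infty.$$ 2) (Wave equation) Let $(u_0,u_1)\in\dot H^1\times L^2(\mathbb R^d)$. The equation $\partial_{tt}u-\Delta u=0$ with $(u,\partial_tu)|_{t=0}=(u_0,u_1)$ has a solution in the sense of distributions for which $\nabla_x u$ and $\partial_t u$ are continuous in $t\in\mathbb R$ with values in $L^2$, and for the solution $u$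 in this class, as $t\to+\infty$, $$\nabla_{t,x}u(t,x)-\frac{1}{\sqrt2\,|x|^{\frac{d-1}{2}}}\big(\partial_s\mathcal T u_0-\mathcal T u_1\big)\Big(|x|-t,\frac{x}{|x|}\Big)\begin{pmatrix}-1\\ x/|x|\end{pmatrix}\to0\quad\text{in }L^2(\mathbb R^d)^{1+d}.$$ Furthermore, for each choice of sign, $$\limsup_{t\to\pm\infty}\|\nabla_{t,x}u(t)\|_{L^2(||x|-|t||\ge R)}\to0\quad\text{as }R\to+\infty.$$ -/

import Mathlib

open MeasureTheory Filter Topology Complex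
open scoped SchwartzMap FourierTransform LineDeriv Laplacian ENNReal

noncomputable section

namespace RadiationField

/-- The Euclidean space `ℝ^d`. -/
abbrev Space (d : ℕ) : Type := EuclideanSpace ℝ (Fin d)

/-- The unit sphere `S^{d-1}` of `ℝ^d`. -/
abbrev Sph (d : ℕ) : Type := Metric.sphere (0 : Space d) 1

/-- Complex-valued `L²(ℝ^d)`. -/
abbrev L2 (d : ℕ) : Type := Lp ℂ 2 (volume : Measure (Space d))

/-- The standard (surface) measure of `S^{d-1}`. -/
abbrev sphMeasure (d : ℕ) : Measure (Sph d) := (volume : Measure (Space d)).toSphere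

/-- The Fourier transform of an `L²` function in the normalization
`f̂(ξ) = ∫ exp(-i x·ξ) f(x) dx`. As Mathlib's transform is `𝓕 f ξ = ∫ exp(-2πi x·ξ) f(x) dx`,
one has `f̂(ξ) = 𝓕 f (ξ / 2π)`. -/
def hat {V : Type*} [NormedAddCommGroup V] [InnerProductSpace ℝ V] [FiniteDimensional ℝ V]
    [MeasurableSpace V] [BorelSpace V] (f : Lp ℂ 2 (volume : Measure V)) (ξ : V) : ℂ :=
  (𝓕 f : Lp ℂ 2 (volume : Measure V)) ((2 * Real.pi)⁻¹ • ξ)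

section HalfWave

variable {d : ℕ}

/-- Multiplication by `exp(i t |2πξ|)` preserves `L²`. -/
theorem memLp_phase_mul (t : ℝ) (g : L2 d) :
    MemLp (fun ξ : Space d => cexp (I * (t * ‖(2 * Real.pi) • ξ‖ : ℝ)) * g ξ) 2 volume := by
  refine (Lp.memLp g).of_le ?_ (Eventually.of_forall fun ξ => ?_)
  · refine AEStronglyMeasurable.mul ?_ (Lp.aestronglyMeasurable g)
    exact Continuous.aestronglyMeasurable (by fun_prop)
  · rw [norm_mul, mul_comm I, Complex.norm_exp_ofReal_mul_I, one_mul]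

/-- The half-wave group `e^{it|D|}` on `L²(ℝ^d)`: the Fourier multiplier `exp(i t |ξ|)`
(`|D|` has symbol `|ξ|` for `hat`, that is `|2πξ|` for Mathlib's `𝓕`). -/
def halfWave (t : ℝ) (f : L2 d) : L2 d :=
  𝓕⁻ ((memLp_phase_mul t (𝓕 f : L2 d)).toLp)

end HalfWave

/-- `τ = (d-1)π/4`. -/
def tau (d : ℕ) : ℝ := ((d : ℝ) - 1) / 4 * Real.pi

/-- `c₀ = 1 / √(2 (2π)^{d-1})`. -/
def c0 (d : ℕ) : ℝ := 1 / Real.sqrt (2 * (2 * Real.pi) ^ ((d : ℝ) - 1))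

section Profiles

variable {d : ℕ}

/-- `P : ℝ × S^{d-1} → ℂ` is a (jointly measurable) function whose Fourier transform in the first
variable (in the `L²(ℝ)` sense) is `g(·, ω)`, for almost every `ω`. Given `g`, this determines `P`
up to almost everywhere equality. -/
def HasPartialFourier (P : ℝ × Sph d → ℂ) (g : ℝ → Sph d → ℂ) : Prop :=
  AEStronglyMeasurable P ((volume : Measure ℝ).prod (sphMeasure d)) ∧
  ∀ᵐ ω ∂(sphMeasure d), ∃ hP : MemLp (fun s : ℝ => P (s, ω)) 2 volume,
    hat hP.toLp =ᵐ[volume] fun ν : ℝ => g ν ω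

/-- `P(s, ω) = f_ω^-(s)`: the Fourier transform of `P(·, ω)` is
`ν ↦ 1_{ν ≤ 0} |ν|^{(d-1)/2} f̂(νω)`. -/
def IsMinusProfile (f : L2 d) (P : ℝ × Sph d → ℂ) : Prop :=
  HasPartialFourier P fun ν ω =>
    if ν ≤ 0 then ((|ν| ^ (((d : ℝ) - 1) / 2) : ℝ) : ℂ) * hat f (ν • (ω : Space d)) else 0

/-- The partial Fourier transform of `𝒯 v`, given the function `F = v̂`:
`c₀ |ν|^{(d-1)/2} (e^{iτ} 1_{ν < 0} + e^{-iτ} 1_{ν ≥ 0}) v̂(νω)`. -/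
def symbolT (F : Space d → ℂ) (ν : ℝ) (ω : Sph d) : ℂ :=
  ((c0 d * |ν| ^ (((d : ℝ) - 1) / 2) : ℝ) : ℂ) *
    (if ν < 0 then cexp (I * tau d) else cexp (-(I * tau d))) * F (ν • (ω : Space d))

/-- `P = 𝒯 v`, for `v ∈ L²(ℝ^d)`. -/
def IsT (v : L2 d) (P : ℝ × Sph d → ℂ) : Prop :=
  HasPartialFourier P (symbolT (hat v))

/-- Away from the origin, the Fourier transform of the tempered distribution `v` (in the
normalization of `hat`) is the locally integrable function `F`. -/
def FourierAwayFromZero (v : 𝓢'(Space d, ℂ)) (F : Space d → ℂ) : Prop :=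
  LocallyIntegrableOn F {0}ᶜ volume ∧
  ∀ φ : 𝓢(Space d, ℂ), HasCompactSupport φ → (0 : Space d) ∉ tsupport φ →
    (𝓕 v) φ = ∫ ξ, F ((2 * Real.pi) • ξ) * φ ξ

/-- `P = ∂_s 𝒯 v`, whose partial Fourier transform is `iν` times that of `𝒯 v`. -/
def IsDerivT (v : 𝓢'(Space d, ℂ)) (P : ℝ × Sph d → ℂ) : Prop :=
  ∃ F : Space d → ℂ, FourierAwayFromZero v F ∧
    HasPartialFourier P fun ν ω => I * ν * symbolT F ν ω

/-- The direction `x / |x|` of a nonzero vector. -/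
def direction (x : Space d) (hx : x ≠ 0) : Sph d :=
  ⟨‖x‖⁻¹ • x, by simp [norm_smul, hx]⟩

open Classical in
/-- `x ↦ P(|x| - t, x / |x|)` (set to `0` at the single point `x = 0`). -/
def alongCone (P : ℝ × Sph d → ℂ) (t : ℝ) (x : Space d) : ℂ :=
  if hx : x = 0 then 0 else P (‖x‖ - t, direction x hx)

end Profiles

section Limits

variable {d : ℕ} {G : Type*} [NormedAddCommGroup G]

/-- `F(t) → 0` in `L²(ℝ^d)` as `t → +∞`. -/
def TendstoZeroL2 (F : ℝ → Space d → G) : Prop :=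
  (∀ t, MemLp (F t) 2 volume) ∧
  Tendsto (fun t => eLpNorm (F t) 2 volume) atTop (𝓝 0)

/-- `‖F(t)‖_{L²(||x| - |t|| ≥ R)}`. -/
def normOffCone (F : ℝ → Space d → G) (R t : ℝ) : ℝ≥0∞ :=
  eLpNorm (F t) 2 (volume.restrict {x : Space d | R ≤ abs (‖x‖ - abs t)})

/-- Both `limsup_{t → +∞} ‖F(t)‖_{L²(||x| - |t|| ≥ R)}` and
`limsup_{t → -∞} ‖F(t)‖_{L²(||x| - |t|| ≥ R)}` tend to `0` as `R → +∞`. -/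
def ConcentratesOnCone (F : ℝ → Space d → G) : Prop :=
  Tendsto (fun R : ℝ => limsup (fun t => normOffCone F R t) atTop) atTop (𝓝 0) ∧
  Tendsto (fun R : ℝ => limsup (fun t => normOffCone F R t) atBot) atTop (𝓝 0)

end Limits

section Wave

variable {d : ℕ}

/-- `u ∈ Ḣ¹(ℝ^d)`: the distributional gradient of `u` belongs to `L²`. -/
def MemHDotOne (u : 𝓢'(Space d, ℂ)) : Prop :=
  ∀ j : Fin d, ∃ g : L2 d, (g : 𝓢'(Space d, ℂ)) = ∂_{EuclideanSpace.single j (1 : ℝ)} u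

/-- `u` is the solution of `∂_tt u - Δ u = 0`, `(u, ∂_t u)(0) = (u₀, u₁)` in the energy space, with
time derivative `v` and space gradient `W`: `∇u` and `∂_t u` are continuous in time with values in
`L²`, and the time derivatives and the equation hold in the sense of distributions. -/
structure IsWaveSolution (u₀ : 𝓢'(Space d, ℂ)) (u₁ : L2 d)
    (u : ℝ → 𝓢'(Space d, ℂ)) (v : ℝ → L2 d) (W : Fin d → ℝ → L2 d) : Prop where
  init : u 0 = u₀
  init_deriv : v 0 = u₁
  continuous_timeDeriv : Continuous v
  continuous_grad : ∀ j, Continuous (W j)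
  grad : ∀ t j, (W j t : 𝓢'(Space d, ℂ)) = ∂_{EuclideanSpace.single j (1 : ℝ)} (u t)
  timeDeriv : ∀ (φ : 𝓢(Space d, ℂ)) (t : ℝ),
    HasDerivAt (fun s => u s φ) ((v t : 𝓢'(Space d, ℂ)) φ) t
  wave : ∀ (φ : 𝓢(Space d, ℂ)) (t : ℝ),
    HasDerivAt (fun s => (v s : 𝓢'(Space d, ℂ)) φ) ((Δ (u t)) φ) t

/-- The space-time gradient `∇_{t,x} u(t, x) = (∂_t u, ∂_1 u, …, ∂_d u)(t, x)` in `ℂ^{1+d}`. -/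
def spaceTimeGrad (v : ℝ → L2 d) (W : Fin d → ℝ → L2 d) (t : ℝ) (x : Space d) :
    EuclideanSpace ℂ (Fin (d + 1)) :=
  WithLp.toLp 2 (Fin.cons (v t x) (fun j => W j t x))

/-- The vector `(-1, x/|x|)` of `ℂ^{1+d}`. -/
def coneVector (x : Space d) : EuclideanSpace ℂ (Fin (d + 1)) :=
  WithLp.toLp 2 (Fin.cons (-1) (fun j => ((x j / ‖x‖ : ℝ) : ℂ)))

end Wave

end RadiationField

end

open RadiationField

/-! The proof is an explicit computation on a dense family, followed by a limiting argument that
uses only conservation of the `L²` norm.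

The dense family consists of the translates of the Poisson function, whose transform is `exp(-2π|ξ|)
exp(-2πi y·ξ)`. Applying the half-wave group to one of them only replaces the real parameter of the
Poisson kernel by `1 - it`. The kernel is computed for a real parameter by subordination to
Gaussians and continued analytically to the right half plane (`integral_cexp_poisson`), so the
evolution is a constant times `z (z² + |x - y|²)^(-(d+1)/2)` with `z = 1 - it`. On the light cone
`|x| = s + t` the terms `t²` cancel in `z² + |x - y|²`, which therefore grows like `t` only. After
multiplication by `|x|^((d-1)/2)` the solution has a pointwise limit, with the phase `exp(±iτ)`
coming from the powers of `i` (`tendsto_polarPull_poissonKernel`). The limit is a Gamma integral,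
hence has exactly the required Fourier transform in `s`.

In the coordinates `(s, ω)` the multiplication by `|x|^((d-1)/2)` is an isometry, and Plancherel in
`s` together with polar coordinates in frequency shows that the limit has the norm of the data.
Pointwise convergence without loss of mass is convergence in `L²` (`tendsto_eLpNorm_sub_of_ae`).

The whole argument is run for superpositions `e^{it|D|} a + e^{-it|D|} b`. The error is bounded by
the data uniformly in time, so the pairs `(a, b)` possessing a profile form a closed subspace; it
contains the Poisson functions in either slot, hence everything (`exists_isOutgoing`). Concentration
on the cone follows because the tail of an `L²` profile is small, and negative times are reached by
exchanging `a` and `b`.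

For the wave equation, `∇u₀` is the Riesz transform of one function `h ∈ L²`, formally `h = |D| u₀`
(`exists_eq_riesz`). The velocity and gradient are then explicit superpositions of half-waves, and
an energy identity for time primitives shows that no other solution exists (`IsWeakWave.eq_zero`).
The vector `(-1, x/|x|)` appears because the symbol `iξ_j/|ξ|` equals `±iω_j` on the two half lines
of frequencies. -/

noncomputable section

namespace RadiationField

/-! ### Analytic continuation and Laplace transforms -/

/-- Two functions holomorphic on the right half plane that agree on the positive reals coincide. -/
theorem eqOn_rightHalfPlane_of_ofReal {F G : ℂ → ℂ}
    (hF : DifferentiableOn ℂ F {z | 0 < z.re}) (hG : DifferentiableOn ℂ G {z | 0 < z.re})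
    (h : ∀ a : ℝ, 0 < a → F a = G a) {z : ℂ} (hz : 0 < z.re) : F z = G z := by
  have ho : IsOpen {z : ℂ | 0 < z.re} := isOpen_lt continuous_const continuous_re
  refine (hF.analyticOnNhd ho).eqOn_of_preconnected_of_frequently_eq (hG.analyticOnNhd ho)
    (convex_halfSpace_re_gt 0).isPreconnected (z₀ := 1) (by simp) ?_ hz
  -- The identity theorem needs the points of agreement to accumulate inside the domain; `1 +
  -- 1/(n+1)` does so at `1`.
  have ht : Tendsto (fun n : ℕ => ((1 + 1 / ((n : ℝ) + 1) : ℝ) : ℂ)) atTop (𝓝[≠] 1) := by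
    rw [tendsto_nhdsWithin_iff]
    constructor
    · have h1 : Tendsto (fun n : ℕ => (1 + 1 / ((n : ℝ) + 1) : ℝ)) atTop (𝓝 (1 + 0)) :=
        tendsto_const_nhds.add tendsto_one_div_add_atTop_nhds_zero_nat
      have h2 := (continuous_ofReal.tendsto _).comp h1
      simpa [Function.comp_def] using h2
    · refine Eventually.of_forall fun n => ?_
      have : (0 : ℝ) < 1 / ((n : ℝ) + 1) := by positivity
      intro hh
      rw [Set.mem_singleton_iff] at hh
      have h3 : (1 + 1 / ((n : ℝ) + 1) : ℝ) = 1 := by exact_mod_cast hh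
      linarith
  refine ht.frequently (Frequently.of_forall fun n => h _ (by positivity))

/-- Laplace transforms are holomorphic on the right half plane. -/
theorem differentiableOn_laplace {α : Type*} [MeasurableSpace α] {μ : Measure α}
    {φ : α → ℝ} {f : α → ℂ} (hφ : AEStronglyMeasurable φ μ) (hφ0 : ∀ᵐ x ∂μ, 0 ≤ φ x)
    (hf : ∀ a : ℝ, 0 < a → Integrable (fun x => cexp (-(a * φ x)) * f x) μ)
    (hfm : AEStronglyMeasurable f μ) :
    DifferentiableOn ℂ (fun z => ∫ x, cexp (-(z * φ x)) * f x ∂μ) {z | 0 < z.re} := by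
  intro z hz
  refine DifferentiableAt.differentiableWithinAt ?_
  have hz' : 0 < z.re := hz
  -- On the ball of radius `δ` one has `Re w ≥ δ`. Half of this decay absorbs the factor `φ` of the
  -- derivative, through `φ ≤ (2/δ) exp(δφ/2)`, and the other half gives the integrable majorant.
  set δ := z.re / 2 with hδ
  have hδ0 : 0 < δ := by positivity
  have meas : ∀ w : ℂ, AEStronglyMeasurable (fun x => cexp (-(w * φ x))) μ := by
    intro w
    have hm : Continuous fun y : ℝ => cexp (-(w * y)) := by fun_prop
    exact hm.comp_aestronglyMeasurable hφ
  have key := hasDerivAt_integral_of_dominated_loc_of_deriv_le (𝕜 := ℂ) (μ := μ)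
    (F := fun w x => cexp (-(w * φ x)) * f x)
    (F' := fun w x => (-φ x) * cexp (-(w * φ x)) * f x) (x₀ := z) (s := Metric.ball z δ)
    (bound := fun x => (2 / δ) * ‖cexp (-((δ / 2 : ℝ) * φ x)) * f x‖) (Metric.ball_mem_nhds z hδ0)
    (Eventually.of_forall fun w => (meas w).mul hfm) ?_ ?_ ?_ ?_ ?_
  · exact key.2.differentiableAt
  · refine (hf z.re hz').norm.mono' ((meas z).mul hfm) (Eventually.of_forall fun x => ?_)
    simp [Complex.norm_exp]
  · refine AEStronglyMeasurable.mul ?_ hfm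
    refine AEStronglyMeasurable.mul ?_ (meas z)
    exact (continuous_ofReal.comp_aestronglyMeasurable hφ).neg
  · filter_upwards [hφ0] with x hx w hw
    have hwre : δ ≤ w.re := by
      have h1 : |(w - z).re| ≤ ‖w - z‖ := abs_re_le_norm _
      have h2 : ‖w - z‖ < δ := by simpa [dist_eq_norm] using hw
      have h3 := (abs_le.1 (h1.trans h2.le)).1
      simp only [sub_re] at h3
      linarith
    simp only [norm_mul, norm_neg, norm_real, Real.norm_eq_abs, abs_of_nonneg hx, Complex.norm_exp,
      neg_re, mul_re, ofReal_re, ofReal_im, mul_zero, sub_zero]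
    rw [← mul_assoc]
    refine mul_le_mul_of_nonneg_right ?_ (norm_nonneg _)
    have h4 : φ x ≤ 2 / δ * Real.exp (δ / 2 * φ x) := by
      have h5 := Real.add_one_le_exp (δ / 2 * φ x)
      have h6 : δ / 2 * φ x ≤ Real.exp (δ / 2 * φ x) := by linarith
      calc φ x = 2 / δ * (δ / 2 * φ x) := by field_simp
        _ ≤ _ := by gcongr
    calc φ x * Real.exp (-(w.re * φ x)) ≤ (2 / δ * Real.exp (δ / 2 * φ x)) * Real.exp (-(δ * φ x)) := by
          gcongr
      _ = 2 / δ * Real.exp (-(δ / 2 * φ x)) := by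
          rw [mul_assoc, ← Real.exp_add]; congr 2; ring
  · exact (hf (δ / 2) (by positivity)).norm.const_mul _
  · refine Eventually.of_forall fun x w _ => ?_
    have h1 : HasDerivAt (fun w : ℂ => -(w * (φ x : ℂ))) (-(φ x : ℂ)) w := by
      simpa using ((hasDerivAt_id w).mul_const (φ x : ℂ)).fun_neg
    have := (h1.cexp).mul_const (f x)
    convert! this using 1
    ring

theorem integrableOn_rpow_mul_exp {b c : ℝ} (hb : -1 < b) (hc : 0 < c) :
    IntegrableOn (fun u : ℝ => u ^ b * Real.exp (-(c * u))) (Set.Ioi 0) := by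
  have := integrableOn_rpow_mul_exp_neg_mul_rpow (p := 1) hb one_pos hc
  refine this.congr_fun (fun u _ => ?_) measurableSet_Ioi
  simp [Real.rpow_one]

/-- Gamma integral with complex frequency. -/
theorem integral_rpow_mul_cexp_neg_mul {b : ℝ} (hb : 0 < b) {z : ℂ} (hz : 0 < z.re) :
    ∫ u in Set.Ioi (0 : ℝ), cexp (-(z * u)) * ((u ^ (b - 1) : ℝ) : ℂ)
      = Real.Gamma b * z ^ (-b : ℂ) := by
  refine eqOn_rightHalfPlane_of_ofReal
    (F := fun z => ∫ u in Set.Ioi (0 : ℝ), cexp (-(z * u)) * ((u ^ (b - 1) : ℝ) : ℂ))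
    (G := fun z => Real.Gamma b * z ^ (-b : ℂ)) ?_ ?_ ?_ hz
  · refine differentiableOn_laplace (by fun_prop) ?_ ?_ ?_
    · filter_upwards [ae_restrict_mem measurableSet_Ioi] with u hu using (le_of_lt hu)
    · intro a ha
      have := (integrableOn_rpow_mul_exp (b := b - 1) (by linarith) ha).ofReal (𝕜 := ℂ)
      refine this.congr (Eventually.of_forall fun u => ?_)
      simp only [coe_algebraMap]
      push_cast
      ring
    · refine (Measurable.aestronglyMeasurable ?_)
      fun_prop
  · intro w hw
    refine DifferentiableAt.differentiableWithinAt ?_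
    refine (differentiableAt_const _).mul ?_
    exact differentiableAt_id.cpow_const (Or.inl hw)
  · intro a ha
    have h := Real.integral_rpow_mul_exp_neg_mul_Ioi hb ha
    calc ∫ u in Set.Ioi (0 : ℝ), cexp (-((a : ℂ) * u)) * ((u ^ (b - 1) : ℝ) : ℂ)
        = ∫ u in Set.Ioi (0 : ℝ), ((u ^ (b - 1) * Real.exp (-(a * u)) : ℝ) : ℂ) := by
          congr 1; ext u; push_cast; ring
      _ = (((1 / a) ^ b * Real.Gamma b : ℝ) : ℂ) := by rw [integral_complex_ofReal, h]
      _ = _ := by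
          rw [one_div, Real.inv_rpow ha.le, ← Real.rpow_neg ha.le]
          push_cast
          rw [Complex.ofReal_cpow ha.le]
          push_cast
          ring

theorem integral_Ioi_cexp_neg_mul {z : ℂ} (hz : 0 < z.re) :
    ∫ u in Set.Ioi (0 : ℝ), cexp (-(z * u)) = z⁻¹ := by
  have h := integral_rpow_mul_cexp_neg_mul one_pos hz
  simpa [cpow_neg_one] using h

/-! ### Subordination of the exponential to Gaussians -/

theorem integrable_exp_neg_mul_abs {c : ℝ} (hc : 0 < c) :
    Integrable fun x : ℝ => Real.exp (-(c * |x|)) := by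
  have h := integrableOn_rpow_mul_exp (b := 0) (by norm_num) hc
  refine (integrable_fun_norm_addHaar (μ := (volume : Measure ℝ))
    (f := fun r => Real.exp (-(c * r)))).2 ?_
  exact h.congr_fun (fun u _ => by simp) measurableSet_Ioi

/-- The two half lines contribute `1/(2π(1 + iξ))` and `1/(2π(1 - iξ))`, which add up to the Cauchy
density. Fourier inversion then yields its characteristic function. -/
theorem fourier_exp_neg_abs (ξ : ℝ) :
    𝓕 (fun x : ℝ => (Real.exp (-(2 * Real.pi * |x|)) : ℂ)) ξ
      = ((1 / (Real.pi * (1 + ξ ^ 2)) : ℝ) : ℂ) := by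
  have hpi := Real.pi_pos
  have hint : Integrable fun x : ℝ => Real.fourierChar (-(x * ξ)) •
      (Real.exp (-(2 * Real.pi * |x|)) : ℂ) := by
    have := (integrable_exp_neg_mul_abs (c := 2 * Real.pi) (by positivity)).ofReal (𝕜 := ℂ)
    refine (Real.fourierIntegral_convergent_iff (V := ℝ) (E := ℂ) ξ).2 this |>.congr ?_
    refine Eventually.of_forall fun x => ?_
    simp [mul_comm]
  rw [Real.fourier_real_eq, ← integral_add_compl (measurableSet_Ioi (a := (0 : ℝ))) hint,
    Set.compl_Ioi]
  have e1 : ∫ x in Set.Ioi (0 : ℝ), Real.fourierChar (-(x * ξ)) •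
      (Real.exp (-(2 * Real.pi * |x|)) : ℂ) = (2 * Real.pi * (1 + I * ξ) : ℂ)⁻¹ := by
    rw [← integral_Ioi_cexp_neg_mul (by simp [hpi])]
    refine setIntegral_congr_fun measurableSet_Ioi fun x hx => ?_
    have hx' : (0 : ℝ) < x := hx
    simp only [Circle.smul_def, Real.fourierChar_apply, smul_eq_mul, abs_of_pos hx', ofReal_exp,
      ← Complex.exp_add]
    congr 1; push_cast; ring
  have e2 : ∫ x in Set.Iic (0 : ℝ), Real.fourierChar (-(x * ξ)) •
      (Real.exp (-(2 * Real.pi * |x|)) : ℂ) = (2 * Real.pi * (1 - I * ξ) : ℂ)⁻¹ := by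
    rw [← integral_Ioi_cexp_neg_mul (by simp [hpi]), ← neg_zero, ← integral_comp_neg_Iic]
    rw [neg_zero]
    refine setIntegral_congr_fun measurableSet_Iic fun x hx => ?_
    have hx' : x ≤ 0 := hx
    simp only [Circle.smul_def, Real.fourierChar_apply, smul_eq_mul, abs_of_nonpos hx', ofReal_exp,
      ← Complex.exp_add]
    congr 1; push_cast; ring
  rw [e1, e2]
  have hp : (Real.pi : ℂ) ≠ 0 := by exact_mod_cast hpi.ne'
  have h1 : (1 + I * ξ : ℂ) ≠ 0 := by
    intro h; have := congrArg Complex.re h; simp at this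
  have h2 : (1 - I * ξ : ℂ) ≠ 0 := by
    intro h; have := congrArg Complex.re h; simp at this
  have h3 : (1 + ξ ^ 2 : ℂ) = (1 + I * ξ) * (1 - I * ξ) := by
    ring_nf; rw [I_sq]; ring
  push_cast
  rw [h3]
  field_simp
  ring

/-- The Cauchy density has characteristic function `exp(-2π|b|)`. -/
theorem integral_cauchy_char (b : ℝ) :
    ∫ η : ℝ, cexp (2 * Real.pi * I * b * η) * ((1 / (Real.pi * (1 + η ^ 2)) : ℝ) : ℂ)
      = Real.exp (-(2 * Real.pi * |b|)) := by
  have hcont : Continuous fun x : ℝ => (Real.exp (-(2 * Real.pi * |x|)) : ℂ) := by fun_prop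
  have h1 : Integrable fun x : ℝ => (Real.exp (-(2 * Real.pi * |x|)) : ℂ) :=
    (integrable_exp_neg_mul_abs (c := 2 * Real.pi) (by positivity)).ofReal
  have h2 : 𝓕 (fun x : ℝ => (Real.exp (-(2 * Real.pi * |x|)) : ℂ)) =
      fun η : ℝ => ((1 / (Real.pi * (1 + η ^ 2)) : ℝ) : ℂ) := funext fourier_exp_neg_abs
  have h3 : Integrable (𝓕 (fun x : ℝ => (Real.exp (-(2 * Real.pi * |x|)) : ℂ))) := by
    rw [h2]
    refine Integrable.ofReal ((integrable_inv_one_add_sq.const_mul (Real.pi⁻¹)).congr ?_)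
    refine Eventually.of_forall fun x => ?_
    simp only [mul_inv]
    exact (one_mul _).symm
  have h4 := congrFun (hcont.fourierInv_fourier_eq h1 h3) b
  rw [h2, Real.fourierInv_eq'] at h4
  rw [← h4]
  refine integral_congr_ae (Eventually.of_forall fun η => ?_)
  simp only [smul_eq_mul, RCLike.inner_apply, conj_trivial]
  congr 2; push_cast; ring

/-- Subordination of the exponential to Gaussians. -/
theorem exp_neg_eq_integral_gaussian {b : ℝ} (hb : 0 ≤ b) :
    (Real.exp (-(2 * Real.pi * b)) : ℂ) = ∫ u in Set.Ioi (0 : ℝ),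
      ((u ^ (-(1 / 2) : ℝ) * Real.exp (-(Real.pi * u)) * Real.exp (-(Real.pi * b ^ 2 / u)) : ℝ) : ℂ) := by
  have hpi := Real.pi_pos
  conv_lhs => rw [← abs_of_nonneg hb]
  rw [← integral_cauchy_char b]
  -- The Cauchy density is itself a Laplace integral in `u` of Gaussians in `η`. Exchanging the two
  -- integrals leaves a Gaussian Fourier transform in `η`, whose value is the subordination weight.
  have e1 : ∀ η : ℝ, cexp (2 * Real.pi * I * b * η) * ((1 / (Real.pi * (1 + η ^ 2)) : ℝ) : ℂ)
      = ∫ u in Set.Ioi (0 : ℝ), cexp (2 * Real.pi * I * b * η) *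
          cexp (-((Real.pi * (1 + η ^ 2) : ℝ) * u)) := by
    intro η
    rw [integral_const_mul, integral_Ioi_cexp_neg_mul (by rw [ofReal_re]; positivity), one_div, ofReal_inv]
  simp_rw [e1]
  have gauss : ∀ u : ℝ, 0 < u → ∫ η : ℝ, Real.exp (-(Real.pi * (1 + η ^ 2) * u))
      = u ^ (-(1 / 2) : ℝ) * Real.exp (-(Real.pi * u)) := by
    intro u hu
    have h1 : ∀ η : ℝ, Real.exp (-(Real.pi * (1 + η ^ 2) * u))
        = Real.exp (-(Real.pi * u)) * Real.exp (-(Real.pi * u) * η ^ 2) := by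
      intro η; rw [← Real.exp_add]; congr 1; ring
    simp_rw [h1]
    rw [integral_const_mul, integral_gaussian, mul_comm]
    congr 1
    rw [Real.sqrt_eq_rpow, Real.rpow_neg hu.le, ← Real.inv_rpow hu.le]
    congr 1
    field_simp
  have hmeas : AEStronglyMeasurable (fun p : ℝ × ℝ => cexp (2 * Real.pi * I * b * p.1) *
      cexp (-((Real.pi * (1 + p.1 ^ 2) : ℝ) * p.2)))
      ((volume : Measure ℝ).prod (volume.restrict (Set.Ioi 0))) := by
    refine Continuous.aestronglyMeasurable ?_
    fun_prop
  have hnorm : ∀ η u : ℝ, ‖cexp (2 * Real.pi * I * b * η) *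
      cexp (-((Real.pi * (1 + η ^ 2) : ℝ) * u))‖ = Real.exp (-(Real.pi * (1 + η ^ 2) * u)) := by
    intro η u
    have : (2 * Real.pi * I * b * η : ℂ) = ((2 * Real.pi * b * η : ℝ) : ℂ) * I := by
      push_cast; ring
    rw [norm_mul, this, norm_exp_ofReal_mul_I, one_mul, Complex.norm_exp, ← ofReal_mul, ← ofReal_neg, ofReal_re]
  rw [integral_integral_swap]
  · refine setIntegral_congr_fun measurableSet_Ioi fun u hu => ?_
    have hu' : (0 : ℝ) < u := hu
    have hG := integral_cexp_quadratic (b := -(Real.pi * u : ℂ)) (by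
      rw [← ofReal_mul, neg_re, ofReal_re]; simpa using mul_pos hpi hu') (2 * Real.pi * I * b) (-(Real.pi * u))
    calc ∫ η : ℝ, cexp (2 * Real.pi * I * b * η) * cexp (-((Real.pi * (1 + η ^ 2) : ℝ) * u))
        = ∫ η : ℝ, cexp (-(Real.pi * u) * (η : ℂ) ^ 2 + 2 * Real.pi * I * b * η + -(Real.pi * u)) := by
          refine integral_congr_ae (Eventually.of_forall fun η => ?_)
          simp only [← Complex.exp_add]
          congr 1; push_cast; ring
      _ = _ := by
          rw [hG]
          have hp : (Real.pi : ℂ) ≠ 0 := by exact_mod_cast hpi.ne'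
          have hu0 : (u : ℂ) ≠ 0 := by exact_mod_cast hu'.ne'
          have e3 : (Real.pi / - -(Real.pi * u) : ℂ) = ((u⁻¹ : ℝ) : ℂ) := by
            push_cast; field_simp
          have e4 : (1 / 2 : ℂ) = ((1 / 2 : ℝ) : ℂ) := by push_cast; ring
          rw [e3, e4, ← ofReal_cpow (by positivity), Real.inv_rpow hu'.le, ← Real.rpow_neg hu'.le,
            mul_assoc (u ^ (-(1 / 2) : ℝ)) (Real.exp _), ← Real.exp_add, ofReal_mul, ofReal_exp]
          congr 2
          push_cast
          field_simp
          ring_nf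
          rw [I_sq]; ring
  · refine (integrable_prod_iff' hmeas).2 ?_
    constructor
    · filter_upwards [ae_restrict_mem measurableSet_Ioi] with u hu
      have hu' : (0 : ℝ) < u := hu
      have hg := (integrable_exp_neg_mul_sq (b := Real.pi * u) (by positivity)).const_mul
        (Real.exp (-(Real.pi * u)))
      refine Integrable.mono' hg ?_ (Eventually.of_forall fun η => ?_)
      · refine Continuous.aestronglyMeasurable ?_
        fun_prop
      · rw [hnorm, ← Real.exp_add]
        refine le_of_eq ?_
        congr 1; ring
    · have := integrableOn_rpow_mul_exp (b := -(1/2)) (c := Real.pi) (by norm_num) hpi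
      refine this.congr_fun (fun u hu => ?_) measurableSet_Ioi
      simp only [hnorm]
      exact (gauss u hu).symm

/-! ### The Poisson kernel with complex parameter -/

theorem integrable_exp_neg_mul_norm {d : ℕ} (hd : 1 ≤ d) {c : ℝ} (hc : 0 < c) :
    Integrable fun x : Space d => Real.exp (-(c * ‖x‖)) := by
  have : Nonempty (Fin d) := ⟨⟨0, hd⟩⟩
  rw [integrable_fun_norm_addHaar (μ := (volume : Measure (Space d)))
    (f := fun r => Real.exp (-(c * r)))]
  have hdm : Module.finrank ℝ (Space d) = d := by simp
  have := integrableOn_rpow_mul_exp (b := ((d - 1 : ℕ) : ℝ)) (c := c)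
    (lt_of_lt_of_le (by norm_num) (Nat.cast_nonneg _)) hc
  refine this.congr_fun (fun u _ => ?_) measurableSet_Ioi
  simp [hdm, Real.rpow_natCast]

/-- The complexified Poisson kernel `∫ exp(2πi x·ξ - 2πz|ξ|) dξ` as an explicit function. -/
def poissonKernel (d : ℕ) (z : ℂ) (r : ℝ) : ℂ :=
  ((Real.pi ^ (-(((d : ℝ) + 1) / 2)) * Real.Gamma (((d : ℝ) + 1) / 2) : ℝ) : ℂ) * z *
    (z ^ 2 + r ^ 2) ^ (-((((d : ℝ) + 1) / 2 : ℝ) : ℂ))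

/-- The imaginary part is `2 Re z Im z`, nonzero unless `z` is real, and then the sum is positive.
Hence the principal power in `poissonKernel` is holomorphic on the whole right half plane, and no
branch has to be tracked as the parameter runs along `1 - it`. -/
theorem sq_add_sq_mem_slitPlane {z : ℂ} (hz : 0 < z.re) (r : ℝ) :
    z ^ 2 + (r : ℂ) ^ 2 ∈ slitPlane := by
  rw [mem_slitPlane_iff]
  by_cases h : z.im = 0
  · left
    have : (z ^ 2 + (r : ℂ) ^ 2).re = z.re ^ 2 + r ^ 2 := by simp [sq, h]
    rw [this]
    positivity
  · right
    have : (z ^ 2 + (r : ℂ) ^ 2).im = 2 * (z.re * z.im) := by simp [sq]; ring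
    rw [this]
    exact mul_ne_zero two_ne_zero (mul_ne_zero hz.ne' h)

/-- The Poisson kernel for a real parameter. -/
theorem integral_cexp_poisson_ofReal {d : ℕ} (hd : 1 ≤ d) (x : Space d) {a : ℝ} (ha : 0 < a) :
    ∫ ξ : Space d, cexp (-((a : ℂ) * (2 * Real.pi * ‖ξ‖ : ℝ))) * cexp (2 * Real.pi * I * (inner ℝ x ξ : ℝ))
      = poissonKernel d a ‖x‖ := by
  have hpi := Real.pi_pos
  have hdm : Module.finrank ℝ (Space d) = d := by simp
  -- The subordination integrand at `b = a‖ξ‖`: for fixed `u` it is Gaussian in `ξ`, so the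
  -- `ξ`-integral can be done in closed form and the remaining `u`-integral is of Gamma type.
  set κ : ℝ → Space d → ℝ := fun u ξ => u ^ (-(1 / 2) : ℝ) * Real.exp (-(Real.pi * u)) *
    Real.exp (-(Real.pi * (a * ‖ξ‖) ^ 2 / u)) with hκ
  have e1 : ∀ ξ : Space d, cexp (-((a : ℂ) * (2 * Real.pi * ‖ξ‖ : ℝ))) *
      cexp (2 * Real.pi * I * (inner ℝ x ξ : ℝ)) = ∫ u in Set.Ioi (0 : ℝ),
        (κ u ξ : ℂ) * cexp (2 * Real.pi * I * (inner ℝ x ξ : ℝ)) := by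
    intro ξ
    rw [integral_mul_const, ← exp_neg_eq_integral_gaussian (by positivity), ofReal_exp]
    congr 2; push_cast; ring
  simp_rw [e1]
  have hκm : Measurable fun p : Space d × ℝ => κ p.2 p.1 := by fun_prop
  have hmeas : AEStronglyMeasurable (fun p : Space d × ℝ => (κ p.2 p.1 : ℂ) *
      cexp (2 * Real.pi * I * (inner ℝ x p.1 : ℝ)))
      ((volume : Measure (Space d)).prod (volume.restrict (Set.Ioi 0))) := by
    refine Measurable.aestronglyMeasurable ?_
    refine (Complex.measurable_ofReal.comp hκm).mul ?_
    fun_prop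
  have hnorm : ∀ (ξ : Space d) (u : ℝ), 0 < u →
      ‖(κ u ξ : ℂ) * cexp (2 * Real.pi * I * (inner ℝ x ξ : ℝ))‖ = κ u ξ := by
    intro ξ u hu
    have : (2 * Real.pi * I * (inner ℝ x ξ : ℝ) : ℂ) = ((2 * Real.pi * inner ℝ x ξ : ℝ) : ℂ) * I := by
      push_cast; ring
    rw [norm_mul, this, norm_exp_ofReal_mul_I, mul_one, norm_real, Real.norm_of_nonneg]
    simp only [hκ]; positivity
  have hκeq : ∀ (u : ℝ) (ξ : Space d), κ u ξ = u ^ (-(1 / 2) : ℝ) * Real.exp (-(Real.pi * u)) *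
      Real.exp (-(Real.pi * a ^ 2 / u) * ‖ξ‖ ^ 2) := by
    intro u ξ; simp only [hκ]; congr 2; ring
  have hκint : ∀ u : ℝ, 0 < u → Integrable (κ u) := by
    intro u hu
    have := (GaussianFourier.integrable_cexp_neg_mul_sq_norm_add (V := Space d)
      (b := ((Real.pi * a ^ 2 / u : ℝ) : ℂ)) (by rw [ofReal_re]; positivity) 0 0).re
    refine (this.const_mul (u ^ (-(1 / 2) : ℝ) * Real.exp (-(Real.pi * u)))).congr
      (Eventually.of_forall fun ξ => ?_)
    rw [hκeq]
    simp only [zero_mul, add_zero]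
    rw [show (-((Real.pi * a ^ 2 / u : ℝ) : ℂ) * (‖ξ‖ : ℂ) ^ 2 : ℂ)
      = ((-(Real.pi * a ^ 2 / u) * ‖ξ‖ ^ 2 : ℝ) : ℂ) by push_cast; ring, ← ofReal_exp]
    rfl
  have hrpow : ∀ u : ℝ, 0 < u → (Real.pi / (Real.pi * a ^ 2 / u)) ^ ((d : ℝ) / 2)
      = a ^ (-(d : ℝ)) * u ^ ((d : ℝ) / 2) := by
    intro u hu
    rw [show Real.pi / (Real.pi * a ^ 2 / u) = (a ^ 2)⁻¹ * u by field_simp,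
      Real.mul_rpow (by positivity) hu.le, Real.inv_rpow (by positivity), ← Real.rpow_natCast a 2,
      ← Real.rpow_mul ha.le, Real.rpow_neg ha.le]
    congr 3; push_cast; ring
  have hu2 : ∀ u : ℝ, 0 < u → u ^ (-(1 / 2) : ℝ) * u ^ ((d : ℝ) / 2) = u ^ (((d : ℝ) + 1) / 2 - 1) := by
    intro u hu
    rw [← Real.rpow_add hu]; congr 1; ring
  have hκI : ∀ u : ℝ, 0 < u → ∫ ξ, κ u ξ =
      a ^ (-(d : ℝ)) * (u ^ (((d : ℝ) + 1) / 2 - 1) * Real.exp (-(Real.pi * u))) := by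
    intro u hu
    simp_rw [hκeq]
    rw [integral_const_mul, GaussianFourier.integral_rexp_neg_mul_sq_norm (by positivity), hdm,
      hrpow u hu, ← hu2 u hu]
    ring
  have hd0 : (0 : ℝ) < ((d : ℝ) + 1) / 2 := by positivity
  rw [integral_integral_swap]
  · have e2 : ∀ u ∈ Set.Ioi (0 : ℝ), ∫ ξ : Space d, (κ u ξ : ℂ) *
        cexp (2 * Real.pi * I * (inner ℝ x ξ : ℝ)) = ((a ^ (-(d : ℝ)) : ℝ) : ℂ) *
        (cexp (-(((Real.pi * (1 + ‖x‖ ^ 2 / a ^ 2) : ℝ) : ℂ) * u)) *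
          ((u ^ (((d : ℝ) + 1) / 2 - 1) : ℝ) : ℂ)) := by
      intro u hu
      have hu' : (0 : ℝ) < u := hu
      have hG := GaussianFourier.integral_cexp_neg_mul_sq_norm_add (V := Space d)
        (b := ((Real.pi * a ^ 2 / u : ℝ) : ℂ)) (by rw [ofReal_re]; positivity) (2 * Real.pi * I) x
      calc _ = ∫ ξ : Space d, ((u ^ (-(1 / 2) : ℝ) * Real.exp (-(Real.pi * u)) : ℝ) : ℂ) *
            cexp (-((Real.pi * a ^ 2 / u : ℝ) : ℂ) * ‖ξ‖ ^ 2 + 2 * Real.pi * I * (inner ℝ x ξ : ℝ)) := by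
            refine integral_congr_ae (Eventually.of_forall fun ξ => ?_)
            simp only [hκeq]
            rw [Complex.exp_add]
            push_cast
            ring
        _ = _ := by
            have hp : (Real.pi : ℂ) ≠ 0 := by exact_mod_cast hpi.ne'
            have hu0 : (u : ℂ) ≠ 0 := by exact_mod_cast hu'.ne'
            have ha0 : (a : ℂ) ≠ 0 := by exact_mod_cast ha.ne'
            rw [integral_const_mul, hG, hdm, ← ofReal_div,
              show ((d : ℂ) / 2) = (((d : ℝ) / 2 : ℝ) : ℂ) by push_cast; ring,
              ← ofReal_cpow (by positivity), hrpow u hu', ← hu2 u hu']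
            rw [show (2 * Real.pi * I) ^ 2 * (‖x‖ : ℂ) ^ 2 / (4 * ((Real.pi * a ^ 2 / u : ℝ) : ℂ)) =
              ((-(Real.pi * u * (‖x‖ ^ 2 / a ^ 2)) : ℝ) : ℂ) by
                push_cast; field_simp; rw [I_sq]; ring]
            rw [show (-(((Real.pi * (1 + ‖x‖ ^ 2 / a ^ 2) : ℝ) : ℂ) * u)) =
              ((-(Real.pi * u) : ℝ) : ℂ) + ((-(Real.pi * u * (‖x‖ ^ 2 / a ^ 2)) : ℝ) : ℂ) by
                push_cast; ring, Complex.exp_add, ← ofReal_exp, ← ofReal_exp]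
            push_cast
            ring
    rw [setIntegral_congr_fun measurableSet_Ioi e2, integral_const_mul,
      integral_rpow_mul_cexp_neg_mul hd0 (by rw [ofReal_re]; positivity)]
    rw [poissonKernel]
    rw [show ((a : ℂ) ^ 2 + (‖x‖ : ℂ) ^ 2) = ((a ^ 2 * (1 + ‖x‖ ^ 2 / a ^ 2) : ℝ) : ℂ) by
      push_cast; field_simp [show (a : ℂ) ≠ 0 by exact_mod_cast ha.ne']]
    simp only [← ofReal_neg]
    rw [← ofReal_cpow (by positivity), ← ofReal_cpow (by positivity), Real.mul_rpow hpi.le (by positivity),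
      Real.mul_rpow (by positivity) (by positivity), ← Real.rpow_natCast a 2, ← Real.rpow_mul ha.le]
    -- Extracting `a²` from `(a² + |x|²)^(-(d+1)/2)` leaves `a^(-(d+1))`; the explicit factor `z =
    -- a` of the kernel turns it into the `a^(-d)` of the Gaussian integrals.
    have e5 : a ^ (-(d : ℝ)) = a * a ^ (((2 : ℕ) : ℝ) * -(((d : ℝ) + 1) / 2)) := by
      nth_rewrite 2 [← Real.rpow_one a]
      rw [← Real.rpow_add ha]; congr 1; push_cast; ring
    rw [e5]
    push_cast
    ring
  · refine (integrable_prod_iff' hmeas).2 ⟨?_, ?_⟩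
    · filter_upwards [ae_restrict_mem measurableSet_Ioi] with u hu
      refine (hκint u hu).mono' ?_ (Eventually.of_forall fun ξ => ?_)
      · refine Measurable.aestronglyMeasurable ?_
        refine (Complex.measurable_ofReal.comp (hκm.comp (by fun_prop : Measurable fun ξ : Space d => (ξ, u)))).mul ?_
        fun_prop
      · exact (hnorm ξ u hu).le
    · have hI : IntegrableOn (fun u : ℝ => a ^ (-(d : ℝ)) * (u ^ (((d : ℝ) + 1) / 2 - 1) *
          Real.exp (-(Real.pi * u)))) (Set.Ioi 0) :=
        (integrableOn_rpow_mul_exp (b := ((d : ℝ) + 1) / 2 - 1) (by linarith) hpi).const_mul _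
      refine hI.congr_fun (fun u hu => ?_) measurableSet_Ioi
      refine Eq.trans (hκI u hu).symm ?_
      exact integral_congr_ae (Eventually.of_forall fun ξ => (hnorm ξ u hu).symm)

/-- The complexified Poisson kernel formula. -/
theorem integral_cexp_poisson {d : ℕ} (hd : 1 ≤ d) (x : Space d) {z : ℂ} (hz : 0 < z.re) :
    ∫ ξ : Space d, cexp (-(z * (2 * Real.pi * ‖ξ‖ : ℝ))) * cexp (2 * Real.pi * I * (inner ℝ x ξ : ℝ))
      = poissonKernel d z ‖x‖ := by
  refine eqOn_rightHalfPlane_of_ofReal (F := fun z => ∫ ξ : Space d,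
    cexp (-(z * (2 * Real.pi * ‖ξ‖ : ℝ))) * cexp (2 * Real.pi * I * (inner ℝ x ξ : ℝ)))
    (G := fun z => poissonKernel d z ‖x‖) ?_ ?_ (fun a ha => integral_cexp_poisson_ofReal hd x ha) hz
  · refine differentiableOn_laplace (Continuous.aestronglyMeasurable (by fun_prop))
      (Eventually.of_forall fun ξ => by positivity) (fun a ha => ?_)
      (Continuous.aestronglyMeasurable (by fun_prop))
    refine (integrable_exp_neg_mul_norm hd (c := a * (2 * Real.pi)) (by positivity)).mono'
      (Continuous.aestronglyMeasurable (by fun_prop)) (Eventually.of_forall fun ξ => ?_)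
    have : (2 * Real.pi * I * (inner ℝ x ξ : ℝ) : ℂ) = ((2 * Real.pi * inner ℝ x ξ : ℝ) : ℂ) * I := by
      push_cast; ring
    rw [norm_mul, this, norm_exp_ofReal_mul_I, mul_one, Complex.norm_exp, ← ofReal_mul, ← ofReal_neg,
      ofReal_re]
    refine le_of_eq ?_
    congr 1; ring
  · intro w hw
    refine DifferentiableAt.differentiableWithinAt ?_
    unfold poissonKernel
    refine ((differentiableAt_const _).mul differentiableAt_id).mul ?_
    refine DifferentiableAt.cpow_const ?_ (sq_add_sq_mem_slitPlane hw _)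
    fun_prop

/-! ### Agreement of the integral and `L²` Fourier transforms -/

section L1L2
variable {V : Type*} [NormedAddCommGroup V] [InnerProductSpace ℝ V] [FiniteDimensional ℝ V]
    [MeasurableSpace V] [BorelSpace V]

theorem integral_fourierInv_mul_eq_flip {f g : V → ℂ} (hf : Integrable f) (hg : Integrable g) :
    ∫ x, 𝓕⁻ f x * g x = ∫ x, f x * 𝓕⁻ g x := by
  have := VectorFourier.integral_fourierIntegral_smul_eq_flip (L := -innerₗ V) (μ := volume)
    (ν := volume) (e := Real.fourierChar) (f := f) (g := g) Real.continuous_fourierChar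
    (by simp only [LinearMap.neg_apply, innerₗ_apply_apply]; fun_prop) hf hg
  have hflip : (-innerₗ V : V →ₗ[ℝ] V →ₗ[ℝ] ℝ).flip = -innerₗ V := by
    ext x y; simp [real_inner_comm]
  rw [hflip] at this
  exact this

theorem continuous_fourierInv {f : V → ℂ} (hf : Integrable f) : Continuous (𝓕⁻ f : V → ℂ) :=
  VectorFourier.fourierIntegral_continuous (L := -innerₗ V) Real.continuous_fourierChar
    (by simp only [LinearMap.neg_apply, innerₗ_apply_apply]; fun_prop) hf

/-- On `L¹ ∩ L²` the `L²` inverse Fourier transform is given by the Fourier integral. -/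
theorem fourierInv_toLp_ae_eq {h : V → ℂ} (h1 : Integrable h) (h2 : MemLp h 2) :
    (𝓕⁻ (h2.toLp h) : Lp ℂ 2 (volume : Measure V)) =ᵐ[volume] (𝓕⁻ h : V → ℂ) := by
  refine ae_eq_of_integral_contDiff_smul_eq
    ((Lp.memLp (𝓕⁻ (h2.toLp h) : Lp ℂ 2 (volume : Measure V))).locallyIntegrable (by norm_num))
    (continuous_fourierInv h1).locallyIntegrable ?_
  intro g g_smooth g_cpt
  have hg₁ : HasCompactSupport (Complex.ofRealCLM ∘ g) := g_cpt.comp_left rfl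
  have hg₂ : ContDiff ℝ ((⊤ : ℕ∞) : WithTop ℕ∞) (Complex.ofRealCLM ∘ g) :=
    Complex.ofRealCLM.contDiff.comp g_smooth
  set φ : 𝓢(V, ℂ) := hg₁.toSchwartzMap hg₂ with hφ
  have hφg : ∀ x, φ x = (g x : ℂ) := fun x => rfl
  have key := congrArg (fun T : 𝓢'(V, ℂ) => T φ)
    (Lp.fourierInv_toTemperedDistribution_eq (h2.toLp h))
  simp only [TemperedDistribution.fourierInv_apply, Lp.toTemperedDistribution_apply] at key
  calc ∫ x, g x • (𝓕⁻ (h2.toLp h) : Lp ℂ 2 (volume : Measure V)) x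
      = ∫ x, φ x • (𝓕⁻ (h2.toLp h) : Lp ℂ 2 (volume : Measure V)) x := by
        simp only [hφg, real_smul, smul_eq_mul]
    _ = ∫ x, (𝓕⁻ φ) x • h2.toLp h x := key.symm
    _ = ∫ x, (𝓕⁻ (φ : V → ℂ)) x * h x := by
        rw [← SchwartzMap.fourierInv_coe]
        refine integral_congr_ae ?_
        filter_upwards [h2.coeFn_toLp] with x hx
        rw [hx, smul_eq_mul]
    _ = ∫ x, φ x * (𝓕⁻ h) x := integral_fourierInv_mul_eq_flip φ.integrable h1
    _ = _ := by simp only [hφg, real_smul]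

/-- The integral represents the `L²` inverse transform, which is injective. -/
theorem ae_eq_zero_of_fourierInv_eq_zero {h : V → ℂ} (h1 : Integrable h) (h2 : MemLp h 2)
    (h0 : ∀ x, (𝓕⁻ h : V → ℂ) x = 0) : h =ᵐ[volume] 0 := by
  have h3 : (𝓕⁻ (h2.toLp h) : Lp ℂ 2 (volume : Measure V)) = 0 := by
    rw [Lp.eq_zero_iff_ae_eq_zero]
    filter_upwards [fourierInv_toLp_ae_eq h1 h2] with x hx
    rw [hx, h0]; rfl
  have h4 : h2.toLp h = 0 := by
    rw [← FourierTransform.fourier_fourierInv_eq (F := Lp ℂ 2 (volume : Measure V)) (h2.toLp h), h3,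
      FourierTransform.fourier_zero]
  have := (Lp.eq_zero_iff_ae_eq_zero).1 h4
  exact h2.coeFn_toLp.symm.trans this

end L1L2

/-! ### Poisson functions: evolution and density -/

section Poisson
variable {d : ℕ}

/-- The Fourier transform of the Poisson function centered at `y`. -/
def poissonSymbol (y : Space d) (ξ : Space d) : ℂ :=
  cexp (-(2 * Real.pi * ‖ξ‖ : ℝ)) * cexp (-(2 * Real.pi * I * (inner ℝ y ξ : ℝ)))

theorem norm_cexp_two_pi_I (r : ℝ) : ‖cexp (2 * Real.pi * I * r)‖ = 1 := by
  rw [show (2 * Real.pi * I * r : ℂ) = ((2 * Real.pi * r : ℝ) : ℂ) * I by push_cast; ring,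
    norm_exp_ofReal_mul_I]

theorem norm_cexp_neg_two_pi_I (r : ℝ) : ‖cexp (-(2 * Real.pi * I * r))‖ = 1 := by
  have := norm_cexp_two_pi_I (-r)
  rw [← this]; congr 2; push_cast; ring

theorem norm_poissonSymbol (y ξ : Space d) :
    ‖poissonSymbol y ξ‖ = Real.exp (-(2 * Real.pi * ‖ξ‖)) := by
  rw [poissonSymbol, norm_mul, norm_cexp_neg_two_pi_I, mul_one, Complex.norm_exp, neg_re, ofReal_re]

theorem continuous_poissonSymbol (y : Space d) : Continuous (poissonSymbol y) := by
  unfold poissonSymbol; fun_prop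

theorem memLp_two_of_norm_le_exp (hd : 1 ≤ d) {h : Space d → ℂ} (hm : AEStronglyMeasurable h)
    (hb : ∀ ξ, ‖h ξ‖ ≤ Real.exp (-(2 * Real.pi * ‖ξ‖))) : Integrable h ∧ MemLp h 2 := by
  have hpi := Real.pi_pos
  constructor
  · exact (integrable_exp_neg_mul_norm hd (c := 2 * Real.pi) (by positivity)).mono' hm
      (Eventually.of_forall hb)
  · rw [memLp_two_iff_integrable_sq_norm hm]
    refine (integrable_exp_neg_mul_norm hd (c := 2 * (2 * Real.pi)) (by positivity)).mono'
      (by fun_prop) (Eventually.of_forall fun ξ => ?_)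
    rw [Real.norm_of_nonneg (by positivity)]
    calc ‖h ξ‖ ^ 2 ≤ Real.exp (-(2 * Real.pi * ‖ξ‖)) ^ 2 := by gcongr; exact hb ξ
      _ = _ := by rw [← Real.exp_nat_mul]; congr 1; push_cast; ring

theorem memLp_poissonSymbol (hd : 1 ≤ d) (y : Space d) : MemLp (poissonSymbol y) 2 volume :=
  (memLp_two_of_norm_le_exp hd (continuous_poissonSymbol y).aestronglyMeasurable
    fun ξ => (norm_poissonSymbol y ξ).le).2

/-- The Poisson function centered at `y`. -/
def poissonFn (hd : 1 ≤ d) (y : Space d) : L2 d := 𝓕⁻ ((memLp_poissonSymbol hd y).toLp)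

theorem fourier_poissonFn (hd : 1 ≤ d) (y : Space d) :
    (𝓕 (poissonFn hd y) : L2 d) =ᵐ[volume] poissonSymbol y := by
  rw [poissonFn, FourierTransform.fourier_fourierInv_eq]
  exact (memLp_poissonSymbol hd y).coeFn_toLp

/-- The half-wave group acts explicitly on Poisson functions. -/
theorem halfWave_poissonFn (hd : 1 ≤ d) (y : Space d) (t : ℝ) :
    halfWave t (poissonFn hd y) =ᵐ[volume] fun x => poissonKernel d (1 - I * t) ‖x - y‖ := by
  have hpi := Real.pi_pos
  set h : Space d → ℂ := fun ξ => cexp (I * (t * ‖(2 * Real.pi) • ξ‖ : ℝ)) * poissonSymbol y ξ with hh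
  have hn : ∀ ξ, ‖h ξ‖ ≤ Real.exp (-(2 * Real.pi * ‖ξ‖)) := by
    intro ξ
    rw [hh, norm_mul, mul_comm I, norm_exp_ofReal_mul_I, one_mul, norm_poissonSymbol]
  have hm : AEStronglyMeasurable h := by
    refine Continuous.aestronglyMeasurable ?_
    exact (by fun_prop : Continuous fun ξ : Space d =>
      cexp (I * (t * ‖(2 * Real.pi) • ξ‖ : ℝ))).mul (continuous_poissonSymbol y)
  obtain ⟨h1, h2⟩ := memLp_two_of_norm_le_exp hd hm hn
  have e1 : halfWave t (poissonFn hd y) = 𝓕⁻ (h2.toLp h) := by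
    rw [halfWave]
    congr 1
    refine (MemLp.toLp_eq_toLp_iff _ _).2 ?_
    filter_upwards [fourier_poissonFn hd y] with ξ hξ
    rw [hξ]
  rw [e1]
  refine (fourierInv_toLp_ae_eq h1 h2).trans (Eventually.of_forall fun x => ?_)
  simp only
  -- The phase `exp(2πit|ξ|)` and the weight `exp(-2π|ξ|)` combine to `exp(-2π(1 - it)|ξ|)`, whose
  -- parameter has real part `1`.
  rw [Real.fourierInv_eq', ← integral_cexp_poisson hd (x - y) (z := 1 - I * t) (by simp)]
  refine integral_congr_ae (Eventually.of_forall fun ξ => ?_)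
  simp only [hh, poissonSymbol, smul_eq_mul, ← Complex.exp_add]
  congr 1
  rw [inner_sub_left, norm_smul, Real.norm_of_nonneg (by positivity), real_inner_comm x ξ]
  push_cast
  ring

/-- Poisson functions span a dense subspace of `L²`. -/
theorem dense_span_poissonFn (hd : 1 ≤ d) :
    (Submodule.span ℂ (Set.range (poissonFn hd))).topologicalClosure = ⊤ := by
  rw [Submodule.topologicalClosure_eq_top_iff, Submodule.eq_bot_iff]
  intro g hg
  rw [Submodule.mem_orthogonal] at hg
  have hG := Lp.memLp (𝓕 g : L2 d)
  -- By Plancherel, orthogonality of `g` to the Poisson function at `y` says that the inverse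
  -- transform of `h = exp(-2π|ξ|) ĝ` vanishes at `y`. As a product of two `L²` functions `h` is
  -- integrable, so this holds pointwise for every `y` and forces `h = 0`.
  set h : Space d → ℂ := fun ξ => (starRingEnd ℂ) (cexp (-(2 * Real.pi * ‖ξ‖ : ℝ))) * (𝓕 g : L2 d) ξ with hh
  have hpi := Real.pi_pos
  have hE : MemLp (fun ξ : Space d => (starRingEnd ℂ) (cexp (-(2 * Real.pi * ‖ξ‖ : ℝ)))) 2 volume := by
    refine (memLp_two_of_norm_le_exp hd (Continuous.aestronglyMeasurable (by fun_prop)) fun ξ => ?_).2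
    rw [RCLike.norm_conj, Complex.norm_exp, neg_re, ofReal_re]
  have h1 : Integrable h := hE.integrable_mul hG
  have h2 : MemLp h 2 volume := by
    refine hG.of_le h1.1 (Eventually.of_forall fun ξ => ?_)
    rw [hh, norm_mul, RCLike.norm_conj, Complex.norm_exp, neg_re, ofReal_re]
    refine mul_le_of_le_one_left (norm_nonneg _) ?_
    rw [Real.exp_le_one_iff]
    have : 0 ≤ 2 * Real.pi * ‖ξ‖ := by positivity
    linarith
  have h0 : ∀ y, (𝓕⁻ h : Space d → ℂ) y = 0 := by
    intro y
    have := hg _ (Submodule.subset_span ⟨y, rfl⟩)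
    rw [← Lp.inner_fourier_eq, L2.inner_def] at this
    rw [Real.fourierInv_eq', ← this]
    refine integral_congr_ae ?_
    filter_upwards [fourier_poissonFn hd y] with ξ hξ
    rw [hξ, hh]
    simp only [poissonSymbol, RCLike.inner_apply, map_mul, smul_eq_mul]
    rw [mul_comm ((𝓕 g : L2 d) ξ), ← mul_assoc]
    congr 1
    rw [mul_comm]
    congr 1
    rw [← Complex.exp_conj]
    congr 1
    simp only [map_neg, map_mul, conj_I, conj_ofReal, real_inner_comm ξ y, map_ofNat]
    push_cast
    ring
  have h3 := ae_eq_zero_of_fourierInv_eq_zero h1 h2 h0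
  have h4 : (𝓕 g : L2 d) = 0 := by
    rw [Lp.eq_zero_iff_ae_eq_zero]
    filter_upwards [h3] with ξ hξ
    simp only [hh, Pi.zero_apply, mul_eq_zero] at hξ
    refine hξ.resolve_left ?_
    simp
  rw [← FourierTransform.fourierInv_fourier_eq (F := L2 d) g, h4, FourierTransform.fourierInv_zero]

end Poisson

/-! ### Polar coordinates around the light cone -/

section Polar
variable {d : ℕ}

/-- The product measure on `ℝ × S^{d-1}`. -/
abbrev cylMeasure (d : ℕ) : Measure (ℝ × Sph d) := (volume : Measure ℝ).prod (sphMeasure d)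

theorem lintegral_polar (hd : 1 ≤ d) {h : Space d → ℝ≥0∞} (hh : Measurable h) :
    ∫⁻ p in {p : ℝ × Sph d | 0 < p.1}, ENNReal.ofReal (|p.1| ^ (d - 1)) * h (p.1 • (p.2 : Space d))
      ∂(cylMeasure d) = ∫⁻ x, h x := by
  have : Nonempty (Fin d) := ⟨⟨0, hd⟩⟩
  have hdm : Module.finrank ℝ (Space d) = d := by simp
  have hset : {p : ℝ × Sph d | 0 < p.1} = Set.Ioi 0 ×ˢ Set.univ := by ext p; simp
  have hmp := (volume : Measure (Space d)).measurePreserving_homeomorphUnitSphereProd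
  symm
  calc ∫⁻ x, h x = ∫⁻ x in ({0}ᶜ : Set (Space d)), h x := by
        rw [restrict_compl_singleton]
    _ = ∫⁻ x : ({0}ᶜ : Set (Space d)), h x ∂((volume : Measure (Space d)).comap (↑)) := by
        rw [lintegral_subtype_comap (measurableSet_singleton _).compl]
    _ = ∫⁻ q, h ((q.2 : ℝ) • (q.1 : Space d)) ∂((sphMeasure d).prod (Measure.volumeIoiPow (d - 1))) := by
        rw [hdm] at hmp
        rw [← hmp.lintegral_comp (by fun_prop)]
        refine lintegral_congr fun x => ?_
        have hx : (x : Space d) ≠ 0 := x.2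
        simp [smul_smul, hx]
    _ = ∫⁻ ω : Sph d, (∫⁻ r, h ((r : ℝ) • (ω : Space d)) ∂(Measure.volumeIoiPow (d - 1))) ∂(sphMeasure d) :=
        lintegral_prod _ (by fun_prop)
    _ = ∫⁻ ω : Sph d, (∫⁻ r in Set.Ioi (0 : ℝ), ENNReal.ofReal (|r| ^ (d - 1)) * h (r • (ω : Space d)))
          ∂(sphMeasure d) := by
        refine lintegral_congr fun ω => ?_
        rw [Measure.volumeIoiPow, lintegral_withDensity_eq_lintegral_mul _ (by fun_prop) (by fun_prop)]
        rw [← lintegral_subtype_comap measurableSet_Ioi]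
        refine lintegral_congr fun r => ?_
        have : (0 : ℝ) < r := r.2
        simp [abs_of_pos this]
    _ = _ := by
        rw [hset, ← Measure.prod_restrict, Measure.restrict_univ, lintegral_prod_symm' _ (by fun_prop)]

theorem measurePreserving_cyl_neg :
    MeasurePreserving (fun p : ℝ × Sph d => (-p.1, p.2)) (cylMeasure d) (cylMeasure d) :=
  (Measure.measurePreserving_neg (volume : Measure ℝ)).prod (MeasurePreserving.id _)

theorem measurePreserving_cyl_add (t : ℝ) :
    MeasurePreserving (fun p : ℝ × Sph d => (p.1 + t, p.2)) (cylMeasure d) (cylMeasure d) :=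
  (measurePreserving_add_right (volume : Measure ℝ) t).prod (MeasurePreserving.id _)

theorem lintegral_polar_neg (hd : 1 ≤ d) {h : Space d → ℝ≥0∞} (hh : Measurable h) :
    ∫⁻ p in {p : ℝ × Sph d | p.1 < 0}, ENNReal.ofReal (|p.1| ^ (d - 1)) * h (p.1 • (p.2 : Space d))
      ∂(cylMeasure d) = ∫⁻ x, h x := by
  have h1 := lintegral_polar hd (h := fun x => h (-x)) (by fun_prop)
  rw [(Measure.measurePreserving_neg (volume : Measure (Space d))).lintegral_comp hh] at h1
  rw [← h1]
  have hs : MeasurableSet {p : ℝ × Sph d | p.1 < 0} := measurableSet_lt measurable_fst measurable_const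
  have := (measurePreserving_cyl_neg (d := d)).setLIntegral_comp_preimage hs
    (f := fun p => ENNReal.ofReal (|p.1| ^ (d - 1)) * h (p.1 • (p.2 : Space d))) (by fun_prop)
  rw [← this]
  have e : (fun p : ℝ × Sph d => (-p.1, p.2)) ⁻¹' {p : ℝ × Sph d | p.1 < 0} = {p | 0 < p.1} := by
    ext p; simp
  rw [e]
  simp

theorem lintegral_polar_shift (hd : 1 ≤ d) (t : ℝ) {h : Space d → ℝ≥0∞} (hh : Measurable h) :
    ∫⁻ p in {p : ℝ × Sph d | 0 < p.1 + t}, ENNReal.ofReal (|p.1 + t| ^ (d - 1)) *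
      h ((p.1 + t) • (p.2 : Space d)) ∂(cylMeasure d) = ∫⁻ x, h x := by
  rw [← lintegral_polar hd hh]
  have hs : MeasurableSet {p : ℝ × Sph d | 0 < p.1} := measurableSet_lt measurable_const measurable_fst
  exact (measurePreserving_cyl_add (d := d) t).setLIntegral_comp_preimage hs
    (f := fun p => ENNReal.ofReal (|p.1| ^ (d - 1)) * h (p.1 • (p.2 : Space d))) (by fun_prop)

theorem measurableSet_shift (t : ℝ) : MeasurableSet {p : ℝ × Sph d | 0 < p.1 + t} :=
  measurableSet_lt measurable_const (by fun_prop)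

/-- The polar formula for the indicator of a null set shows that its preimage is null, as the
Jacobian is positive there. Almost everywhere identities on `ℝ^d` can thus be read on the cylinder.
-/
theorem quasiMeasurePreserving_shift (hd : 1 ≤ d) (t : ℝ) :
    Measure.QuasiMeasurePreserving (fun p : ℝ × Sph d => (p.1 + t) • (p.2 : Space d))
      ((cylMeasure d).restrict {p | 0 < p.1 + t}) volume := by
  refine ⟨by fun_prop, Measure.AbsolutelyContinuous.mk fun N hN hN0 => ?_⟩
  rw [Measure.map_apply (by fun_prop) hN]
  have h1 := lintegral_polar_shift hd t (h := N.indicator 1) (measurable_one.indicator hN)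
  rw [lintegral_indicator_one hN, hN0, lintegral_eq_zero_iff (by
    refine Measurable.mul (by fun_prop) ?_
    exact (measurable_one.indicator hN).comp (by fun_prop))] at h1
  rw [← compl_compl ((fun p : ℝ × Sph d => (p.1 + t) • (p.2 : Space d)) ⁻¹' N), ← mem_ae_iff]
  filter_upwards [h1, ae_restrict_mem (measurableSet_shift t)] with p hp hpt
  have hpt' : 0 < p.1 + t := hpt
  intro hpN
  have hpN' : (p.1 + t) • (p.2 : Space d) ∈ N := hpN
  simp [hpN', hpt'.ne'] at hp

/-- Frequencies of both signs are needed here. Positive radii are the unshifted polar formula,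
negative ones reduce to it by reflection, and radius `0` is null. -/
theorem quasiMeasurePreserving_smul (hd : 1 ≤ d) :
    Measure.QuasiMeasurePreserving (fun p : ℝ × Sph d => p.1 • (p.2 : Space d))
      (cylMeasure d) volume := by
  have hpos : ∀ N : Set (Space d), volume N = 0 → ∀ᵐ p ∂(cylMeasure d), 0 < p.1 →
      p.1 • (p.2 : Space d) ∉ N := by
    intro N hN
    have h1 := (quasiMeasurePreserving_shift hd 0).preimage_null hN
    rw [← compl_compl ((fun p : ℝ × Sph d => (p.1 + 0) • (p.2 : Space d)) ⁻¹' N), ← mem_ae_iff] at h1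
    have h2 := (ae_restrict_iff' (measurableSet_shift (d := d) 0)).1 h1
    simpa using h2
  refine ⟨by fun_prop, Measure.AbsolutelyContinuous.mk fun N hN hN0 => ?_⟩
  rw [Measure.map_apply (by fun_prop) hN,
    ← compl_compl ((fun p : ℝ × Sph d => p.1 • (p.2 : Space d)) ⁻¹' N), ← mem_ae_iff]
  have hneg : volume (-N) = 0 := by rw [Measure.measure_neg, hN0]
  have h2 := (measurePreserving_cyl_neg (d := d)).quasiMeasurePreserving.ae (hpos (-N) hneg)
  have h0 : ∀ᵐ p ∂(cylMeasure d), p.1 ≠ 0 :=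
    Measure.quasiMeasurePreserving_fst.ae (p := fun r : ℝ => r ≠ 0) (Measure.ae_ne volume 0)
  filter_upwards [hpos N hN0, h2, h0] with p hp1 hp2 hp0 hpN
  rcases lt_or_gt_of_ne hp0 with h | h
  · refine hp2 (by simpa using h) ?_
    simpa using hpN
  · exact hp1 h hpN

/-- The weight `r^((d-1)/2)` is the square root of the polar Jacobian; this is what makes polar
coordinates isometric in `L²`, both in space and in frequency. -/
theorem enorm_rpow_half_mul_sq (hd : 1 ≤ d) {r : ℝ} (hr : 0 < r) (c : ℂ) :
    ‖((r ^ (((d : ℝ) - 1) / 2) : ℝ) : ℂ) * c‖ₑ ^ 2 = ENNReal.ofReal (r ^ (d - 1)) * ‖c‖ₑ ^ 2 := by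
  rw [enorm_mul, mul_pow]
  congr 1
  rw [← ofReal_norm, norm_real, Real.norm_of_nonneg (by positivity),
    ← ENNReal.ofReal_pow (by positivity), ← Real.rpow_natCast, ← Real.rpow_mul hr.le,
    ← Real.rpow_natCast r (d - 1)]
  congr 2
  push_cast [Nat.cast_sub hd]
  ring

theorem eLpNorm_two_sq {α E : Type*} [MeasurableSpace α] [NormedAddCommGroup E] {μ : Measure α} (f : α → E) :
    eLpNorm f 2 μ ^ 2 = ∫⁻ x, ‖f x‖ₑ ^ 2 ∂μ := by
  have := eLpNorm_nnreal_pow_eq_lintegral (p := 2) (f := f) (μ := μ) (by norm_num)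
  simp only [NNReal.coe_ofNat, ENNReal.rpow_ofNat, ENNReal.coe_ofNat] at this
  exact this

theorem eLpNorm_two_eq_of_sq {α β E F : Type*} [MeasurableSpace α] [MeasurableSpace β]
    [NormedAddCommGroup E] [NormedAddCommGroup F] {μ : Measure α} {ν : Measure β} {f : α → E} {g : β → F}
    (h : ∫⁻ x, ‖f x‖ₑ ^ 2 ∂μ = ∫⁻ x, ‖g x‖ₑ ^ 2 ∂ν) : eLpNorm f 2 μ = eLpNorm g 2 ν := by
  rw [← eLpNorm_two_sq, ← eLpNorm_two_sq] at h
  exact (ENNReal.pow_right_strictMono two_ne_zero).injective h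

/-- `u` in polar coordinates around the light cone. -/
def polarPull (t : ℝ) (u : Space d → ℂ) (p : ℝ × Sph d) : ℂ :=
  (((p.1 + t) ^ (((d : ℝ) - 1) / 2) : ℝ) : ℂ) * u ((p.1 + t) • (p.2 : Space d))

theorem polarPull_congr_ae (hd : 1 ≤ d) (t : ℝ) {u v : Space d → ℂ} (h : u =ᵐ[volume] v) :
    polarPull t u =ᵐ[(cylMeasure d).restrict {p | 0 < p.1 + t}] polarPull t v := by
  filter_upwards [(quasiMeasurePreserving_shift hd t).ae_eq_comp h] with p hp
  simp only [Function.comp_apply] at hp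
  simp only [polarPull, hp]

theorem eLpNorm_polarPull (hd : 1 ≤ d) (t : ℝ) {u : Space d → ℂ} (hu : AEStronglyMeasurable u) :
    eLpNorm (polarPull t u) 2 ((cylMeasure d).restrict {p | 0 < p.1 + t}) = eLpNorm u 2 volume := by
  rw [eLpNorm_congr_ae (polarPull_congr_ae hd t hu.ae_eq_mk), eLpNorm_congr_ae hu.ae_eq_mk]
  refine eLpNorm_two_eq_of_sq ?_
  have hm := hu.stronglyMeasurable_mk.measurable
  rw [← lintegral_polar_shift hd t (h := fun x => ‖hu.mk u x‖ₑ ^ 2) (by fun_prop)]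
  refine setLIntegral_congr_fun (measurableSet_shift t) fun p hp => ?_
  have hp' : 0 < p.1 + t := hp
  simp only [polarPull]
  rw [enorm_rpow_half_mul_sq hd hp', abs_of_pos hp']

/-- The polar coordinates `x ↦ (|x| - t, x / |x|)` around the light cone, with a junk direction at
the origin. -/
def coneMap (hd : 1 ≤ d) (t : ℝ) (x : Space d) : ℝ × Sph d := by
  classical
  exact (‖x‖ - t, if hx : x = 0 then ⟨EuclideanSpace.single ⟨0, hd⟩ 1, by simp⟩ else direction x hx)

theorem measurable_coneMap (hd : 1 ≤ d) (t : ℝ) : Measurable (coneMap hd t) := by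
  unfold coneMap
  refine Measurable.prodMk (by fun_prop) ?_
  refine (MeasurableEmbedding.subtype_coe
    (Metric.isClosed_sphere (x := (0 : Space d)) (ε := 1)).measurableSet).measurable_comp_iff.1 ?_
  have : (Subtype.val ∘ fun x : Space d => if hx : x = 0 then
      (⟨EuclideanSpace.single ⟨0, hd⟩ 1, by simp⟩ : Sph d) else direction x hx) =
      fun x => if x = 0 then EuclideanSpace.single ⟨0, hd⟩ 1 else ‖x‖⁻¹ • x := by
    ext1 x
    by_cases hx : x = 0 <;> simp [hx, direction]
  rw [this]
  exact Measurable.ite (measurableSet_singleton 0) measurable_const (by fun_prop)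

theorem coneMap_smul (hd : 1 ≤ d) {t s : ℝ} (h : 0 < s + t) (ω : Sph d) :
    coneMap hd t ((s + t) • (ω : Space d)) = (s, ω) := by
  have hω : ‖(ω : Space d)‖ = 1 := by simp
  have hω0 : (ω : Space d) ≠ 0 := by intro h0; rw [h0] at hω; simp at hω
  have hne : (s + t) • (ω : Space d) ≠ 0 := smul_ne_zero h.ne' hω0
  rw [coneMap]
  simp only [hne, dif_neg, not_false_eq_true]
  refine Prod.ext ?_ (Subtype.ext ?_)
  · simp [norm_smul, abs_of_pos h]
  · simp [direction, norm_smul, abs_of_pos h, smul_smul, h.ne']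

theorem alongCone_eq (hd : 1 ≤ d) (P : ℝ × Sph d → ℂ) (t : ℝ) {x : Space d} (hx : x ≠ 0) :
    alongCone P t x = P (coneMap hd t x) := by
  simp [alongCone, coneMap, hx]

/-- Profiles are determined only almost everywhere; this makes their spherical waves well defined
almost everywhere. It is the polar formula for the indicator of the preimage, since `coneMap`
inverts polar coordinates. -/
theorem quasiMeasurePreserving_coneMap (hd : 1 ≤ d) (t : ℝ) :
    Measure.QuasiMeasurePreserving (coneMap hd t) volume (cylMeasure d) := by
  refine ⟨measurable_coneMap hd t, Measure.AbsolutelyContinuous.mk fun N hN hN0 => ?_⟩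
  have hm := measurable_coneMap hd t
  rw [Measure.map_apply hm hN, ← lintegral_indicator_one (hm hN),
    ← lintegral_polar_shift hd t (measurable_one.indicator (hm hN)),
    setLIntegral_congr_fun (g := fun p => ENNReal.ofReal (|p.1 + t| ^ (d - 1)) * N.indicator 1 p)
      (measurableSet_shift t), lintegral_eq_zero_iff]
  · refine ae_restrict_of_ae ?_
    filter_upwards [show Nᶜ ∈ ae (cylMeasure d) by rwa [mem_ae_iff, compl_compl]] with p hp
    have : p ∉ N := hp
    simp [this]
  · exact Measurable.mul (by fun_prop) (measurable_one.indicator hN)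
  · intro p hp
    have : coneMap hd t ((p.1 + t) • (p.2 : Space d)) = p := coneMap_smul hd hp p.2
    have h2 : ((p.1 + t) • (p.2 : Space d) ∈ coneMap hd t ⁻¹' N) = (p ∈ N) := by
      rw [Set.mem_preimage, this]
    have h3 : (coneMap hd t ⁻¹' N).indicator (1 : Space d → ℝ≥0∞) ((p.1 + t) • (p.2 : Space d))
        = N.indicator 1 p := by
      by_cases hpN : p ∈ N
      · rw [Set.indicator_of_mem hpN, Set.indicator_of_mem (h2.symm ▸ hpN)]; rfl
      · rw [Set.indicator_of_notMem hpN, Set.indicator_of_notMem (h2.symm ▸ hpN)]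
    exact congrArg _ h3

theorem Space.ae_ne_zero (hd : 1 ≤ d) : ∀ᵐ x : Space d, x ≠ 0 := by
  have : Nonempty (Fin d) := ⟨⟨0, hd⟩⟩
  exact Measure.ae_ne volume 0

theorem alongCone_congr_ae (hd : 1 ≤ d) (t : ℝ) {P Q : ℝ × Sph d → ℂ} (h : P =ᵐ[cylMeasure d] Q) :
    alongCone P t =ᵐ[volume] alongCone Q t := by
  filter_upwards [(quasiMeasurePreserving_coneMap hd t).ae_eq_comp h, Space.ae_ne_zero hd] with x hx h0
  rw [alongCone_eq hd _ _ h0, alongCone_eq hd _ _ h0]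
  exact hx

theorem aestronglyMeasurable_alongCone (hd : 1 ≤ d) (t : ℝ) {P : ℝ × Sph d → ℂ}
    (h : AEStronglyMeasurable P (cylMeasure d)) : AEStronglyMeasurable (alongCone P t) volume := by
  refine (h.comp_quasiMeasurePreserving (quasiMeasurePreserving_coneMap hd t)).congr ?_
  filter_upwards [Space.ae_ne_zero hd] with x h0
  rw [alongCone_eq hd _ _ h0]; rfl

/-- The outgoing spherical wave `|x|^{-(d-1)/2} P(|x| - t, x/|x|)`. -/
def coneWave (P : ℝ × Sph d → ℂ) (t : ℝ) (x : Space d) : ℂ :=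
  ((‖x‖ ^ (-(((d : ℝ) - 1) / 2)) : ℝ) : ℂ) * alongCone P t x

theorem coneWave_congr_ae (hd : 1 ≤ d) (t : ℝ) {P Q : ℝ × Sph d → ℂ} (h : P =ᵐ[cylMeasure d] Q) :
    coneWave P t =ᵐ[volume] coneWave Q t := by
  filter_upwards [alongCone_congr_ae hd t h] with x hx
  simp only [coneWave, hx]

theorem aestronglyMeasurable_coneWave (hd : 1 ≤ d) (t : ℝ) {P : ℝ × Sph d → ℂ}
    (h : AEStronglyMeasurable P (cylMeasure d)) : AEStronglyMeasurable (coneWave P t) volume := by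
  refine AEStronglyMeasurable.mul ?_ (aestronglyMeasurable_alongCone hd t h)
  exact (by fun_prop : Measurable fun x : Space d => ((‖x‖ ^ (-(((d : ℝ) - 1) / 2)) : ℝ) : ℂ)).aestronglyMeasurable

theorem polarPull_coneWave (hd : 1 ≤ d) (P : ℝ × Sph d → ℂ) {t : ℝ} {p : ℝ × Sph d} (hp : 0 < p.1 + t) :
    polarPull t (coneWave P t) p = P p := by
  have hω : ‖(p.2 : Space d)‖ = 1 := by simp
  have hω0 : (p.2 : Space d) ≠ 0 := by intro h0; rw [h0] at hω; simp at hω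
  rw [polarPull, coneWave, alongCone_eq hd _ _ (smul_ne_zero hp.ne' hω0), coneMap_smul hd hp p.2,
    norm_smul, hω, mul_one, Real.norm_of_nonneg hp.le, ← mul_assoc, ← ofReal_mul, ← Real.rpow_add hp]
  simp

/-- The moving wave becomes a fixed function on the cylinder, and time enters only through the
pulled back solution and the half space `s + t > 0`. -/
theorem eLpNorm_sub_coneWave (hd : 1 ≤ d) (t : ℝ) {u : Space d → ℂ} (hu : AEStronglyMeasurable u)
    {P : ℝ × Sph d → ℂ} (hP : AEStronglyMeasurable P (cylMeasure d)) :
    eLpNorm (fun x => u x - coneWave P t x) 2 volume =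
      eLpNorm (fun p => polarPull t u p - P p) 2 ((cylMeasure d).restrict {p | 0 < p.1 + t}) := by
  change eLpNorm (u - coneWave P t) 2 volume = _
  rw [← eLpNorm_polarPull hd t (hu.sub (aestronglyMeasurable_coneWave hd t hP))]
  refine eLpNorm_congr_ae ?_
  filter_upwards [ae_restrict_mem (measurableSet_shift t)] with p hp
  rw [← polarPull_coneWave hd P hp]
  simp only [polarPull, Pi.sub_apply]
  ring

/-- The spherical wave only sees the part `s > -t` of the profile, and sees it isometrically. -/
theorem eLpNorm_coneWave_le (hd : 1 ≤ d) (t : ℝ) {P : ℝ × Sph d → ℂ}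
    (hP : AEStronglyMeasurable P (cylMeasure d)) :
    eLpNorm (coneWave P t) 2 volume ≤ eLpNorm P 2 (cylMeasure d) := by
  rw [← eLpNorm_polarPull hd t (aestronglyMeasurable_coneWave hd t hP),
    eLpNorm_congr_ae (g := P)]
  · exact eLpNorm_mono_measure _ Measure.restrict_le_self
  · filter_upwards [ae_restrict_mem (measurableSet_shift t)] with p hp
    exact polarPull_coneWave hd P hp

/-- Cutting the wave off near the cone is the same as cutting the profile off at `|s| < R`, because
`s = |x| - t`; for `t ≥ 0` this agrees with the distance `||x| - |t||`. -/
theorem eLpNorm_coneWave_offCone_le (hd : 1 ≤ d) {t : ℝ} (ht : 0 ≤ t) (R : ℝ) {P : ℝ × Sph d → ℂ}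
    (hP : AEStronglyMeasurable P (cylMeasure d)) :
    eLpNorm (coneWave P t) 2 (volume.restrict {x : Space d | R ≤ abs (‖x‖ - abs t)}) ≤
      eLpNorm P 2 ((cylMeasure d).restrict {p | R ≤ |p.1|}) := by
  have hm1 : MeasurableSet {x : Space d | R ≤ abs (‖x‖ - abs t)} :=
    measurableSet_le measurable_const (by fun_prop)
  have hm2 : MeasurableSet {p : ℝ × Sph d | R ≤ |p.1|} :=
    measurableSet_le measurable_const (by fun_prop)
  rw [← eLpNorm_indicator_eq_eLpNorm_restrict hm1, ← eLpNorm_indicator_eq_eLpNorm_restrict hm2]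
  refine le_trans (le_of_eq ?_) (eLpNorm_coneWave_le hd t (hP.indicator hm2))
  refine eLpNorm_congr_ae ?_
  filter_upwards [Space.ae_ne_zero hd] with x h0
  by_cases hx : x ∈ {x : Space d | R ≤ abs (‖x‖ - abs t)}
  · rw [Set.indicator_of_mem hx, coneWave, coneWave, alongCone_eq hd _ _ h0, alongCone_eq hd _ _ h0,
      Set.indicator_of_mem]
    simpa [coneMap, abs_of_nonneg ht] using hx
  · rw [Set.indicator_of_notMem hx, coneWave, alongCone_eq hd _ _ h0, Set.indicator_of_notMem, mul_zero]
    simpa [coneMap, abs_of_nonneg ht] using hx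

end Polar

theorem fourier_L2_sub {V : Type*} [NormedAddCommGroup V] [InnerProductSpace ℝ V]
    [FiniteDimensional ℝ V] [MeasurableSpace V] [BorelSpace V] (f g : Lp ℂ 2 (volume : Measure V)) :
    (𝓕 (f - g) : Lp ℂ 2 (volume : Measure V)) = 𝓕 f - 𝓕 g :=
  (Lp.fourierTransformₗᵢ V ℂ).map_sub f g

/-! ### Fourier transform in the radial variable -/

section PartialFourier
variable {d : ℕ}

/-- `P(·, ω)` has the (unscaled) Fourier transform `g(·, ω)` for almost every `ω`. -/
def HasPF (P : ℝ × Sph d → ℂ) (g : ℝ → Sph d → ℂ) : Prop :=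
  AEStronglyMeasurable P (cylMeasure d) ∧
  ∀ᵐ ω ∂(sphMeasure d), ∃ hP : MemLp (fun s : ℝ => P (s, ω)) 2 volume,
    (𝓕 hP.toLp : Lp ℂ 2 (volume : Measure ℝ)) =ᵐ[volume] fun l : ℝ => g l ω

theorem quasiMeasurePreserving_const_smul {V : Type*} [NormedAddCommGroup V] [InnerProductSpace ℝ V]
    [FiniteDimensional ℝ V] [MeasurableSpace V] [BorelSpace V] {c : ℝ} (hc : c ≠ 0) :
    Measure.QuasiMeasurePreserving (fun x : V => c • x) volume volume := by
  refine ⟨by fun_prop, ?_⟩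
  rw [Measure.map_addHaar_smul _ hc]
  exact Measure.smul_absolutelyContinuous

/-- Passage between the normalizations: with `ν = 2πl` the factors `2π` move into the symbol, so all
later work uses the unitary transform. -/
theorem hasPartialFourier_iff {P : ℝ × Sph d → ℂ} {g : ℝ → Sph d → ℂ} :
    HasPartialFourier P g ↔ HasPF P fun l ω => g (2 * Real.pi * l) ω := by
  have hpi := Real.pi_pos
  have h1 := quasiMeasurePreserving_const_smul (V := ℝ) (c := 2 * Real.pi) (by positivity)
  have h2 := quasiMeasurePreserving_const_smul (V := ℝ) (c := (2 * Real.pi)⁻¹) (by positivity)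
  unfold HasPartialFourier HasPF
  refine and_congr Iff.rfl (eventually_congr (Eventually.of_forall fun ω => exists_congr fun hP => ?_))
  constructor
  · intro h
    filter_upwards [h1.ae_eq_comp h] with l hl
    have e : (2 * Real.pi)⁻¹ * (2 * Real.pi * l) = l := by field_simp
    simp only [Function.comp_apply, hat, smul_eq_mul, e] at hl
    exact hl
  · intro h
    filter_upwards [h2.ae_eq_comp h] with l hl
    have e : (2 * Real.pi) * ((2 * Real.pi)⁻¹ * l) = l := by field_simp
    simp only [Function.comp_apply, smul_eq_mul, e] at hl
    simpa only [hat, smul_eq_mul] using hl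

theorem ae_fiber {q : ℝ × Sph d → Prop} (h : ∀ᵐ p ∂(cylMeasure d), q p) :
    ∀ᵐ ω ∂(sphMeasure d), ∀ᵐ s : ℝ, q (s, ω) := by
  have h1 : ∀ᵐ p ∂((sphMeasure d).prod (volume : Measure ℝ)), q p.swap :=
    Measure.measurePreserving_swap.quasiMeasurePreserving.ae h
  exact Measure.ae_ae_of_ae_prod h1

theorem HasPF.congr_right {P : ℝ × Sph d → ℂ} {g g' : ℝ → Sph d → ℂ} (hP : HasPF P g)
    (h : ∀ᵐ ω ∂(sphMeasure d), ∀ᵐ l : ℝ, g l ω = g' l ω) : HasPF P g' := by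
  refine ⟨hP.1, ?_⟩
  filter_upwards [hP.2, h] with ω ⟨hm, hF⟩ hω
  exact ⟨hm, hF.trans hω⟩

theorem HasPF.add {P Q : ℝ × Sph d → ℂ} {g k : ℝ → Sph d → ℂ} (hP : HasPF P g) (hQ : HasPF Q k) :
    HasPF (P + Q) (g + k) := by
  refine ⟨hP.1.add hQ.1, ?_⟩
  filter_upwards [hP.2, hQ.2] with ω ⟨hm, hF⟩ ⟨hm', hF'⟩
  refine ⟨hm.add hm', ?_⟩
  have e : MemLp.toLp _ (hm.add hm') = hm.toLp + hm'.toLp := rfl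
  have e2 : (𝓕 (MemLp.toLp _ (hm.add hm')) : Lp ℂ 2 (volume : Measure ℝ)) =
    𝓕 hm.toLp + 𝓕 hm'.toLp := by rw [e, FourierTransform.fourier_add]
  refine (EventuallyEq.of_eq
    (congrArg (fun u : Lp ℂ 2 (volume : Measure ℝ) => (u : ℝ → ℂ)) e2)).trans ?_
  filter_upwards [Lp.coeFn_add (𝓕 hm.toLp : Lp ℂ 2 (volume : Measure ℝ)) (𝓕 hm'.toLp), hF, hF']
    with l h1 h2 h3
  rw [h1, Pi.add_apply, h2, h3]; rfl

/-- Multiplication by a function of the direction. -/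
theorem HasPF.mul_dir {P : ℝ × Sph d → ℂ} {g : ℝ → Sph d → ℂ} (hP : HasPF P g) {a : Sph d → ℂ}
    (ha : Measurable a) : HasPF (fun p => a p.2 * P p) (fun l ω => a ω * g l ω) := by
  refine ⟨AEStronglyMeasurable.mul (ha.comp measurable_snd).aestronglyMeasurable hP.1, ?_⟩
  filter_upwards [hP.2] with ω ⟨hm, hF⟩
  refine ⟨hm.const_mul (a ω), ?_⟩
  have e : MemLp.toLp _ (hm.const_mul (a ω)) = a ω • hm.toLp := rfl
  have e2 : (𝓕 (MemLp.toLp _ (hm.const_mul (a ω))) : Lp ℂ 2 (volume : Measure ℝ)) =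
    a ω • 𝓕 hm.toLp := by rw [e, FourierTransform.fourier_smul]
  refine (EventuallyEq.of_eq
    (congrArg (fun u : Lp ℂ 2 (volume : Measure ℝ) => (u : ℝ → ℂ)) e2)).trans ?_
  filter_upwards [Lp.coeFn_smul (a ω) (𝓕 hm.toLp : Lp ℂ 2 (volume : Measure ℝ)), hF] with l h1 h2
  rw [h1, Pi.smul_apply, h2, smul_eq_mul]

theorem HasPF.const_mul {P : ℝ × Sph d → ℂ} {g : ℝ → Sph d → ℂ} (hP : HasPF P g) (c : ℂ) :
    HasPF (fun p => c * P p) (fun l ω => c * g l ω) :=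
  hP.mul_dir (a := fun _ => c) measurable_const

theorem HasPF.sub {P Q : ℝ × Sph d → ℂ} {g k : ℝ → Sph d → ℂ} (hP : HasPF P g) (hQ : HasPF Q k) :
    HasPF (P - Q) (g - k) := by
  have := hP.add (hQ.const_mul (-1))
  convert! this using 1
  · ext p; simp [sub_eq_add_neg]
  · ext l ω; simp [sub_eq_add_neg]

/-- Plancherel in the first variable. -/
theorem HasPF.lintegral_sq {P : ℝ × Sph d → ℂ} {g : ℝ → Sph d → ℂ} (hP : HasPF P g) :
    eLpNorm P 2 (cylMeasure d) ^ 2 = ∫⁻ ω : Sph d, (∫⁻ l : ℝ, ‖g l ω‖ₑ ^ 2) ∂(sphMeasure d) := by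
  rw [eLpNorm_two_sq, lintegral_prod_symm _ (hP.1.enorm.pow_const 2)]
  refine lintegral_congr_ae ?_
  filter_upwards [hP.2] with ω ⟨hm, hF⟩
  have h1 : eLpNorm (𝓕 hm.toLp : Lp ℂ 2 (volume : Measure ℝ)) 2 volume =
      eLpNorm (fun s : ℝ => P (s, ω)) 2 volume := by
    rw [← Lp.enorm_def, ← Lp.enorm_toLp hm, ← ofReal_norm, Lp.norm_fourier_eq, ofReal_norm]
  rw [← eLpNorm_two_sq, ← h1, eLpNorm_congr_ae hF, eLpNorm_two_sq]

theorem HasPF.eLpNorm_eq {P : ℝ × Sph d → ℂ} {g : ℝ → Sph d → ℂ} (hP : HasPF P g)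
    (hg : AEStronglyMeasurable (fun p : ℝ × Sph d => g p.1 p.2) (cylMeasure d)) :
    eLpNorm P 2 (cylMeasure d) = eLpNorm (fun p : ℝ × Sph d => g p.1 p.2) 2 (cylMeasure d) := by
  have h := hP.lintegral_sq
  rw [← lintegral_prod_symm (fun p : ℝ × Sph d => ‖g p.1 p.2‖ₑ ^ 2) (hg.enorm.pow_const 2),
    ← eLpNorm_two_sq] at h
  exact (ENNReal.pow_right_strictMono two_ne_zero).injective h

/-- The difference has zero partial transform, so Plancherel on the cylinder gives it norm zero. -/
theorem HasPF.unique {P Q : ℝ × Sph d → ℂ} {g : ℝ → Sph d → ℂ} (hP : HasPF P g) (hQ : HasPF Q g) :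
    P =ᵐ[cylMeasure d] Q := by
  have h := (hP.sub hQ).lintegral_sq
  simp only [sub_self, Pi.zero_apply, enorm_zero, ne_eq, OfNat.ofNat_ne_zero, not_false_eq_true,
    zero_pow, lintegral_zero, pow_eq_zero_iff] at h
  rw [eLpNorm_eq_zero_iff (hP.1.sub hQ.1) two_ne_zero] at h
  filter_upwards [h] with p hp
  exact sub_eq_zero.1 hp

/-- Limits of partial Fourier transforms. -/
theorem HasPF.exists_of_tendsto {P : ℕ → ℝ × Sph d → ℂ} {g : ℕ → ℝ → Sph d → ℂ}
    {G : ℝ → Sph d → ℂ} (hP : ∀ n, HasPF (P n) (g n))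
    (hg : ∀ n, MemLp (fun p : ℝ × Sph d => g n p.1 p.2) 2 (cylMeasure d))
    (hG : MemLp (fun p : ℝ × Sph d => G p.1 p.2) 2 (cylMeasure d))
    (hlim : Tendsto (fun n => eLpNorm (fun p : ℝ × Sph d => g n p.1 p.2 - G p.1 p.2) 2 (cylMeasure d))
      atTop (𝓝 0)) : ∃ Q, HasPF Q G := by
  have hPm : ∀ n, MemLp (P n) 2 (cylMeasure d) := fun n =>
    ⟨(hP n).1, by rw [(hP n).eLpNorm_eq (hg n).1]; exact (hg n).2⟩
  have hcg : CauchySeq fun n => (hg n).toLp := by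
    have : Tendsto (fun n => (hg n).toLp) atTop (𝓝 hG.toLp) := by
      rw [tendsto_iff_edist_tendsto_0]
      refine hlim.congr fun n => ?_
      rw [Lp.edist_toLp_toLp]; rfl
    exact this.cauchySeq
  -- Plancherel carries the Cauchy property from the transforms to the functions. What remains is to
  -- identify the transform of the limit on almost every line, although convergence is only known on
  -- the cylinder.
  have hcp : CauchySeq fun n => (hPm n).toLp := by
    rw [EMetric.cauchySeq_iff] at hcg ⊢
    intro ε hε
    obtain ⟨N, hN⟩ := hcg ε hε
    refine ⟨N, fun m hm n hn => ?_⟩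
    have := hN m hm n hn
    rw [Lp.edist_toLp_toLp] at this ⊢
    rw [((hP m).sub (hP n)).eLpNorm_eq ((hg m).1.sub (hg n).1)]
    exact this
  obtain ⟨Q₀, hQ⟩ := cauchySeq_tendsto_of_complete hcp
  have hQm := Lp.memLp Q₀
  set Q : ℝ × Sph d → ℂ := (Q₀ : ℝ × Sph d → ℂ) with hQdef
  have hlimP : Tendsto (fun n => eLpNorm (P n - Q) 2 (cylMeasure d)) atTop (𝓝 0) := by
    rw [tendsto_iff_edist_tendsto_0] at hQ
    refine hQ.congr fun n => ?_
    rw [← Lp.toLp_coeFn Q₀ hQm, Lp.edist_toLp_toLp]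
  refine ⟨Q, hQm.1, ?_⟩
  set X : ℕ → Sph d → ℝ≥0∞ := fun n ω => ∫⁻ s : ℝ, ‖P n (s, ω) - Q (s, ω)‖ₑ ^ 2 with hX
  set Y : ℕ → Sph d → ℝ≥0∞ := fun n ω => ∫⁻ l : ℝ, ‖g n l ω - G l ω‖ₑ ^ 2 with hY
  have mX : ∀ n, AEMeasurable (fun p : ℝ × Sph d => ‖P n p - Q p‖ₑ ^ 2) (cylMeasure d) :=
    fun n => ((hPm n).1.sub hQm.1).enorm.pow_const 2
  have mY : ∀ n, AEMeasurable (fun p : ℝ × Sph d => ‖g n p.1 p.2 - G p.1 p.2‖ₑ ^ 2) (cylMeasure d) :=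
    fun n => ((hg n).1.sub hG.1).enorm.pow_const 2
  have mX' : ∀ n, AEMeasurable (X n) (sphMeasure d) := fun n =>
    (mX n).prod_swap.lintegral_prod_right'
  have mY' : ∀ n, AEMeasurable (Y n) (sphMeasure d) := fun n =>
    (mY n).prod_swap.lintegral_prod_right'
  have iXY : ∀ n, ∫⁻ ω, (X n ω + Y n ω) ∂(sphMeasure d) = eLpNorm (P n - Q) 2 (cylMeasure d) ^ 2 +
      eLpNorm (fun p : ℝ × Sph d => g n p.1 p.2 - G p.1 p.2) 2 (cylMeasure d) ^ 2 := by
    intro n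
    simp_rw [lintegral_add_left' (mX' n), eLpNorm_two_sq, Pi.sub_apply]
    rw [lintegral_prod_symm _ (mX n),
      lintegral_prod_symm _ (mY n)]
  have lim0 : Tendsto (fun n => ∫⁻ ω, (X n ω + Y n ω) ∂(sphMeasure d)) atTop (𝓝 0) := by
    simp_rw [iXY]
    have h1 := (ENNReal.continuous_pow 2).tendsto 0 |>.comp hlimP
    have h2 := (ENNReal.continuous_pow 2).tendsto 0 |>.comp hlim
    simpa [Function.comp_def] using h1.add h2
  -- Fatou's lemma makes the lower limit of the line errors zero for almost every direction. This
  -- replaces the extraction of an almost everywhere convergent subsequence: for such a direction,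
  -- infinitely many `n` make both errors small.
  have hliminf : ∀ᵐ ω ∂(sphMeasure d), liminf (fun n => X n ω + Y n ω) atTop = 0 := by
    have mXY : ∀ n, AEMeasurable (fun ω => X n ω + Y n ω) (sphMeasure d) :=
      fun n => (mX' n).add (mY' n)
    have h1 := lintegral_liminf_le' (u := (atTop : Filter ℕ)) (μ := sphMeasure d)
      (f := fun n => (mXY n).mk) fun n => (mXY n).measurable_mk.aemeasurable
    simp_rw [← lintegral_congr_ae (mXY _).ae_eq_mk] at h1
    rw [lim0.liminf_eq] at h1
    have h2 := (lintegral_eq_zero_iff (Measurable.liminf fun n => (mXY n).measurable_mk)).1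
      (le_antisymm h1 zero_le)
    filter_upwards [h2, ae_all_iff.2 fun n => (mXY n).ae_eq_mk] with ω hω1 hω2
    simp_rw [hω2]
    exact hω1
  have hQf : ∀ᵐ ω ∂(sphMeasure d), MemLp (fun s : ℝ => Q (s, ω)) 2 volume := by
    have h1 : ∀ᵐ ω ∂(sphMeasure d), AEStronglyMeasurable (fun s : ℝ => Q (s, ω)) volume :=
      hQm.1.prod_swap.prodMk_left
    have h2 : ∫⁻ ω : Sph d, (∫⁻ s : ℝ, ‖Q (s, ω)‖ₑ ^ 2) ∂(sphMeasure d) ≠ ∞ := by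
      rw [← lintegral_prod_symm (fun p : ℝ × Sph d => ‖Q p‖ₑ ^ 2) (hQm.1.enorm.pow_const 2),
        ← eLpNorm_two_sq]
      exact (ENNReal.pow_lt_top hQm.2).ne
    filter_upwards [h1, ae_lt_top' ((hQm.1.enorm.pow_const 2).prod_swap.lintegral_prod_right') h2]
      with ω hω1 hω2
    refine ⟨hω1, ?_⟩
    have h3 : eLpNorm (fun s : ℝ => Q (s, ω)) 2 volume ^ 2 < ∞ := by
      rw [eLpNorm_two_sq]; exact hω2
    by_contra h4
    rw [not_lt, top_le_iff] at h4
    simp [h4] at h3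
  have hGf : ∀ᵐ ω ∂(sphMeasure d), AEStronglyMeasurable (fun l : ℝ => G l ω) volume :=
    hG.1.prod_swap.prodMk_left
  have hall : ∀ᵐ ω ∂(sphMeasure d), ∀ n, ∃ hP : MemLp (fun s : ℝ => P n (s, ω)) 2 volume,
    (𝓕 hP.toLp : Lp ℂ 2 (volume : Measure ℝ)) =ᵐ[volume] fun l : ℝ => g n l ω :=
    ae_all_iff.2 fun n => (hP n).2
  filter_upwards [hliminf, hQf, hall, hGf] with ω h0 hq hn hGω
  refine ⟨hq, ?_⟩
  have hle : ∀ n, eLpNorm (fun l => (𝓕 hq.toLp : Lp ℂ 2 (volume : Measure ℝ)) l - G l ω) 2 volume ≤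
      (X n ω + Y n ω) ^ (1 / 2 : ℝ) + (X n ω + Y n ω) ^ (1 / 2 : ℝ) := by
    intro n
    obtain ⟨hp, hF⟩ := hn n
    have half : ∀ (f : ℝ → ℂ), eLpNorm f 2 volume = (∫⁻ s, ‖f s‖ₑ ^ 2) ^ (1 / 2 : ℝ) := by
      intro f
      rw [← eLpNorm_two_sq, ← ENNReal.rpow_natCast, ← ENNReal.rpow_mul]
      norm_num
    have e1 : eLpNorm (fun l => (𝓕 hq.toLp : Lp ℂ 2 (volume : Measure ℝ)) l - g n l ω) 2 volume
        = X n ω ^ (1 / 2 : ℝ) := by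
      rw [hX, ← half]
      have : eLpNorm ((𝓕 hq.toLp - 𝓕 hp.toLp : Lp ℂ 2 (volume : Measure ℝ))) 2 volume =
          eLpNorm (fun s => P n (s, ω) - Q (s, ω)) 2 volume := by
        rw [← fourier_L2_sub, ← Lp.enorm_def, ← ofReal_norm, Lp.norm_fourier_eq, ofReal_norm,
          ← edist_eq_enorm_sub, edist_comm, Lp.edist_toLp_toLp]
        rfl
      rw [← this]
      refine eLpNorm_congr_ae ?_
      filter_upwards [hF, Lp.coeFn_sub (𝓕 hq.toLp : Lp ℂ 2 (volume : Measure ℝ)) (𝓕 hp.toLp)] with l h1 h2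
      rw [h2, Pi.sub_apply, h1]
    have e2 : eLpNorm (fun l => g n l ω - G l ω) 2 volume = Y n ω ^ (1 / 2 : ℝ) := half _
    have hgω : AEStronglyMeasurable (fun l => g n l ω) volume :=
      (Lp.memLp (𝓕 hp.toLp : Lp ℂ 2 (volume : Measure ℝ))).1.congr hF
    calc _ = eLpNorm ((fun l => (𝓕 hq.toLp : Lp ℂ 2 (volume : Measure ℝ)) l - g n l ω) +
            (fun l => g n l ω - G l ω)) 2 volume := by
          congr 1; ext l; simp
      _ ≤ X n ω ^ (1 / 2 : ℝ) + Y n ω ^ (1 / 2 : ℝ) := by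
          rw [← e1, ← e2]
          exact eLpNorm_add_le ((Lp.memLp _).1.sub hgω) (hgω.sub hGω) (by norm_num)
      _ ≤ _ := by
          gcongr
          · exact le_self_add
          · exact le_add_self
  have hz : eLpNorm (fun l => (𝓕 hq.toLp : Lp ℂ 2 (volume : Measure ℝ)) l - G l ω) 2 volume = 0 := by
    by_contra hne
    set e := eLpNorm (fun l => (𝓕 hq.toLp : Lp ℂ 2 (volume : Measure ℝ)) l - G l ω) 2 volume
    have hcont : Tendsto (fun x : ℝ≥0∞ => x ^ (1 / 2 : ℝ) + x ^ (1 / 2 : ℝ)) (𝓝 0) (𝓝 0) := by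
      have h1 := (ENNReal.continuous_rpow_const (y := 1 / 2)).tendsto 0
      have h2 := h1.add h1
      simpa using h2
    have hev : ∀ᶠ x in 𝓝 (0 : ℝ≥0∞), x ^ (1 / 2 : ℝ) + x ^ (1 / 2 : ℝ) < e :=
      hcont.eventually (gt_mem_nhds (pos_iff_ne_zero.2 hne))
    obtain ⟨δ, hδ, hδe⟩ := (ENNReal.nhds_zero_basis.eventually_iff).1 hev
    have hfr : ∃ᶠ n in atTop, X n ω + Y n ω < δ :=
      frequently_lt_of_liminf_lt (by isBoundedDefault) (by rw [h0]; exact hδ)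
    obtain ⟨n, hn'⟩ := hfr.exists
    exact absurd (hle n) (not_le.2 (hδe hn'))
  have hz' := (eLpNorm_eq_zero_iff (f := fun l => (𝓕 hq.toLp : Lp ℂ 2 (volume : Measure ℝ)) l - G l ω)
    ((Lp.memLp (𝓕 hq.toLp : Lp ℂ 2 (volume : Measure ℝ))).1.sub hGω) two_ne_zero).1 hz
  filter_upwards [hz'] with l hl
  exact sub_eq_zero.1 hl

end PartialFourier

/-! ### Symbols with separate data on the two half lines -/

section Symbols
variable {d : ℕ}

/-- The symbol `|l|^{(d-1)/2}` times `A(lω)` for `l < 0` and `B(lω)` for `l ≥ 0`. -/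
def sym (A B : Space d → ℂ) (l : ℝ) (ω : Sph d) : ℂ :=
  ((|l| ^ (((d : ℝ) - 1) / 2) : ℝ) : ℂ) *
    if l < 0 then A (l • (ω : Space d)) else B (l • (ω : Space d))

theorem sym_add (A B A' B' : Space d → ℂ) : sym (A + A') (B + B') = sym A B + sym A' B' := by
  ext l ω
  simp only [sym, Pi.add_apply]
  split_ifs <;> ring

theorem sym_const_mul (c : ℂ) (A B : Space d → ℂ) :
    sym (fun x => c * A x) (fun x => c * B x) = fun l ω => c * sym A B l ω := by
  ext l ω
  simp only [sym]
  split_ifs <;> ring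

theorem sym_congr_ae (hd : 1 ≤ d) {A A' B B' : Space d → ℂ} (hA : A =ᵐ[volume] A')
    (hB : B =ᵐ[volume] B') :
    ∀ᵐ p : ℝ × Sph d ∂(cylMeasure d), sym A B p.1 p.2 = sym A' B' p.1 p.2 := by
  filter_upwards [(quasiMeasurePreserving_smul hd).ae_eq_comp hA,
    (quasiMeasurePreserving_smul hd).ae_eq_comp hB] with p h1 h2
  simp only [Function.comp_apply] at h1 h2
  simp only [sym, h1, h2]

theorem measurable_sym {A B : Space d → ℂ} (hA : Measurable A) (hB : Measurable B) :
    Measurable fun p : ℝ × Sph d => sym A B p.1 p.2 := by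
  unfold sym
  refine Measurable.mul (by fun_prop) ?_
  exact Measurable.ite (measurableSet_lt measurable_fst measurable_const) (by fun_prop) (by fun_prop)

theorem aestronglyMeasurable_sym (hd : 1 ≤ d) {A B : Space d → ℂ} (hA : AEStronglyMeasurable A)
    (hB : AEStronglyMeasurable B) :
    AEStronglyMeasurable (fun p : ℝ × Sph d => sym A B p.1 p.2) (cylMeasure d) := by
  refine (measurable_sym hA.stronglyMeasurable_mk.measurable
    hB.stronglyMeasurable_mk.measurable).aestronglyMeasurable.congr ?_
  exact sym_congr_ae hd hA.ae_eq_mk.symm hB.ae_eq_mk.symm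

theorem enorm_abs_rpow_half_mul_sq (hd : 1 ≤ d) {r : ℝ} (hr : r ≠ 0) (c : ℂ) :
    ‖((|r| ^ (((d : ℝ) - 1) / 2) : ℝ) : ℂ) * c‖ₑ ^ 2 = ENNReal.ofReal (|r| ^ (d - 1)) * ‖c‖ₑ ^ 2 :=
  enorm_rpow_half_mul_sq hd (abs_pos.2 hr) c

/-- Each of the half lines `l < 0` and `l > 0`, combined with all directions, covers `ℝ^d` once in
polar coordinates. So `A` and `B` occupy disjoint parts of the cylinder and each contributes its
full norm. -/
theorem eLpNorm_sym_sq (hd : 1 ≤ d) {A B : Space d → ℂ} (hA : AEStronglyMeasurable A)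
    (hB : AEStronglyMeasurable B) :
    eLpNorm (fun p : ℝ × Sph d => sym A B p.1 p.2) 2 (cylMeasure d) ^ 2 =
      eLpNorm A 2 volume ^ 2 + eLpNorm B 2 volume ^ 2 := by
  rw [eLpNorm_congr_ae (sym_congr_ae hd hA.ae_eq_mk hB.ae_eq_mk), eLpNorm_congr_ae hA.ae_eq_mk,
    eLpNorm_congr_ae hB.ae_eq_mk]
  have mA := hA.stronglyMeasurable_mk.measurable
  have mB := hB.stronglyMeasurable_mk.measurable
  simp only [eLpNorm_two_sq]
  have hs : MeasurableSet {p : ℝ × Sph d | p.1 < 0} := measurableSet_lt measurable_fst measurable_const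
  have hs' : MeasurableSet {p : ℝ × Sph d | 0 < p.1} := measurableSet_lt measurable_const measurable_fst
  rw [← lintegral_add_compl _ hs, ← lintegral_polar_neg hd (h := fun x => ‖hA.mk A x‖ₑ ^ 2) (by fun_prop),
    ← lintegral_polar hd (h := fun x => ‖hB.mk B x‖ₑ ^ 2) (by fun_prop)]
  congr 1
  · refine setLIntegral_congr_fun hs fun p hp => ?_
    have hp' : p.1 < 0 := hp
    simp only [sym, if_pos hp']
    exact enorm_abs_rpow_half_mul_sq hd hp'.ne _
  · have he : ({p : ℝ × Sph d | p.1 < 0}ᶜ : Set (ℝ × Sph d)) =ᵐ[cylMeasure d] {p | 0 < p.1} := by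
      have h0 : ∀ᵐ p ∂(cylMeasure d), p.1 ≠ 0 :=
        Measure.quasiMeasurePreserving_fst.ae (p := fun r : ℝ => r ≠ 0) (Measure.ae_ne volume 0)
      filter_upwards [h0] with p hp
      refine propext ?_
      change ¬ p.1 < 0 ↔ 0 < p.1
      exact ⟨fun h => lt_of_le_of_ne (not_lt.1 h) hp.symm, fun h => not_lt.2 h.le⟩
    rw [Measure.restrict_congr_set he]
    refine setLIntegral_congr_fun hs' fun p hp => ?_
    have hp' : 0 < p.1 := hp
    simp only [sym, if_neg (not_lt.2 hp'.le)]
    exact enorm_abs_rpow_half_mul_sq hd hp'.ne' _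

end Symbols

/-! ### Radiation profiles of Poisson functions -/

section PoissonProfile
variable {d : ℕ}

/-- The profile of the Poisson function centered at `y`, for the frequencies of sign `ε`. -/
def poissonProfile (ε : ℝ) (y : Space d) (p : ℝ × Sph d) : ℂ :=
  Real.Gamma (((d : ℝ) + 1) / 2) *
    (2 * Real.pi * (1 - I * ε * ((p.1 - inner ℝ y (p.2 : Space d) : ℝ) : ℂ))) ^
      (-((((d : ℝ) + 1) / 2 : ℝ) : ℂ))

/-- The partial Fourier transform of `poissonProfile`. -/
def poissonProfileSymbol (ε : ℝ) (y : Space d) (l : ℝ) (ω : Sph d) : ℂ :=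
  if 0 < ε * l then ((|l| ^ (((d : ℝ) - 1) / 2) : ℝ) : ℂ) * poissonSymbol y (l • (ω : Space d)) else 0

theorem integrable_abs_rpow_mul_exp {c k : ℝ} (hc : 0 ≤ c) (hk : 0 < k) :
    Integrable fun l : ℝ => |l| ^ c * Real.exp (-(k * |l|)) := by
  refine (integrable_fun_norm_addHaar (μ := (volume : Measure ℝ))
    (f := fun r => r ^ c * Real.exp (-(k * r)))).2 ?_
  refine (integrableOn_rpow_mul_exp (b := c) (by linarith) hk).congr_fun (fun u _ => ?_) measurableSet_Ioi
  simp

theorem norm_sphere (ω : Sph d) : ‖(ω : Space d)‖ = 1 := by simp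

theorem memLp_poissonProfileSymbol (hd : 1 ≤ d) (ε : ℝ) (y : Space d) (ω : Sph d) :
    Integrable (fun l => poissonProfileSymbol ε y l ω) ∧
      MemLp (fun l => poissonProfileSymbol ε y l ω) 2 volume := by
  have hpi := Real.pi_pos
  have hd' : (0 : ℝ) ≤ ((d : ℝ) - 1) / 2 := by
    have : (1 : ℝ) ≤ d := by exact_mod_cast hd
    linarith
  have hm : AEStronglyMeasurable (fun l => poissonProfileSymbol ε y l ω) volume := by
    refine Measurable.aestronglyMeasurable ?_
    unfold poissonProfileSymbol
    refine Measurable.ite (measurableSet_lt measurable_const (by fun_prop)) ?_ measurable_const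
    refine Measurable.mul (by fun_prop) ?_
    exact (continuous_poissonSymbol y).measurable.comp (by fun_prop)
  have hb : ∀ l, ‖poissonProfileSymbol ε y l ω‖ ≤
      |l| ^ (((d : ℝ) - 1) / 2) * Real.exp (-(2 * Real.pi * |l|)) := by
    intro l
    unfold poissonProfileSymbol
    split_ifs
    · rw [norm_mul, norm_poissonSymbol, norm_smul, norm_sphere, mul_one, norm_real, Real.norm_eq_abs,
        Real.norm_eq_abs, abs_of_nonneg (by positivity)]
    · rw [norm_zero]; positivity
  refine ⟨(integrable_abs_rpow_mul_exp hd' (by positivity)).mono' hm (Eventually.of_forall hb), ?_⟩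
  rw [memLp_two_iff_integrable_sq_norm hm]
  refine (integrable_abs_rpow_mul_exp (c := ((d : ℝ) - 1) / 2 * (2 : ℕ)) (k := 2 * (2 * Real.pi))
    (by positivity) (by positivity)).mono' (by fun_prop) (Eventually.of_forall fun l => ?_)
  rw [Real.norm_of_nonneg (by positivity)]
  calc ‖poissonProfileSymbol ε y l ω‖ ^ 2
      ≤ (|l| ^ (((d : ℝ) - 1) / 2) * Real.exp (-(2 * Real.pi * |l|))) ^ 2 := by gcongr; exact hb l
    _ = _ := by
        rw [mul_pow, ← Real.exp_nat_mul, ← Real.rpow_natCast, ← Real.rpow_mul (abs_nonneg l)]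
        congr 2
        push_cast; ring

theorem one_sub_mem {ε σ : ℝ} : 0 < (2 * Real.pi * (1 - I * ε * (σ : ℂ)) : ℂ).re := by
  have hpi := Real.pi_pos
  have : (2 * Real.pi * (1 - I * ε * (σ : ℂ)) : ℂ).re = 2 * Real.pi := by simp
  rw [this]; positivity

/-- On one half line the symbol is `|l|^((d-1)/2)` times an exponential, so the inverse transform is
the Gamma integral of exponent `(d+1)/2` and complex frequency `2π(1 - iε(s - y·ω))`. -/
theorem fourierInv_poissonProfileSymbol {ε : ℝ} (hε : ε = 1 ∨ ε = -1) (y : Space d)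
    (ω : Sph d) (s : ℝ) :
    (𝓕⁻ (fun l => poissonProfileSymbol ε y l ω) : ℝ → ℂ) s = poissonProfile ε y (s, ω) := by
  have hb : (0 : ℝ) < ((d : ℝ) + 1) / 2 := by positivity
  have hε0 : ε * ε = 1 := by rcases hε with h | h <;> rw [h] <;> norm_num
  have habs : |ε| = 1 := by rcases hε with h | h <;> rw [h] <;> norm_num
  -- Reflecting when `ε = -1` brings both signs to an integral over `l > 0`.
  have hsub : ∀ H : ℝ → ℂ, ∫ l, H l = ∫ l, H (ε * l) := by
    intro H
    rcases hε with h | h <;> rw [h]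
    · simp
    · simp only [neg_mul, one_mul]
      exact (integral_neg_eq_self H volume).symm
  rw [Real.fourierInv_eq', hsub, poissonProfile,
    ← integral_rpow_mul_cexp_neg_mul hb one_sub_mem, ← integral_indicator measurableSet_Ioi]
  refine integral_congr_ae (Eventually.of_forall fun l => ?_)
  simp only [poissonProfileSymbol, Set.indicator, Set.mem_Ioi, ← mul_assoc, hε0, one_mul]
  split_ifs with hl
  · rw [abs_mul, habs, one_mul, abs_of_pos hl, poissonSymbol, norm_smul, norm_sphere, mul_one, Real.norm_eq_abs,
      abs_mul, habs, one_mul, abs_of_pos hl, inner_smul_right, smul_eq_mul,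
      show ((d : ℝ) - 1) / 2 = ((d : ℝ) + 1) / 2 - 1 by ring, mul_comm (((l ^ (((d : ℝ) + 1) / 2 - 1) : ℝ) : ℂ)),
      ← mul_assoc, ← Complex.exp_add, ← Complex.exp_add]
    congr 2
    simp only [RCLike.inner_apply, conj_trivial]
    push_cast
    ring
  · simp

theorem hasPF_poissonProfile (hd : 1 ≤ d) {ε : ℝ} (hε : ε = 1 ∨ ε = -1) (y : Space d) :
    HasPF (poissonProfile ε y) (poissonProfileSymbol ε y) := by
  refine ⟨?_, Eventually.of_forall fun ω => ?_⟩
  · refine Measurable.aestronglyMeasurable ?_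
    unfold poissonProfile
    fun_prop
  · obtain ⟨h1, h2⟩ := memLp_poissonProfileSymbol hd ε y ω
    have he := fourierInv_toLp_ae_eq h1 h2
    have he' : (𝓕⁻ h2.toLp : Lp ℂ 2 (volume : Measure ℝ)) =ᵐ[volume] fun s => poissonProfile ε y (s, ω) :=
      he.trans (Eventually.of_forall fun s => fourierInv_poissonProfileSymbol hε y ω s)
    have hm : MemLp (fun s => poissonProfile ε y (s, ω)) 2 volume := (Lp.memLp _).ae_eq he'
    refine ⟨hm, ?_⟩
    have e : hm.toLp = (𝓕⁻ h2.toLp : Lp ℂ 2 (volume : Measure ℝ)) := by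
      refine Lp.ext ?_
      exact hm.coeFn_toLp.trans he'.symm
    rw [e, FourierTransform.fourier_fourierInv_eq]
    exact h2.coeFn_toLp

theorem ofReal_mul_cpow {t : ℝ} (ht : 0 < t) {q : ℂ} (hq : q ≠ 0) (c : ℝ) :
    ((t : ℂ) * q) ^ (c : ℂ) = ((t ^ c : ℝ) : ℂ) * q ^ (c : ℂ) := by
  have ht0 : (t : ℂ) ≠ 0 := by exact_mod_cast ht.ne'
  rw [ofReal_cpow ht.le, cpow_def_of_ne_zero (mul_ne_zero ht0 hq), cpow_def_of_ne_zero ht0,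
    cpow_def_of_ne_zero hq, log_ofReal_mul ht hq, ofReal_log ht.le, add_mul, Complex.exp_add]

/-- Principal powers are not multiplicative in general. Here the argument of `1 - iεσ` is less than
`π/2` in modulus, so adding the argument `επ/2` of `iε` stays within the principal range. -/
theorem two_I_mul_cpow {ε : ℝ} (hε : ε = 1 ∨ ε = -1) (σ b : ℝ) :
    (2 * I * ε * (1 - I * ε * (σ : ℂ)) : ℂ) ^ (b : ℂ) =
      ((2 ^ b : ℝ) : ℂ) * cexp (I * ε * (Real.pi / 2) * b) * (1 - I * ε * (σ : ℂ)) ^ (b : ℂ) := by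
  have hpi := Real.pi_pos
  set q : ℂ := 1 - I * ε * (σ : ℂ) with hq
  have hqre : q.re = 1 := by simp [hq]
  have hq0 : q ≠ 0 := by intro h; rw [h] at hqre; simp at hqre
  have hI : cexp (I * ε * (Real.pi / 2)) = I * ε := by
    rcases hε with h | h
    · rw [h]; simp only [ofReal_one, mul_one]
      rw [mul_comm, exp_pi_div_two_mul_I]
    · rw [h]
      rw [show (I * ((-1 : ℝ) : ℂ) * (Real.pi / 2) : ℂ) = -(Real.pi / 2 * I) by push_cast; ring,
        Complex.exp_neg, exp_pi_div_two_mul_I, inv_I]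
      push_cast; ring
  have hmul : (2 * I * ε * q : ℂ) = ((2 : ℝ) : ℂ) * (I * ε * q) := by push_cast; ring
  have hε0 : (ε : ℂ) ≠ 0 := by
    rcases hε with h | h <;> rw [h] <;> norm_num
  have hIq : (I * ε * q : ℂ) ≠ 0 := mul_ne_zero (mul_ne_zero I_ne_zero hε0) hq0
  have harg : |q.arg| < Real.pi / 2 := abs_arg_lt_pi_div_two_iff.2 (Or.inl (by rw [hqre]; norm_num))
  have him : (I * ε * (Real.pi / 2) + log q : ℂ).im = ε * (Real.pi / 2) + q.arg := by
    rw [add_im, log_im]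
    congr 1
    rw [show (I * ε * (Real.pi / 2) : ℂ) = ((ε * (Real.pi / 2) : ℝ) : ℂ) * I by push_cast; ring]
    simp only [mul_im, ofReal_re, I_im, mul_one, ofReal_im, I_re, mul_zero, add_zero]
  have hlog : log (I * ε * q) = I * ε * (Real.pi / 2) + log q := by
    rw [← Complex.log_exp (x := I * ε * (Real.pi / 2) + log q)]
    · rw [Complex.exp_add, hI, exp_log hq0]
    · rw [him]
      rcases hε with h | h <;> rw [h] <;> linarith [(abs_lt.1 harg).1, (abs_lt.1 harg).2]
    · rw [him]
      rcases hε with h | h <;> rw [h] <;> linarith [(abs_lt.1 harg).1, (abs_lt.1 harg).2]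
  rw [hmul, ofReal_mul_cpow two_pos hIq, cpow_def_of_ne_zero hIq, hlog, add_mul, Complex.exp_add,
    cpow_def_of_ne_zero hq0]
  ring

/-- Pointwise convergence of the Poisson waves along the light cone. -/
theorem tendsto_polarPull_poissonKernel {ε : ℝ} (hε : ε = 1 ∨ ε = -1) (y : Space d)
    (p : ℝ × Sph d) :
    Tendsto (fun t : ℝ => polarPull t (fun x => poissonKernel d (1 + I * ε * t) ‖x - y‖) p) atTop
      (𝓝 (cexp (-(I * ε * tau d)) * poissonProfile ε y p)) := by
  obtain ⟨s, ω⟩ := p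
  have hpi := Real.pi_pos
  set c := inner ℝ y (ω : Space d) with hc
  set b : ℝ := ((d : ℝ) + 1) / 2 with hb
  set β : ℝ := ((d : ℝ) - 1) / 2 with hβ
  -- In `(1 + iεt)² + |(s+t)ω - y|²` the terms `t²` cancel; `D` collects what is independent of `t`
  -- and `w` is the coefficient of `t`. Since `Im w = 2ε`, the numbers `w + D/t` keep away from the
  -- branch cut.
  set D : ℝ := 1 + s ^ 2 - 2 * s * c + ‖y‖ ^ 2 with hD
  set w : ℂ := 2 * I * ε * (1 - I * ε * ((s - c : ℝ) : ℂ)) with hw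
  have hε2 : (ε : ℂ) * ε = 1 := by rcases hε with h | h <;> rw [h] <;> norm_num
  have hε2' : ε ^ 2 = 1 := by rcases hε with h | h <;> rw [h] <;> norm_num
  have hweq : w = 2 * I * ε + 2 * ((s - c : ℝ) : ℂ) := by
    rw [hw]; ring_nf; rw [I_sq, show (ε : ℂ) ^ 2 = 1 by rw [sq, hε2]]; ring
  have hwim : ∀ x : ℝ, (w + x).im = 2 * ε := by
    intro x; rw [hweq]; simp
  have hε0 : ε ≠ 0 := by rcases hε with h | h <;> rw [h] <;> norm_num
  have hslit : ∀ x : ℝ, w + x ∈ slitPlane := fun x => by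
    rw [mem_slitPlane_iff]; right; rw [hwim]; exact mul_ne_zero two_ne_zero hε0
  have hlim1 : Tendsto (fun t : ℝ => ((s + t) / t) ^ β) atTop (𝓝 1) := by
    have h1 : Tendsto (fun t : ℝ => s / t + 1) atTop (𝓝 (0 + 1)) :=
      (tendsto_const_nhds.div_atTop tendsto_id).add tendsto_const_nhds
    rw [zero_add] at h1
    have h2 : Tendsto (fun t : ℝ => (s / t + 1) ^ β) atTop (𝓝 ((1 : ℝ) ^ β)) :=
      h1.rpow_const (Or.inl one_ne_zero)
    rw [Real.one_rpow] at h2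
    refine h2.congr' ?_
    filter_upwards [eventually_gt_atTop 0] with t ht
    rw [add_div, div_self ht.ne']
  have hlim2 : Tendsto (fun t : ℝ => (((1 / t : ℝ) : ℂ) + I * ε)) atTop (𝓝 (I * ε)) := by
    have h1 : Tendsto (fun t : ℝ => 1 / t) atTop (𝓝 0) := tendsto_const_nhds.div_atTop tendsto_id
    have h2 := (continuous_ofReal.tendsto 0).comp h1
    simpa [Function.comp_def] using h2.add_const (I * (ε : ℂ))
  have hlim3 : Tendsto (fun t : ℝ => (w + ((D / t : ℝ) : ℂ)) ^ (-(b : ℂ))) atTop (𝓝 (w ^ (-(b : ℂ)))) := by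
    have h1 : Tendsto (fun t : ℝ => D / t) atTop (𝓝 0) := tendsto_const_nhds.div_atTop tendsto_id
    have h2 := ((continuous_ofReal.tendsto 0).comp h1).const_add w
    simp only [ofReal_zero, add_zero] at h2
    have h3 : ContinuousAt (fun z : ℂ => z ^ (-(b : ℂ))) w :=
      continuousAt_id.cpow continuousAt_const (by simpa using hslit 0)
    exact h3.tendsto.comp h2
  have hprod := (((continuous_ofReal.tendsto 1).comp hlim1).mul
    (tendsto_const_nhds (x := (((Real.pi ^ (-b) * Real.Gamma b : ℝ)) : ℂ)))).mul (hlim2.mul hlim3)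
  have hfin : ((1 : ℝ) : ℂ) * ((Real.pi ^ (-b) * Real.Gamma b : ℝ) : ℂ) * (I * ε * w ^ (-(b : ℂ))) =
      cexp (-(I * ε * tau d)) * poissonProfile ε y (s, ω) := by
    have hI : cexp (I * ε * (Real.pi / 2)) = I * ε := by
      rcases hε with h | h
      · rw [h]; simp only [ofReal_one, mul_one]
        rw [mul_comm, exp_pi_div_two_mul_I]
      · rw [h]
        rw [show (I * ((-1 : ℝ) : ℂ) * (Real.pi / 2) : ℂ) = -(Real.pi / 2 * I) by push_cast; ring,
          Complex.exp_neg, exp_pi_div_two_mul_I, inv_I]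
        push_cast; ring
    have hq0 : (1 - I * ε * ((s - c : ℝ) : ℂ)) ≠ 0 := by
      intro h; have := congrArg Complex.re h; simp at this
    rw [poissonProfile, ← hb, ← ofReal_neg, hw, two_I_mul_cpow hε,
      show (2 * Real.pi * (1 - I * ε * ((s - c : ℝ) : ℂ)) : ℂ) =
        ((2 * Real.pi : ℝ) : ℂ) * (1 - I * ε * ((s - c : ℝ) : ℂ)) by push_cast; ring,
      ofReal_mul_cpow (by positivity) hq0, Real.mul_rpow two_pos.le hpi.le,
      -- The prefactor `1 + iεt` contributes `exp(iεπ/2)` and the power `-b` of `w` contributes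
      -- `exp(-iεbπ/2)`. As `1 - b = -(d-1)/2`, their product is `exp(-iετ)`.
      show (-(I * ε * tau d) : ℂ) = I * ε * (Real.pi / 2) + I * ε * (Real.pi / 2) * ((-b : ℝ) : ℂ) by
        rw [tau, hb]; push_cast; ring, Complex.exp_add, hI]
    push_cast
    ring
  rw [← hfin]
  refine hprod.congr' ?_
  filter_upwards [eventually_gt_atTop 0, eventually_gt_atTop (-s)] with t ht hts
  have hst : 0 < s + t := by linarith
  have hr : ‖(s + t) • (ω : Space d) - y‖ ^ 2 = (s + t) ^ 2 - 2 * (s + t) * c + ‖y‖ ^ 2 := by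
    rw [norm_sub_sq_real, norm_smul, norm_sphere, inner_smul_left, real_inner_comm, ← hc]
    simp [abs_of_pos hst]
    ring
  have hsum : ((1 + I * ε * t : ℂ) ^ 2 + (‖(s + t) • (ω : Space d) - y‖ : ℂ) ^ 2) =
      (t : ℂ) * (w + ((D / t : ℝ) : ℂ)) := by
    have ht0 : (t : ℂ) ≠ 0 := by exact_mod_cast ht.ne'
    rw [← ofReal_pow, hr, hweq, hD]
    push_cast
    rw [mul_add (t : ℂ), mul_comm (t : ℂ) (_ / (t : ℂ)), div_mul_cancel₀ _ ht0]
    ring_nf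
    rw [I_sq, show (ε : ℂ) ^ 2 = 1 by rw [sq, hε2]]
    ring
  have hne : w + ((D / t : ℝ) : ℂ) ≠ 0 := slitPlane_ne_zero (hslit _)
  simp only [Function.comp_apply, polarPull, poissonKernel]
  rw [hsum, ← hb, ← hβ, ← ofReal_neg b, ofReal_mul_cpow ht hne, Real.div_rpow hst.le ht.le]
  -- Since `b = β + 1`, the decay `t^(-b)` splits into `t^(-β)`, which normalizes the weight
  -- `(s+t)^β`, and `t^(-1)`, which normalizes the prefactor `1 + iεt`.
  have hbt : t ^ (-b) = (t ^ β)⁻¹ * t⁻¹ := by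
    rw [← Real.rpow_neg ht.le, ← Real.rpow_neg_one t, ← Real.rpow_add ht]
    congr 1; rw [hb, hβ]; ring
  have ht0 : (t : ℂ) ≠ 0 := by exact_mod_cast ht.ne'
  have htβ : ((t ^ β : ℝ) : ℂ) ≠ 0 := by exact_mod_cast (Real.rpow_pos_of_pos ht β).ne'
  rw [hbt]
  push_cast
  field_simp

end PoissonProfile

/-! ### From pointwise to `L²` convergence -/

/-- Almost everywhere convergence without loss of mass implies convergence in `L²`. -/
theorem tendsto_eLpNorm_sub_of_ae {α : Type*} [MeasurableSpace α] {μ : Measure α} {U : ℝ → α → ℂ}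
    {V : α → ℂ} (hU : ∀ t, AEStronglyMeasurable (U t) μ) (hV : MemLp V 2 μ)
    (hle : ∀ t, eLpNorm (U t) 2 μ ≤ eLpNorm V 2 μ)
    (hlim : ∀ᵐ x ∂μ, Tendsto (fun t => U t x) atTop (𝓝 (V x))) :
    Tendsto (fun t => eLpNorm (U t - V) 2 μ) atTop (𝓝 0) := by
  set M := ∫⁻ x, ‖V x‖ₑ ^ 2 ∂μ with hM
  have hMfin : M ≠ ∞ := by
    rw [hM, ← eLpNorm_two_sq]; exact (ENNReal.pow_lt_top hV.2).ne
  -- The quantity `2|U|² + 2|V|² - |U - V|²` is nonnegative and tends to `4|V|²`. Fatou bounds the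
  -- lower limit of its integral below by `4M`, while the norm bound gives `∫ f + ∫ |U - V|² ≤ 4M`;
  -- so the last integral tends to zero.
  set f : ℝ → α → ℝ≥0∞ := fun t x => ENNReal.ofReal (2 * ‖U t x‖ ^ 2 + 2 * ‖V x‖ ^ 2 - ‖U t x - V x‖ ^ 2) with hf
  have hfm : ∀ t, AEMeasurable (f t) μ := fun t =>
    (((((hU t).norm.pow 2).const_mul 2).add ((hV.1.norm.pow 2).const_mul 2)).sub
      (((hU t).sub hV.1).norm.pow 2)).aemeasurable.ennreal_ofReal
  have hDm : ∀ t, AEMeasurable (fun x => ‖U t x - V x‖ₑ ^ 2) μ := fun t =>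
    ((hU t).sub hV.1).enorm.pow_const 2
  have hsq : ∀ z : ℂ, ‖z‖ₑ ^ 2 = ENNReal.ofReal (‖z‖ ^ 2) := fun z => by
    rw [← ofReal_norm, ENNReal.ofReal_pow (norm_nonneg _)]
  have hadd : ∀ t x, f t x + ‖U t x - V x‖ₑ ^ 2 = 2 * ‖U t x‖ₑ ^ 2 + 2 * ‖V x‖ₑ ^ 2 := by
    intro t x
    have hpos : 0 ≤ 2 * ‖U t x‖ ^ 2 + 2 * ‖V x‖ ^ 2 - ‖U t x - V x‖ ^ 2 := by
      have h1 := norm_sub_le (U t x) (V x)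
      nlinarith [norm_nonneg (U t x - V x), sq_nonneg (‖U t x‖ - ‖V x‖), norm_nonneg (U t x),
        norm_nonneg (V x)]
    rw [hf, hsq, hsq, hsq, ← ENNReal.ofReal_add hpos (by positivity), show (2 : ℝ≥0∞) = ENNReal.ofReal 2 by simp,
      ← ENNReal.ofReal_mul (by norm_num), ← ENNReal.ofReal_mul (by norm_num),
      ← ENNReal.ofReal_add (by positivity) (by positivity)]
    congr 1; ring
  have hint : ∀ t, ∫⁻ x, f t x ∂μ + ∫⁻ x, ‖U t x - V x‖ₑ ^ 2 ∂μ ≤ 4 * M := by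
    intro t
    rw [← lintegral_add_left' (hfm t)]
    simp_rw [hadd t]
    rw [lintegral_add_left' (((hU t).enorm.pow_const 2).const_mul 2),
      lintegral_const_mul' _ _ (by norm_num), lintegral_const_mul' _ _ (by norm_num), ← hM]
    have h1 : ∫⁻ x, ‖U t x‖ₑ ^ 2 ∂μ ≤ M := by
      rw [hM, ← eLpNorm_two_sq, ← eLpNorm_two_sq]; gcongr; exact hle t
    calc 2 * ∫⁻ x, ‖U t x‖ₑ ^ 2 ∂μ + 2 * M ≤ 2 * M + 2 * M := by gcongr
      _ = 4 * M := by ring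
  have hfat : 4 * M ≤ liminf (fun t => ∫⁻ x, f t x ∂μ) atTop := by
    refine le_trans (le_of_eq ?_) (lintegral_liminf_le' (u := (atTop : Filter ℝ)) hfm)
    rw [hM, ← lintegral_const_mul' _ _ (by norm_num)]
    refine lintegral_congr_ae ?_
    filter_upwards [hlim] with x hx
    have h1 : Tendsto (fun t => 2 * ‖U t x‖ ^ 2 + 2 * ‖V x‖ ^ 2 - ‖U t x - V x‖ ^ 2) atTop
        (𝓝 (2 * ‖V x‖ ^ 2 + 2 * ‖V x‖ ^ 2 - ‖V x - V x‖ ^ 2)) :=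
      (((hx.norm.pow 2).const_mul 2).add_const _).sub ((hx.sub_const _).norm.pow 2)
    rw [sub_self, norm_zero] at h1
    have h2 := (ENNReal.continuous_ofReal.tendsto _).comp h1
    have h3 := h2.liminf_eq
    simp only [Function.comp_def] at h3
    rw [hf]
    simp only
    rw [h3, hsq, show (4 : ℝ≥0∞) = ENNReal.ofReal 4 by simp, ← ENNReal.ofReal_mul (by norm_num)]
    congr 1; ring
  have hten : Tendsto (fun t => ∫⁻ x, f t x ∂μ) atTop (𝓝 (4 * M)) := by
    refine tendsto_of_le_liminf_of_limsup_le hfat ?_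
    refine (limsup_le_limsup (Eventually.of_forall fun t => le_trans le_self_add (hint t))).trans ?_
    simp
  have h4M : 4 * M ≠ ∞ := ENNReal.mul_ne_top (by norm_num) hMfin
  have hD : Tendsto (fun t => ∫⁻ x, ‖U t x - V x‖ₑ ^ 2 ∂μ) atTop (𝓝 0) := by
    have h1 : Tendsto (fun t => 4 * M - ∫⁻ x, f t x ∂μ) atTop (𝓝 (4 * M - 4 * M)) :=
      ENNReal.Tendsto.sub tendsto_const_nhds hten (Or.inl h4M)
    rw [tsub_self] at h1
    refine tendsto_of_tendsto_of_tendsto_of_le_of_le tendsto_const_nhds h1 (fun _ => zero_le) fun t => ?_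
    refine ENNReal.le_sub_of_add_le_left ?_ (hint t)
    exact ne_top_of_le_ne_top h4M (le_trans le_self_add (hint t))
  have h5 := (ENNReal.continuous_rpow_const (y := 1 / 2)).tendsto 0 |>.comp hD
  rw [ENNReal.zero_rpow_of_pos (by norm_num)] at h5
  refine h5.congr fun t => ?_
  simp only [Function.comp_apply]
  rw [← eLpNorm_two_sq (fun x => U t x - V x), ← ENNReal.rpow_natCast, ← ENNReal.rpow_mul]
  norm_num
  rfl

/-! ### Superpositions of half-waves and their profiles -/

section HalfWaveGroup
variable {d : ℕ}

theorem fourier_ext {f g : L2 d} (h : (𝓕 f : L2 d) =ᵐ[volume] (𝓕 g : L2 d)) : f = g := by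
  have h1 : (𝓕 f : L2 d) = 𝓕 g := Lp.ext h
  rw [← FourierTransform.fourierInv_fourier_eq (F := L2 d) f, h1, FourierTransform.fourierInv_fourier_eq]

theorem fourier_halfWave (t : ℝ) (f : L2 d) :
    (𝓕 (halfWave t f) : L2 d) =ᵐ[volume]
      fun ξ => cexp (I * (t * ‖(2 * Real.pi) • ξ‖ : ℝ)) * (𝓕 f : L2 d) ξ := by
  rw [halfWave, FourierTransform.fourier_fourierInv_eq]
  exact (memLp_phase_mul t (𝓕 f : L2 d)).coeFn_toLp

theorem fourier_add_ae (f g : L2 d) :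
    (𝓕 (f + g) : L2 d) =ᵐ[volume] fun ξ => (𝓕 f : L2 d) ξ + (𝓕 g : L2 d) ξ := by
  rw [FourierTransform.fourier_add]
  exact Lp.coeFn_add _ _

theorem fourier_smul_ae (c : ℂ) (f : L2 d) :
    (𝓕 (c • f) : L2 d) =ᵐ[volume] fun ξ => c * (𝓕 f : L2 d) ξ := by
  rw [FourierTransform.fourier_smul]
  exact Lp.coeFn_smul _ _

theorem halfWave_add (t : ℝ) (f g : L2 d) : halfWave t (f + g) = halfWave t f + halfWave t g := by
  refine fourier_ext ?_
  filter_upwards [fourier_halfWave t (f + g), fourier_halfWave t f, fourier_halfWave t g,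
    fourier_add_ae f g, fourier_add_ae (halfWave t f) (halfWave t g)] with ξ h1 h2 h3 h4 h5
  rw [h1, h4, h5, h2, h3, mul_add]

theorem halfWave_smul (t : ℝ) (c : ℂ) (f : L2 d) : halfWave t (c • f) = c • halfWave t f := by
  refine fourier_ext ?_
  filter_upwards [fourier_halfWave t (c • f), fourier_halfWave t f,
    fourier_smul_ae c f, fourier_smul_ae c (halfWave t f)] with ξ h1 h2 h3 h4
  rw [h1, h3, h4, h2]; ring

theorem enorm_eq_of_fourier_norm_eq {f g : L2 d}
    (h : ∀ᵐ ξ, ‖(𝓕 f : L2 d) ξ‖ = ‖(𝓕 g : L2 d) ξ‖) : ‖f‖ₑ = ‖g‖ₑ := by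
  rw [← ofReal_norm, ← ofReal_norm g, ← Lp.norm_fourier_eq f, ← Lp.norm_fourier_eq g, ofReal_norm, ofReal_norm,
    Lp.enorm_def, Lp.enorm_def]
  exact eLpNorm_congr_norm_ae h

theorem enorm_halfWave (t : ℝ) (f : L2 d) : ‖halfWave t f‖ₑ = ‖f‖ₑ := by
  refine enorm_eq_of_fourier_norm_eq ?_
  filter_upwards [fourier_halfWave t f] with ξ h
  rw [h, norm_mul, mul_comm I, norm_exp_ofReal_mul_I, one_mul]

/-- The superposition `e^{it|D|} a + e^{-it|D|} b`. -/
def twoWave (a b : L2 d) (t : ℝ) : L2 d := halfWave t a + halfWave (-t) b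

theorem twoWave_add (a b a' b' : L2 d) (t : ℝ) :
    twoWave (a + a') (b + b') t = twoWave a b t + twoWave a' b' t := by
  simp only [twoWave, halfWave_add]; abel

theorem twoWave_smul (c : ℂ) (a b : L2 d) (t : ℝ) :
    twoWave (c • a) (c • b) t = c • twoWave a b t := by
  simp only [twoWave, halfWave_smul, smul_add]

theorem twoWave_sub (a b a' b' : L2 d) (t : ℝ) :
    twoWave (a - a') (b - b') t = twoWave a b t - twoWave a' b' t := by
  have h1 := twoWave_add (a - a') (b - b') a' b' t
  rw [sub_add_cancel, sub_add_cancel] at h1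
  rw [h1, add_sub_cancel_right]

theorem twoWave_neg_time (a b : L2 d) (t : ℝ) : twoWave a b (-t) = twoWave b a t := by
  rw [twoWave, twoWave, neg_neg, add_comm]

theorem enorm_twoWave_le (a b : L2 d) (t : ℝ) : ‖twoWave a b t‖ₑ ≤ ‖a‖ₑ + ‖b‖ₑ := by
  refine (enorm_add_le _ _).trans ?_
  rw [enorm_halfWave, enorm_halfWave]

/-- The partial Fourier transform of the outgoing profile of `twoWave a b`. -/
def outSym (a b : L2 d) : ℝ → Sph d → ℂ :=
  sym (fun ξ => cexp (I * tau d) * (𝓕 a : L2 d) ξ) (fun ξ => cexp (-(I * tau d)) * (𝓕 b : L2 d) ξ)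

theorem aesm_phase_mul (c : ℂ) (a : L2 d) :
    AEStronglyMeasurable (fun ξ => c * (𝓕 a : L2 d) ξ) volume :=
  (Lp.memLp (𝓕 a : L2 d)).1.const_mul c

theorem aestronglyMeasurable_outSym (hd : 1 ≤ d) (a b : L2 d) :
    AEStronglyMeasurable (fun p : ℝ × Sph d => outSym a b p.1 p.2) (cylMeasure d) :=
  aestronglyMeasurable_sym hd (aesm_phase_mul _ a) (aesm_phase_mul _ b)

theorem eLpNorm_phase_mul {c : ℂ} (hc : ‖c‖ = 1) (a : L2 d) :
    eLpNorm (fun ξ => c * (𝓕 a : L2 d) ξ) 2 volume = ‖a‖ₑ := by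
  rw [← ofReal_norm, ← Lp.norm_fourier_eq a, ofReal_norm, Lp.enorm_def]
  refine eLpNorm_congr_norm_ae (Eventually.of_forall fun ξ => ?_)
  rw [norm_mul, hc, one_mul]

theorem norm_cexp_tau : ‖cexp (I * tau d)‖ = 1 ∧ ‖cexp (-(I * tau d))‖ = 1 := by
  constructor
  · rw [mul_comm, norm_exp_ofReal_mul_I]
  · rw [show (-(I * tau d) : ℂ) = ((-tau d : ℝ) : ℂ) * I by push_cast; ring, norm_exp_ofReal_mul_I]

/-- Each of the two unimodular phases leaves a norm unchanged, so a profile with this transform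
carries all of the mass of the data. This is the no-loss condition in the passage to `L²`
convergence. -/
theorem eLpNorm_outSym_sq (hd : 1 ≤ d) (a b : L2 d) :
    eLpNorm (fun p : ℝ × Sph d => outSym a b p.1 p.2) 2 (cylMeasure d) ^ 2 = ‖a‖ₑ ^ 2 + ‖b‖ₑ ^ 2 := by
  rw [outSym, eLpNorm_sym_sq hd (aesm_phase_mul _ a) (aesm_phase_mul _ b),
    eLpNorm_phase_mul norm_cexp_tau.1, eLpNorm_phase_mul norm_cexp_tau.2]

theorem eLpNorm_outSym_le (hd : 1 ≤ d) (a b : L2 d) :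
    eLpNorm (fun p : ℝ × Sph d => outSym a b p.1 p.2) 2 (cylMeasure d) ≤ ‖a‖ₑ + ‖b‖ₑ := by
  refine (ENNReal.pow_right_strictMono two_ne_zero).le_iff_le.1 ?_
  simp only [eLpNorm_outSym_sq hd]
  calc ‖a‖ₑ ^ 2 + ‖b‖ₑ ^ 2 ≤ 2 * ‖a‖ₑ * ‖b‖ₑ + (‖a‖ₑ ^ 2 + ‖b‖ₑ ^ 2) := le_add_self
    _ = (‖a‖ₑ + ‖b‖ₑ) ^ 2 := by ring

theorem memLp_outSym (hd : 1 ≤ d) (a b : L2 d) :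
    MemLp (fun p : ℝ × Sph d => outSym a b p.1 p.2) 2 (cylMeasure d) :=
  ⟨aestronglyMeasurable_outSym hd a b, (eLpNorm_outSym_le hd a b).trans_lt (by simp)⟩

theorem outSym_add_ae (hd : 1 ≤ d) (a b a' b' : L2 d) :
    ∀ᵐ p : ℝ × Sph d ∂(cylMeasure d),
      outSym (a + a') (b + b') p.1 p.2 = (outSym a b + outSym a' b') p.1 p.2 := by
  rw [outSym, outSym, outSym, ← sym_add]
  refine sym_congr_ae hd ?_ ?_
  · filter_upwards [fourier_add_ae a a'] with ξ h
    rw [h, Pi.add_apply, mul_add]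
  · filter_upwards [fourier_add_ae b b'] with ξ h
    rw [h, Pi.add_apply, mul_add]

theorem outSym_smul_ae (hd : 1 ≤ d) (c : ℂ) (a b : L2 d) :
    ∀ᵐ p : ℝ × Sph d ∂(cylMeasure d),
      outSym (c • a) (c • b) p.1 p.2 = c * outSym a b p.1 p.2 := by
  have := sym_const_mul c (fun ξ => cexp (I * tau d) * (𝓕 a : L2 d) ξ)
    (fun ξ => cexp (-(I * tau d)) * (𝓕 b : L2 d) ξ)
  have h2 : ∀ p : ℝ × Sph d, c * outSym a b p.1 p.2 = _ := fun p => (congrFun (congrFun this p.1) p.2).symm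
  simp_rw [h2]
  rw [outSym]
  refine sym_congr_ae hd ?_ ?_
  · filter_upwards [fourier_smul_ae c a] with ξ h
    rw [h]; ring
  · filter_upwards [fourier_smul_ae c b] with ξ h
    rw [h]; ring

theorem HasPF.congr_right' {P : ℝ × Sph d → ℂ} {g g' : ℝ → Sph d → ℂ} (hP : HasPF P g)
    (h : ∀ᵐ p : ℝ × Sph d ∂(cylMeasure d), g' p.1 p.2 = g p.1 p.2) : HasPF P g' := by
  refine hP.congr_right ?_
  filter_upwards [ae_fiber h] with ω hω
  filter_upwards [hω] with l hl using hl.symm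

theorem outSym_sub_ae (hd : 1 ≤ d) (a b a' b' : L2 d) :
    ∀ᵐ p : ℝ × Sph d ∂(cylMeasure d),
      outSym (a - a') (b - b') p.1 p.2 = outSym a b p.1 p.2 - outSym a' b' p.1 p.2 := by
  filter_upwards [outSym_add_ae hd (a - a') (b - b') a' b'] with p hp
  rw [sub_add_cancel, sub_add_cancel] at hp
  rw [hp]; simp

/-- `p` is the radiation profile of `twoWave a b` as `t → +∞`. -/
def IsOutgoing (a b : L2 d) (p : ℝ × Sph d → ℂ) : Prop :=
  HasPF p (outSym a b) ∧
  Tendsto (fun t => eLpNorm (fun x => twoWave a b t x - coneWave p t x) 2 volume) atTop (𝓝 0)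

theorem aesm_twoWave_sub (hd : 1 ≤ d) {a b : L2 d} {p : ℝ × Sph d → ℂ} {g : ℝ → Sph d → ℂ}
    (hp : HasPF p g) (t : ℝ) :
    AEStronglyMeasurable (fun x => twoWave a b t x - coneWave p t x) volume :=
  (Lp.memLp (twoWave a b t)).1.sub (aestronglyMeasurable_coneWave hd t hp.1)

theorem IsOutgoing.add (hd : 1 ≤ d) {a b a' b' : L2 d} {p p' : ℝ × Sph d → ℂ}
    (h : IsOutgoing a b p) (h' : IsOutgoing a' b' p') : IsOutgoing (a + a') (b + b') (p + p') := by
  refine ⟨(h.1.add h'.1).congr_right' (outSym_add_ae hd a b a' b'), ?_⟩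
  have hs := h.2.add h'.2
  rw [add_zero] at hs
  refine tendsto_of_tendsto_of_tendsto_of_le_of_le tendsto_const_nhds hs (fun _ => zero_le) fun t => ?_
  refine le_trans (le_of_eq ?_) (eLpNorm_add_le (aesm_twoWave_sub hd h.1 t) (aesm_twoWave_sub hd h'.1 t)
    (by norm_num))
  refine eLpNorm_congr_ae ?_
  rw [twoWave_add]
  filter_upwards [Lp.coeFn_add (twoWave a b t) (twoWave a' b' t), Space.ae_ne_zero hd] with x hx h0
  rw [hx]
  simp only [Pi.add_apply, coneWave, alongCone_eq hd _ _ h0]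
  ring

theorem IsOutgoing.smul (hd : 1 ≤ d) {a b : L2 d} {p : ℝ × Sph d → ℂ} (c : ℂ)
    (h : IsOutgoing a b p) : IsOutgoing (c • a) (c • b) (fun q => c * p q) := by
  refine ⟨(h.1.const_mul c).congr_right' (outSym_smul_ae hd c a b), ?_⟩
  have hs := ENNReal.Tendsto.const_mul (a := ‖c‖ₑ) h.2 (Or.inr (by simp))
  rw [mul_zero] at hs
  refine hs.congr fun t => ?_
  rw [← eLpNorm_const_smul]
  refine eLpNorm_congr_ae ?_
  rw [twoWave_smul]
  filter_upwards [Lp.coeFn_smul c (twoWave a b t), Space.ae_ne_zero hd] with x hx h0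
  rw [hx]
  simp only [Pi.smul_apply, coneWave, alongCone_eq hd _ _ h0, smul_eq_mul]
  ring

/-- A three term estimate: the evolution of the data error, the convergence for a fixed approximant,
and the spherical wave of the profile error. The first and last are bounded by the data error
uniformly in time, so the approximant can be chosen before `t`. -/
theorem IsOutgoing.of_tendsto (hd : 1 ≤ d) {a b : ℕ → L2 d} {p : ℕ → ℝ × Sph d → ℂ} {a' b' : L2 d}
    (h : ∀ n, IsOutgoing (a n) (b n) (p n)) (ha : Tendsto a atTop (𝓝 a'))
    (hb : Tendsto b atTop (𝓝 b')) : ∃ q, IsOutgoing a' b' q := by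
  have hE : Tendsto (fun n => ‖a n - a'‖ₑ + ‖b n - b'‖ₑ) atTop (𝓝 0) := by
    rw [tendsto_iff_edist_tendsto_0] at ha hb
    have := ha.add hb
    simpa [edist_eq_enorm_sub] using this
  obtain ⟨q, hq⟩ := HasPF.exists_of_tendsto (fun n => (h n).1) (fun n => memLp_outSym hd (a n) (b n))
    (memLp_outSym hd a' b') (by
      refine tendsto_of_tendsto_of_tendsto_of_le_of_le tendsto_const_nhds hE (fun _ => zero_le) fun n => ?_
      rw [← eLpNorm_congr_ae (outSym_sub_ae hd (a n) (b n) a' b')]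
      exact eLpNorm_outSym_le hd _ _)
  refine ⟨q, hq, ?_⟩
  rw [ENNReal.tendsto_nhds_zero]
  intro δ hδ
  have hev : ∀ᶠ n in atTop, ‖a n - a'‖ₑ + ‖b n - b'‖ₑ ≤ δ / 3 :=
    (ENNReal.tendsto_nhds_zero.1 hE) (δ / 3) (ENNReal.div_pos hδ.ne' (by norm_num))
  obtain ⟨n, hn⟩ := hev.exists
  filter_upwards [(ENNReal.tendsto_nhds_zero.1 (h n).2) (δ / 3) (ENNReal.div_pos hδ.ne' (by norm_num))]
    with t ht
  have e : (fun x => twoWave a' b' t x - coneWave q t x) =ᵐ[volume]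
      (twoWave (a' - a n) (b' - b n) t : Space d → ℂ) +
        ((fun x => twoWave (a n) (b n) t x - coneWave (p n) t x) + coneWave (p n - q) t) := by
    rw [twoWave_sub]
    filter_upwards [Lp.coeFn_sub (twoWave a' b' t) (twoWave (a n) (b n) t), Space.ae_ne_zero hd] with x hx h0
    simp only [Pi.add_apply, hx, Pi.sub_apply, coneWave, alongCone_eq hd _ _ h0]
    ring
  have hpq := ((h n).1.sub hq)
  rw [eLpNorm_congr_ae e]
  have m2 := aesm_twoWave_sub hd (a := a n) (b := b n) (h n).1 t
  have m3 := aestronglyMeasurable_coneWave hd t hpq.1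
  calc _ ≤ ‖twoWave (a' - a n) (b' - b n) t‖ₑ +
        (eLpNorm (fun x => twoWave (a n) (b n) t x - coneWave (p n) t x) 2 volume +
          eLpNorm (coneWave (p n - q) t) 2 volume) := by
        refine (eLpNorm_add_le (Lp.memLp _).1 (m2.add m3) (by norm_num)).trans ?_
        rw [← Lp.enorm_def]
        gcongr
        exact eLpNorm_add_le m2 m3 (by norm_num)
    _ ≤ δ / 3 + (δ / 3 + δ / 3) := by
        gcongr
        · refine (enorm_twoWave_le _ _ _).trans ?_
          rw [← neg_sub (a n), ← neg_sub (b n), enorm_neg, enorm_neg]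
          exact hn
        · refine (eLpNorm_coneWave_le hd t hpq.1).trans ?_
          refine le_trans ?_ hn
          refine le_trans (le_of_eq ?_) (eLpNorm_outSym_le hd (a n - a') (b n - b'))
          rw [eLpNorm_congr_ae (outSym_sub_ae hd (a n) (b n) a' b')]
          exact hpq.eLpNorm_eq ((aestronglyMeasurable_outSym hd _ _).sub (aestronglyMeasurable_outSym hd _ _))
    _ = δ := by rw [← add_assoc, ENNReal.add_thirds]

end HalfWaveGroup

/-! ### Existence of profiles and concentration on the light cone -/

section Asymptotics
variable {d : ℕ}

theorem halfWave_zero (t : ℝ) : halfWave t (0 : L2 d) = 0 := by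
  have h := halfWave_smul t 0 (0 : L2 d)
  simpa using h

theorem ae_fst_ne_zero : ∀ᵐ p : ℝ × Sph d ∂(cylMeasure d), p.1 ≠ 0 :=
  Measure.quasiMeasurePreserving_fst.ae (Measure.ae_ne volume (0 : ℝ))

/-- Both directions of time at once: `ε = -1` is a Poisson function in the first slot, `ε = 1` in
the second. The pulled back solution converges pointwise to the candidate, its norm never exceeds
that of the data, and by `hs` and `hn` this is the norm of the candidate. -/
theorem isOutgoing_of_poissonFn (hd : 1 ≤ d) {ε : ℝ} (hε : ε = 1 ∨ ε = -1) (y : Space d) {a b : L2 d}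
    (hw : ∀ t, twoWave a b t = halfWave (-(ε * t)) (poissonFn hd y))
    (hn : ‖a‖ₑ ^ 2 + ‖b‖ₑ ^ 2 = ‖poissonFn hd y‖ₑ ^ 2)
    (hs : ∀ᵐ p : ℝ × Sph d ∂(cylMeasure d),
      outSym a b p.1 p.2 = cexp (-(I * ε * tau d)) * poissonProfileSymbol ε y p.1 p.2) :
    IsOutgoing a b (fun p => cexp (-(I * ε * tau d)) * poissonProfile ε y p) := by
  set V : ℝ × Sph d → ℂ := fun p => cexp (-(I * ε * tau d)) * poissonProfile ε y p with hV
  have hPF : HasPF V (outSym a b) := ((hasPF_poissonProfile hd hε y).const_mul _).congr_right' hs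
  have hnorm : eLpNorm V 2 (cylMeasure d) = ‖poissonFn hd y‖ₑ := by
    refine (ENNReal.pow_right_strictMono two_ne_zero).injective ?_
    rw [hPF.eLpNorm_eq (aestronglyMeasurable_outSym hd a b), eLpNorm_outSym_sq hd, hn]
  refine ⟨hPF, ?_⟩
  set u : ℝ → Space d → ℂ := fun t => twoWave a b t with hu
  have hum : ∀ t, AEStronglyMeasurable (u t) volume := fun t => (Lp.memLp (twoWave a b t)).1
  have huK : ∀ t, u t =ᵐ[volume] fun x => poissonKernel d (1 + I * ε * t) ‖x - y‖ := fun t => by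
    have h1 := halfWave_poissonFn hd y (-(ε * t))
    rw [← hw t] at h1
    filter_upwards [h1] with x hx
    rw [hu]; simp only
    rw [hx]; congr 1; push_cast; ring
  set K : ℝ → ℝ × Sph d → ℂ := fun t =>
    polarPull t (fun x => poissonKernel d (1 + I * ε * t) ‖x - y‖) with hK
  have hKu : ∀ t, polarPull t (u t) =ᵐ[(cylMeasure d).restrict {p | 0 < p.1 + t}] K t := fun t =>
    polarPull_congr_ae hd t (huK t)
  have hpm : ∀ t, AEStronglyMeasurable (K t) ((cylMeasure d).restrict {p | 0 < p.1 + t}) := fun t => by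
    refine AEStronglyMeasurable.congr ?_ (hKu t)
    refine AEStronglyMeasurable.mul ?_ ?_
    · exact (Measurable.aestronglyMeasurable (by fun_prop))
    · exact (hum t).comp_quasiMeasurePreserving (quasiMeasurePreserving_shift hd t)
  -- Extension by zero to the whole cylinder puts all times on one measure space. The pointwise
  -- limit is unaffected, because `s + t > 0` eventually.
  set U : ℝ → ℝ × Sph d → ℂ := fun t => {p : ℝ × Sph d | 0 < p.1 + t}.indicator (K t) with hU
  have hUm : ∀ t, AEStronglyMeasurable (U t) (cylMeasure d) := fun t =>
    (aestronglyMeasurable_indicator_iff (measurableSet_shift t)).2 (hpm t)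
  have key := tendsto_eLpNorm_sub_of_ae (μ := cylMeasure d) (U := U) (V := V) hUm
    ⟨hPF.1, by rw [hnorm]; simp⟩ (fun t => by
      rw [hU]
      simp only
      rw [eLpNorm_indicator_eq_eLpNorm_restrict (measurableSet_shift t), ← eLpNorm_congr_ae (hKu t),
        eLpNorm_polarPull hd t (hum t), hnorm, hu]
      simp only
      rw [hw, ← Lp.enorm_def, enorm_halfWave])
    (Eventually.of_forall fun p => by
      refine (tendsto_polarPull_poissonKernel hε y p).congr' ?_
      filter_upwards [eventually_gt_atTop (-p.1)] with t ht
      rw [hU]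
      simp only
      rw [Set.indicator_of_mem (by simp only [Set.mem_ofPred_eq]; linarith)])
  refine tendsto_of_tendsto_of_tendsto_of_le_of_le tendsto_const_nhds key (fun _ => zero_le) fun t => ?_
  simp only
  rw [eLpNorm_sub_coneWave hd t (hum t) hPF.1]
  refine le_trans (le_of_eq ?_) (eLpNorm_restrict_le _ _ _ {p | 0 < p.1 + t})
  refine eLpNorm_congr_ae ?_
  filter_upwards [hKu t, ae_restrict_mem (measurableSet_shift t)] with p hp hmem
  rw [Pi.sub_apply, hp, hU]
  simp only
  rw [Set.indicator_of_mem (s := {p : ℝ × Sph d | 0 < p.1 + t}) hmem]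

theorem isOutgoing_poissonFn_left (hd : 1 ≤ d) (y : Space d) :
    ∃ p, IsOutgoing (poissonFn hd y) 0 p := by
  refine ⟨_, isOutgoing_of_poissonFn hd (ε := -1) (Or.inr rfl) y (fun t => ?_) (by simp) ?_⟩
  · rw [twoWave, halfWave_zero, add_zero]; congr 1; ring
  · have h0 : (𝓕 (0 : L2 d) : L2 d) =ᵐ[volume] 0 := by
      rw [FourierTransform.fourier_zero]; exact Lp.coeFn_zero _ _ _
    have h1 : (fun ξ => cexp (I * tau d) * (𝓕 (poissonFn hd y) : L2 d) ξ) =ᵐ[volume]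
        fun ξ => cexp (I * tau d) * poissonSymbol y ξ := by
      filter_upwards [fourier_poissonFn hd y] with ξ h; rw [h]
    have h2 : (fun ξ => cexp (-(I * tau d)) * (𝓕 (0 : L2 d) : L2 d) ξ) =ᵐ[volume] fun _ => 0 := by
      filter_upwards [h0] with ξ h; rw [h]; simp
    filter_upwards [sym_congr_ae hd h1 h2, ae_fst_ne_zero] with p hp hne
    rw [outSym, hp, sym, poissonProfileSymbol]
    rcases lt_or_gt_of_ne hne with h | h
    · rw [if_pos h, if_pos (by linarith)]
      push_cast
      rw [show -(I * -1 * tau d) = I * tau d by ring]; ring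
    · rw [if_neg h.not_gt, if_neg (by linarith)]; simp

theorem isOutgoing_poissonFn_right (hd : 1 ≤ d) (y : Space d) :
    ∃ p, IsOutgoing 0 (poissonFn hd y) p := by
  refine ⟨_, isOutgoing_of_poissonFn hd (ε := 1) (Or.inl rfl) y (fun t => ?_) (by simp) ?_⟩
  · rw [twoWave, halfWave_zero, zero_add]; congr 1; ring
  · have h0 : (𝓕 (0 : L2 d) : L2 d) =ᵐ[volume] 0 := by
      rw [FourierTransform.fourier_zero]; exact Lp.coeFn_zero _ _ _
    have h1 : (fun ξ => cexp (-(I * tau d)) * (𝓕 (poissonFn hd y) : L2 d) ξ) =ᵐ[volume]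
        fun ξ => cexp (-(I * tau d)) * poissonSymbol y ξ := by
      filter_upwards [fourier_poissonFn hd y] with ξ h; rw [h]
    have h2 : (fun ξ => cexp (I * tau d) * (𝓕 (0 : L2 d) : L2 d) ξ) =ᵐ[volume] fun _ => 0 := by
      filter_upwards [h0] with ξ h; rw [h]; simp
    filter_upwards [sym_congr_ae hd h2 h1, ae_fst_ne_zero] with p hp hne
    rw [outSym, hp, sym, poissonProfileSymbol]
    rcases lt_or_gt_of_ne hne with h | h
    · rw [if_pos h, if_neg (by linarith)]; simp
    · rw [if_neg h.not_gt, if_pos (by linarith)]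
      push_cast
      rw [show -(I * 1 * tau d) = -(I * tau d) by ring]; ring

/-- The linear space of pairs `(a, b)` for which `twoWave a b` has a radiation profile. -/
def outgoingPairs (hd : 1 ≤ d) : Submodule ℂ (L2 d × L2 d) where
  carrier := {q | ∃ p, IsOutgoing q.1 q.2 p}
  add_mem' := fun ⟨_, h⟩ ⟨_, h'⟩ => ⟨_, h.add hd h'⟩
  zero_mem' := by
    obtain ⟨p, hp⟩ := isOutgoing_poissonFn_left hd (0 : Space d)
    have := hp.smul hd 0
    rw [zero_smul, smul_zero] at this
    exact ⟨_, this⟩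
  smul_mem' := fun c _ ⟨_, h⟩ => ⟨_, h.smul hd c⟩

theorem isClosed_outgoingPairs (hd : 1 ≤ d) : IsClosed (outgoingPairs hd : Set (L2 d × L2 d)) := by
  refine IsSeqClosed.isClosed fun q q' hq hlim => ?_
  choose p hp using hq
  exact IsOutgoing.of_tendsto hd hp ((continuous_fst.tendsto _).comp hlim)
    ((continuous_snd.tendsto _).comp hlim)

theorem mem_of_forall_poissonFn (hd : 1 ≤ d) {S : Submodule ℂ (L2 d)} (hS : IsClosed (S : Set (L2 d)))
    (h : ∀ y, poissonFn hd y ∈ S) (a : L2 d) : a ∈ S := by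
  have h1 : Submodule.span ℂ (Set.range (poissonFn hd)) ≤ S :=
    Submodule.span_le.2 (by rintro _ ⟨y, rfl⟩; exact h y)
  have h2 := Submodule.topologicalClosure_minimal _ h1 hS
  rw [dense_span_poissonFn hd] at h2
  exact h2 trivial

/-- The pairs with a profile form a closed subspace. Its intersection with each coordinate axis
contains all Poisson functions, hence the whole axis, and the two axes span. -/
theorem exists_isOutgoing (hd : 1 ≤ d) (a b : L2 d) : ∃ p, IsOutgoing a b p := by
  have h1 : a ∈ (outgoingPairs hd).comap (LinearMap.inl ℂ (L2 d) (L2 d)) := by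
    refine mem_of_forall_poissonFn hd ?_ (fun y => isOutgoing_poissonFn_left hd y) a
    exact (isClosed_outgoingPairs hd).preimage (ContinuousLinearMap.inl ℂ (L2 d) (L2 d)).continuous
  have h2 : b ∈ (outgoingPairs hd).comap (LinearMap.inr ℂ (L2 d) (L2 d)) := by
    refine mem_of_forall_poissonFn hd ?_ (fun y => isOutgoing_poissonFn_right hd y) b
    exact (isClosed_outgoingPairs hd).preimage (ContinuousLinearMap.inr ℂ (L2 d) (L2 d)).continuous
  obtain ⟨p, hp⟩ := h1
  obtain ⟨q, hq⟩ := h2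
  have := IsOutgoing.add hd hp hq
  simp only [LinearMap.inl_apply, LinearMap.inr_apply, add_zero, zero_add] at this
  exact ⟨_, this⟩

/-- Some profile exists, and the partial transform determines it almost everywhere; hence any
function with the right transform serves. -/
theorem HasPF.isOutgoing (hd : 1 ≤ d) {a b : L2 d} {p : ℝ × Sph d → ℂ} (hp : HasPF p (outSym a b)) :
    IsOutgoing a b p := by
  obtain ⟨q, hq⟩ := exists_isOutgoing hd a b
  refine ⟨hp, hq.2.congr fun t => eLpNorm_congr_ae ?_⟩
  filter_upwards [coneWave_congr_ae hd t (hp.unique hq.1)] with x hx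
  rw [hx]

theorem HasPF.memLp_outSym (hd : 1 ≤ d) {a b : L2 d} {p : ℝ × Sph d → ℂ} (hp : HasPF p (outSym a b)) :
    MemLp p 2 (cylMeasure d) :=
  ⟨hp.1, by
    rw [hp.eLpNorm_eq (aestronglyMeasurable_outSym hd a b)]
    exact (RadiationField.memLp_outSym hd a b).2⟩

/-- The measure with density `|p|²` is finite, and the sets `|s| ≥ R` decrease to the empty set. -/
theorem tendsto_eLpNorm_restrict_abs_ge {p : ℝ × Sph d → ℂ} (hp : MemLp p 2 (cylMeasure d)) :
    Tendsto (fun R : ℝ => eLpNorm p 2 ((cylMeasure d).restrict {q | R ≤ |q.1|})) atTop (𝓝 0) := by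
  have hmeas : ∀ R : ℝ, MeasurableSet {q : ℝ × Sph d | R ≤ |q.1|} := fun R =>
    measurableSet_le measurable_const (by fun_prop)
  set ν : Measure (ℝ × Sph d) := (cylMeasure d).withDensity fun q => ‖p q‖ₑ ^ 2 with hν
  have hνfin : ν Set.univ ≠ ∞ := by
    rw [hν, withDensity_apply _ MeasurableSet.univ, Measure.restrict_univ, ← eLpNorm_two_sq]
    exact (ENNReal.pow_lt_top hp.2).ne
  have hν0 : Tendsto (fun R : ℝ => ν {q | R ≤ |q.1|}) atTop (𝓝 0) := by
    have h1 := tendsto_measure_iInter_atTop (μ := ν) (s := fun R : ℝ => {q : ℝ × Sph d | R ≤ |q.1|})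
      (fun R => (hmeas R).nullMeasurableSet) (fun R R' h q hq => le_trans h hq)
      ⟨0, ne_top_of_le_ne_top hνfin (measure_mono (Set.subset_univ _))⟩
    have h2 : (⋂ R : ℝ, {q : ℝ × Sph d | R ≤ |q.1|}) = ∅ := by
      ext q
      simp only [Set.mem_iInter, Set.mem_ofPred_eq, Set.mem_empty_iff_false, iff_false, not_forall, not_le]
      exact ⟨|q.1| + 1, by linarith⟩
    rwa [h2, measure_empty] at h1
  have h5 := (ENNReal.continuous_rpow_const (y := 1 / 2)).tendsto 0 |>.comp hν0
  rw [ENNReal.zero_rpow_of_pos (by norm_num)] at h5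
  refine h5.congr fun R => ?_
  simp only [Function.comp_apply]
  rw [hν, withDensity_apply _ (hmeas R), ← eLpNorm_two_sq, ← ENNReal.rpow_natCast, ← ENNReal.rpow_mul]
  norm_num

theorem limsup_normOffCone_twoWave (hd : 1 ≤ d) (a b : L2 d) :
    Tendsto (fun R : ℝ => limsup (fun t => normOffCone (fun t x => twoWave a b t x) R t) atTop)
      atTop (𝓝 0) := by
  obtain ⟨p, hp⟩ := exists_isOutgoing hd a b
  refine tendsto_of_tendsto_of_tendsto_of_le_of_le tendsto_const_nhds
    (tendsto_eLpNorm_restrict_abs_ge (hp.1.memLp_outSym hd)) (fun _ => zero_le) fun R => ?_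
  simp only
  set m := eLpNorm p 2 ((cylMeasure d).restrict {q | R ≤ |q.1|}) with hm
  have h1 : Tendsto (fun t => eLpNorm (fun x => twoWave a b t x - coneWave p t x) 2 volume + m) atTop
      (𝓝 (0 + m)) := hp.2.add_const m
  rw [zero_add] at h1
  rw [← h1.limsup_eq]
  refine limsup_le_limsup ?_
  filter_upwards [eventually_ge_atTop 0] with t ht
  rw [normOffCone]
  have m1 := aesm_twoWave_sub hd (a := a) (b := b) hp.1 t
  have m2 := aestronglyMeasurable_coneWave hd t hp.1.1
  have e : (fun x => twoWave a b t x) =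
      (fun x => twoWave a b t x - coneWave p t x) + coneWave p t := by
    ext x; simp
  rw [e]
  refine (eLpNorm_add_le m1.restrict m2.restrict (by norm_num)).trans ?_
  exact add_le_add (eLpNorm_restrict_le _ _ _ _) (eLpNorm_coneWave_offCone_le hd ht R hp.1.1)

/-- Reversing time exchanges `a` and `b` and does not change `|t|`, so the past follows from the
future. -/
theorem concentratesOnCone_twoWave (hd : 1 ≤ d) (a b : L2 d) :
    ConcentratesOnCone fun t x => twoWave a b t x := by
  refine ⟨limsup_normOffCone_twoWave hd a b, (limsup_normOffCone_twoWave hd b a).congr fun R => ?_⟩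
  rw [← Filter.map_neg_atTop, ← Filter.limsup_comp]
  congr 1
  ext t
  simp only [Function.comp_apply, normOffCone, abs_neg, twoWave_neg_time]

end Asymptotics

/-! ### The half-wave equation -/

section HalfWaveTheorem
variable {d : ℕ}

theorem IsOutgoing.tendstoZeroL2 (hd : 1 ≤ d) {a b : L2 d} {p : ℝ × Sph d → ℂ}
    (h : IsOutgoing a b p) : TendstoZeroL2 fun t x => twoWave a b t x - coneWave p t x := by
  refine ⟨fun t => (Lp.memLp (twoWave a b t)).sub
    ⟨aestronglyMeasurable_coneWave hd t h.1.1, ?_⟩, h.2⟩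
  exact (eLpNorm_coneWave_le hd t h.1.1).trans_lt (h.1.memLp_outSym hd).2

theorem TendstoZeroL2.congr {G : Type*} [NormedAddCommGroup G] {F F' : ℝ → Space d → G}
    (h : TendstoZeroL2 F) (e : ∀ t, F t =ᵐ[volume] F' t) : TendstoZeroL2 F' :=
  ⟨fun t => (h.1 t).ae_eq (e t), h.2.congr fun t => eLpNorm_congr_ae (e t)⟩

theorem hat_two_pi_mul_smul (f : L2 d) (l : ℝ) (ω : Space d) :
    hat f ((2 * Real.pi * l) • ω) = (𝓕 f : L2 d) (l • ω) := by
  rw [hat, smul_smul]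
  congr 2
  field_simp

theorem abs_two_pi_mul_rpow (l β : ℝ) :
    |2 * Real.pi * l| ^ β = (2 * Real.pi) ^ β * |l| ^ β := by
  rw [abs_mul, abs_of_pos (by positivity), Real.mul_rpow (by positivity) (abs_nonneg _)]

/-- Data in the first slot radiate through negative frequencies only. The factor `(2π)^((d-1)/2)` is
the cost of replacing `|l|` by `|ν| = 2π|l|`; the two conventions at frequency zero differ on a null
set. -/
theorem outSym_zero_right_ae (hd : 1 ≤ d) (f : L2 d) :
    ∀ᵐ p : ℝ × Sph d ∂(cylMeasure d), outSym f 0 p.1 p.2 =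
      cexp (I * tau d) / (((2 * Real.pi) ^ (((d : ℝ) - 1) / 2) : ℝ) : ℂ) *
        (if 2 * Real.pi * p.1 ≤ 0 then ((|2 * Real.pi * p.1| ^ (((d : ℝ) - 1) / 2) : ℝ) : ℂ) *
          hat f ((2 * Real.pi * p.1) • (p.2 : Space d)) else 0) := by
  have h2 : (fun ξ => cexp (-(I * tau d)) * (𝓕 (0 : L2 d) : L2 d) ξ) =ᵐ[volume] fun _ => 0 := by
    have h0 : (𝓕 (0 : L2 d) : L2 d) =ᵐ[volume] 0 := by
      rw [FourierTransform.fourier_zero]; exact Lp.coeFn_zero _ _ _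
    filter_upwards [h0] with ξ h; rw [h]; simp
  filter_upwards [sym_congr_ae hd (ae_eq_refl fun ξ => cexp (I * tau d) * (𝓕 f : L2 d) ξ) h2,
    ae_fst_ne_zero] with p hp hne
  rw [outSym, hp, sym, hat_two_pi_mul_smul, abs_two_pi_mul_rpow]
  have hpi : (2 * Real.pi) ^ (((d : ℝ) - 1) / 2) ≠ 0 := by positivity
  have hpi' : (((2 * Real.pi) ^ (((d : ℝ) - 1) / 2) : ℝ) : ℂ) ≠ 0 := by exact_mod_cast hpi
  rcases lt_or_gt_of_ne hne with h | h
  · rw [if_pos h, if_pos (mul_nonpos_of_nonneg_of_nonpos (by positivity) h.le), ofReal_mul]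
    field_simp
  · rw [if_neg h.not_gt, if_neg (by have := Real.pi_pos; simp only [not_le]; positivity)]
    simp

theorem exists_isMinusProfile (hd : 1 ≤ d) (f : L2 d) : ∃ P : ℝ × Sph d → ℂ, IsMinusProfile f P := by
  obtain ⟨p, hp⟩ := exists_isOutgoing hd f 0
  set c : ℂ := cexp (I * tau d) / (((2 * Real.pi) ^ (((d : ℝ) - 1) / 2) : ℝ) : ℂ) with hc
  have hc0 : c ≠ 0 := by
    rw [hc]
    refine div_ne_zero (Complex.exp_ne_zero _) ?_
    have : (2 * Real.pi) ^ (((d : ℝ) - 1) / 2) ≠ 0 := by positivity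
    exact_mod_cast this
  refine ⟨_, hasPartialFourier_iff.2 ((hp.1.const_mul c⁻¹).congr_right' ?_)⟩
  filter_upwards [outSym_zero_right_ae hd f] with p hp
  rw [hp, ← hc, inv_mul_cancel_left₀ hc0]

theorem IsMinusProfile.tendstoZeroL2 (hd : 1 ≤ d) {f : L2 d} {P : ℝ × Sph d → ℂ}
    (hP : IsMinusProfile f P) :
    TendstoZeroL2 fun (t : ℝ) (x : Space d) => halfWave t f x -
      cexp (I * tau d) / (((2 * Real.pi * ‖x‖) ^ (((d : ℝ) - 1) / 2) : ℝ) : ℂ) *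
        alongCone P t x := by
  have h1 := ((hasPartialFourier_iff.1 hP).const_mul (cexp (I * tau d) /
    (((2 * Real.pi) ^ (((d : ℝ) - 1) / 2) : ℝ) : ℂ))).congr_right' (outSym_zero_right_ae hd f)
  refine (h1.isOutgoing hd).tendstoZeroL2 hd |>.congr fun t => ?_
  filter_upwards [Space.ae_ne_zero hd] with x hx
  rw [twoWave, halfWave_zero, add_zero, coneWave, alongCone_eq hd _ _ hx, alongCone_eq hd _ _ hx,
    Real.mul_rpow (by positivity) (norm_nonneg _), Real.rpow_neg (norm_nonneg _)]
  push_cast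
  congr 1
  field_simp

theorem concentratesOnCone_halfWave (hd : 1 ≤ d) (f : L2 d) :
    ConcentratesOnCone fun (t : ℝ) (x : Space d) => halfWave t f x := by
  have := concentratesOnCone_twoWave hd f 0
  simpa only [twoWave, halfWave_zero, add_zero] using this

end HalfWaveTheorem

/-! ### Pairing distributions with Fourier transforms of test functions -/

section Pairing
variable {d : ℕ}

/-- The `j`-th vector of the standard basis. -/
abbrev basisVec (j : Fin d) : Space d := EuclideanSpace.single j (1 : ℝ)

/-- Multiplication of a Schwartz function by the `j`-th coordinate. -/
def coordMul (j : Fin d) (ψ : 𝓢(Space d, ℂ)) : 𝓢(Space d, ℂ) :=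
  SchwartzMap.smulLeftCLM ℂ (fun ξ : Space d => inner ℝ ξ (basisVec j)) ψ

theorem coordMul_apply (j : Fin d) (ψ : 𝓢(Space d, ℂ)) (ξ : Space d) :
    coordMul j ψ ξ = (ξ j : ℂ) * ψ ξ := by
  rw [coordMul, SchwartzMap.smulLeftCLM_apply_apply (by fun_prop), EuclideanSpace.inner_single_right]
  simp

theorem L2.apply_fourier (f : L2 d) (ψ : 𝓢(Space d, ℂ)) :
    (f : 𝓢'(Space d, ℂ)) (𝓕 ψ) = ∫ ξ, ψ ξ * (𝓕 f : L2 d) ξ := by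
  rw [← TemperedDistribution.fourier_apply, Lp.fourier_toTemperedDistribution_eq,
    Lp.toTemperedDistribution_apply]
  rfl

/-- Testing against `𝓕 ψ` turns a derivative into multiplication by `2πi ξ_j`. The sign from
integration by parts cancels the one from differentiating the kernel `exp(-2πi x·ξ)`. -/
theorem lineDeriv_apply_fourier (u : 𝓢'(Space d, ℂ)) (j : Fin d) (ψ : 𝓢(Space d, ℂ)) :
    (∂_{basisVec j} u) (𝓕 ψ) = 2 * Real.pi * I * (𝓕 u) (coordMul j ψ) := by
  rw [TemperedDistribution.lineDerivOp_apply_apply, SchwartzMap.lineDerivOp_fourier_eq,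
    TemperedDistribution.fourier_apply, neg_smul, FourierTransform.fourier_neg, neg_neg,
    FourierTransform.fourier_smul, map_smul]
  rfl

theorem L2.lineDeriv_apply_fourier (f : L2 d) (j : Fin d) (ψ : 𝓢(Space d, ℂ)) :
    (∂_{basisVec j} (f : 𝓢'(Space d, ℂ))) (𝓕 ψ) =
      ∫ ξ, ψ ξ * (2 * Real.pi * I * ξ j * (𝓕 f : L2 d) ξ) := by
  rw [RadiationField.lineDeriv_apply_fourier, TemperedDistribution.fourier_apply, L2.apply_fourier,
    ← integral_const_mul]
  congr 1; ext ξ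
  rw [coordMul_apply]; ring

theorem exists_fourier_eq_schwartz (φ : 𝓢(Space d, ℂ)) : ∃ ψ : 𝓢(Space d, ℂ), 𝓕 ψ = φ :=
  ⟨𝓕⁻ φ, FourierTransform.fourier_fourierInv_eq φ⟩

theorem L2.coe_injective : Function.Injective fun f : L2 d => (f : 𝓢'(Space d, ℂ)) := by
  have h := LinearMap.ker_eq_bot.1 (Lp.ker_toTemperedDistributionCLM_eq_bot (E := Space d) (F := ℂ)
    (μ := volume) (p := 2))
  exact h

/-- A complex-valued test function obtained from a real one. -/
def toComplexSchwartz {g : Space d → ℝ} (h1 : ContDiff ℝ ((⊤ : ℕ∞) : WithTop ℕ∞) g)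
    (h2 : HasCompactSupport g) : 𝓢(Space d, ℂ) :=
  HasCompactSupport.toSchwartzMap (f := fun x => (g x : ℂ))
    (h2.comp_left (g := fun r : ℝ => (r : ℂ)) ofReal_zero)
    (Complex.ofRealCLM.contDiff.comp h1)

theorem toComplexSchwartz_apply {g : Space d → ℝ} (h1 : ContDiff ℝ ((⊤ : ℕ∞) : WithTop ℕ∞) g)
    (h2 : HasCompactSupport g) (x : Space d) : toComplexSchwartz h1 h2 x = g x := rfl

theorem ae_eq_zero_of_forall_schwartz {k : Space d → ℂ} (hk : LocallyIntegrable k volume)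
    (h : ∀ ψ : 𝓢(Space d, ℂ), HasCompactSupport ψ → ∫ ξ, ψ ξ * k ξ = 0) : k =ᵐ[volume] 0 := by
  refine ae_eq_zero_of_integral_contDiff_smul_eq_zero hk fun g h1 h2 => ?_
  have := h (toComplexSchwartz h1 h2) (h2.comp_left (g := fun r : ℝ => (r : ℂ)) ofReal_zero)
  simpa only [toComplexSchwartz_apply, ← Complex.real_smul] using this

theorem locallyIntegrable_L2 (f : L2 d) : LocallyIntegrable f volume :=
  (Lp.memLp f).locallyIntegrable (by norm_num)

theorem locallyIntegrable_mul_L2 {m : Space d → ℂ} (hm : Continuous m) (f : L2 d) :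
    LocallyIntegrable (fun ξ => m ξ * f ξ) volume :=
  (locallyIntegrable_L2 f).continuous_mul hm

theorem integrable_schwartz_mul_L2 (ψ : 𝓢(Space d, ℂ)) (f : L2 d) :
    Integrable (fun ξ => ψ ξ * f ξ) volume :=
  (ψ.memLp 2 volume).integrable_mul (Lp.memLp f)

end Pairing

/-! ### Continuity and weak differentiability in time -/

section TimeRegularity
variable {d : ℕ}

theorem enorm_L2_sq (f : L2 d) : ‖f‖ₑ ^ 2 = ∫⁻ ξ, ‖(𝓕 f : L2 d) ξ‖ₑ ^ 2 := by
  rw [← ofReal_norm, ← Lp.norm_fourier_eq f, ofReal_norm, Lp.enorm_def, eLpNorm_two_sq]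

theorem fourier_sub_ae (f g : L2 d) :
    (𝓕 (f - g) : L2 d) =ᵐ[volume] fun ξ => (𝓕 f : L2 d) ξ - (𝓕 g : L2 d) ξ := by
  rw [fourier_L2_sub]
  exact Lp.coeFn_sub _ _

theorem norm_phase (t r : ℝ) : ‖cexp (I * (t * r : ℝ))‖ = 1 := by
  rw [mul_comm I, norm_exp_ofReal_mul_I]

/-- Dominated convergence on the Fourier side, with majorant `(2|𝓕 f|)²`. No rate can be expected
for general `L²` data. -/
theorem continuous_halfWave (f : L2 d) : Continuous fun t => halfWave t f := by
  refine continuous_iff_continuousAt.2 fun t₀ => ?_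
  rw [ContinuousAt, tendsto_iff_edist_tendsto_0]
  have hsq : Tendsto (fun t => edist (halfWave t f) (halfWave t₀ f) ^ 2) (𝓝 t₀) (𝓝 0) := by
    have e : ∀ t, edist (halfWave t f) (halfWave t₀ f) ^ 2 = ∫⁻ ξ : Space d,
        ‖(cexp (I * (t * ‖(2 * Real.pi) • ξ‖ : ℝ)) - cexp (I * (t₀ * ‖(2 * Real.pi) • ξ‖ : ℝ))) *
          (𝓕 f : L2 d) ξ‖ₑ ^ 2 := fun t => by
      rw [edist_eq_enorm_sub, enorm_L2_sq]
      refine lintegral_congr_ae ?_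
      filter_upwards [fourier_sub_ae (halfWave t f) (halfWave t₀ f), fourier_halfWave t f,
        fourier_halfWave t₀ f] with ξ h1 h2 h3
      rw [h1, h2, h3, sub_mul]
    simp_rw [e]
    have := tendsto_lintegral_filter_of_dominated_convergence (μ := (volume : Measure (Space d)))
      (l := 𝓝 t₀) (F := fun t ξ =>
        ‖(cexp (I * (t * ‖(2 * Real.pi) • ξ‖ : ℝ)) - cexp (I * (t₀ * ‖(2 * Real.pi) • ξ‖ : ℝ))) *
          (𝓕 f : L2 d) ξ‖ₑ ^ 2) (f := fun _ => 0)
      (fun ξ => (2 * ‖(𝓕 f : L2 d) ξ‖ₑ) ^ 2) ?_ ?_ ?_ ?_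
    · simpa using this
    · refine Eventually.of_forall fun t => Measurable.pow_const (Measurable.enorm (.mul ?_ ?_)) 2
      · exact Continuous.measurable (by fun_prop)
      · exact (Lp.stronglyMeasurable _).measurable
    · refine Eventually.of_forall fun t => Eventually.of_forall fun ξ => ?_
      rw [enorm_mul]
      gcongr
      refine enorm_sub_le.trans ?_
      rw [← ofReal_norm, ← ofReal_norm, norm_phase, norm_phase]
      norm_num
    · simp_rw [mul_pow]
      rw [lintegral_const_mul' _ _ (by norm_num), ← enorm_L2_sq]
      exact ENNReal.mul_ne_top (by norm_num) (by simp)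
    · refine Eventually.of_forall fun ξ => ?_
      have hc : Continuous fun t : ℝ =>
        ‖(cexp (I * (t * ‖(2 * Real.pi) • ξ‖ : ℝ)) - cexp (I * (t₀ * ‖(2 * Real.pi) • ξ‖ : ℝ))) *
          (𝓕 f : L2 d) ξ‖ₑ ^ 2 := (ENNReal.continuous_pow 2).comp (continuous_enorm.comp (by fun_prop))
      have := hc.tendsto t₀
      simpa using this
  have h5 := (ENNReal.continuous_rpow_const (y := 1 / 2)).tendsto 0 |>.comp hsq
  rw [ENNReal.zero_rpow_of_pos (by norm_num)] at h5
  refine h5.congr fun t => ?_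
  simp only [Function.comp_apply]
  rw [← ENNReal.rpow_natCast, ← ENNReal.rpow_mul]
  norm_num

theorem continuous_twoWave (a b : L2 d) : Continuous (twoWave a b) :=
  (continuous_halfWave a).add ((continuous_halfWave b).comp continuous_neg)

theorem integrable_schwartz_norm_mul_L2 (ψ : 𝓢(Space d, ℂ)) (f : L2 d) :
    Integrable (fun ξ => ‖ψ ξ‖ * ‖ξ‖ * ‖f ξ‖) volume := by
  set χ : 𝓢(Space d, ℂ) := SchwartzMap.smulLeftCLM ℂ (fun ξ : Space d => (1 + ‖ξ‖ ^ 2 : ℝ)) ψ with hχ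
  refine (integrable_schwartz_mul_L2 χ f).mono ?_ (Eventually.of_forall fun ξ => ?_)
  · exact (Continuous.aestronglyMeasurable (by fun_prop)).mul (Lp.memLp f).1.norm
  · rw [hχ, SchwartzMap.smulLeftCLM_apply_apply (by fun_prop), norm_mul, norm_mul, norm_mul, norm_smul,
      norm_norm, norm_norm, norm_norm, mul_comm ‖ψ ξ‖]
    gcongr
    rw [Real.norm_of_nonneg (by positivity)]
    nlinarith [sq_nonneg (‖ξ‖ - 1), norm_nonneg ξ]

/-- The time derivative costs a factor `|ξ|`, which need not be square integrable against `𝓕 f`; the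
Schwartz function absorbs it, so differentiation under the integral is possible after testing. -/
theorem hasDerivAt_halfWave_apply (f : L2 d) (ψ : 𝓢(Space d, ℂ)) (t : ℝ) :
    HasDerivAt (fun s => (halfWave s f : 𝓢'(Space d, ℂ)) (𝓕 ψ))
      (∫ ξ, ψ ξ * (2 * Real.pi * I * ‖ξ‖ * (𝓕 (halfWave t f) : L2 d) ξ)) t := by
  have hm := (Lp.memLp (𝓕 f : L2 d)).1
  have key := hasDerivAt_integral_of_dominated_loc_of_deriv_le (μ := (volume : Measure (Space d)))
    (F := fun (s : ℝ) ξ => ψ ξ * (cexp (I * (s * ‖(2 * Real.pi) • ξ‖ : ℝ)) * (𝓕 f : L2 d) ξ))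
    (F' := fun (s : ℝ) ξ => ψ ξ * (2 * Real.pi * I * ‖ξ‖ *
      (cexp (I * (s * ‖(2 * Real.pi) • ξ‖ : ℝ)) * (𝓕 f : L2 d) ξ)))
    (x₀ := t) (s := Set.univ) (bound := fun ξ => 2 * Real.pi * (‖ψ ξ‖ * ‖ξ‖ * ‖(𝓕 f : L2 d) ξ‖))
    univ_mem ?_ ?_ ?_ ?_ ?_ ?_
  · refine (key.2.congr_deriv (integral_congr_ae ?_)).congr_of_eventuallyEq
      (Eventually.of_forall fun s => ?_)
    · filter_upwards [fourier_halfWave t f] with ξ h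
      rw [h]
    · simp only
      rw [L2.apply_fourier]
      refine integral_congr_ae ?_
      filter_upwards [fourier_halfWave s f] with ξ h
      rw [h]
  · refine Eventually.of_forall fun s => ψ.continuous.aestronglyMeasurable.mul (.mul ?_ hm)
    exact Continuous.aestronglyMeasurable (by fun_prop)
  · refine (integrable_schwartz_mul_L2 ψ (𝓕 f : L2 d)).mono ?_ (Eventually.of_forall fun ξ => ?_)
    · refine ψ.continuous.aestronglyMeasurable.mul (.mul ?_ hm)
      exact Continuous.aestronglyMeasurable (by fun_prop)
    · rw [norm_mul, norm_mul, norm_phase, one_mul, norm_mul]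
  · refine ψ.continuous.aestronglyMeasurable.mul (.mul ?_ (.mul ?_ hm)) <;>
    exact Continuous.aestronglyMeasurable (by fun_prop)
  · refine Eventually.of_forall fun ξ s _ => le_of_eq ?_
    simp only [norm_mul, norm_phase, norm_I, norm_real, norm_norm, RCLike.norm_ofNat]
    rw [Real.norm_of_nonneg Real.pi_pos.le]
    ring
  · exact (integrable_schwartz_norm_mul_L2 ψ (𝓕 f : L2 d)).const_mul _
  · refine Eventually.of_forall fun ξ s _ => ?_
    have h1 : HasDerivAt (fun s : ℝ => (I * (s * ‖(2 * Real.pi) • ξ‖ : ℝ) : ℂ))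
        (I * (1 * ‖(2 * Real.pi) • ξ‖ : ℝ)) s :=
      (((hasDerivAt_id s).mul_const ‖(2 * Real.pi) • ξ‖).ofReal_comp).const_mul I
    refine ((h1.cexp.mul_const _).const_mul _).congr_deriv ?_
    rw [norm_smul, Real.norm_of_nonneg (by positivity)]
    push_cast
    ring

theorem integrable_schwartz_norm_mul_L2' (ψ : 𝓢(Space d, ℂ)) (f : L2 d) :
    Integrable (fun ξ => ψ ξ * (2 * Real.pi * I * ‖ξ‖ * f ξ)) volume := by
  refine ((integrable_schwartz_norm_mul_L2 ψ f).const_mul (2 * Real.pi)).mono ?_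
    (Eventually.of_forall fun ξ => le_of_eq ?_)
  · refine ψ.continuous.aestronglyMeasurable.mul (.mul ?_ (Lp.memLp f).1)
    exact Continuous.aestronglyMeasurable (by fun_prop)
  · simp only [norm_mul, norm_I, norm_real, norm_norm, RCLike.norm_ofNat]
    rw [Real.norm_of_nonneg Real.pi_pos.le]
    ring

theorem hasDerivAt_twoWave_apply (a b : L2 d) (ψ : 𝓢(Space d, ℂ)) (t : ℝ) :
    HasDerivAt (fun s => (twoWave a b s : 𝓢'(Space d, ℂ)) (𝓕 ψ))
      (∫ ξ, ψ ξ * (2 * Real.pi * I * ‖ξ‖ *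
        ((𝓕 (halfWave t a) : L2 d) ξ - (𝓕 (halfWave (-t) b) : L2 d) ξ))) t := by
  have h1 := hasDerivAt_halfWave_apply a ψ t
  have h2 := (hasDerivAt_halfWave_apply b ψ (-t)).scomp t (hasDerivAt_neg t)
  refine ((h1.add h2).congr_deriv ?_).congr_of_eventuallyEq (Eventually.of_forall fun s => ?_)
  · rw [neg_one_smul, ← sub_eq_add_neg, ← integral_sub (integrable_schwartz_norm_mul_L2' _ _)
      (integrable_schwartz_norm_mul_L2' _ _)]
    congr 1; ext ξ; ring
  · have := map_add (Lp.toTemperedDistributionCLM ℂ (volume : Measure (Space d)) 2) (halfWave s a)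
      (halfWave (-s) b)
    exact congrArg (fun u : 𝓢'(Space d, ℂ) => u (𝓕 ψ)) this

end TimeRegularity

/-! ### Riesz transforms and `L²` gradients -/

section Riesz
variable {d : ℕ}

theorem norm_riesz_symbol_le (j : Fin d) (ξ : Space d) : ‖(I * (ξ j / ‖ξ‖ : ℝ) : ℂ)‖ ≤ 1 := by
  rw [norm_mul, norm_I, one_mul, norm_real, norm_div, norm_norm]
  exact div_le_one_of_le₀ (PiLp.norm_apply_le ξ j) (norm_nonneg _)

theorem memLp_riesz (j : Fin d) (g : L2 d) :
    MemLp (fun ξ : Space d => I * (ξ j / ‖ξ‖ : ℝ) * g ξ) 2 volume := by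
  refine (Lp.memLp g).of_le ?_ (Eventually.of_forall fun ξ => ?_)
  · refine AEStronglyMeasurable.mul (Measurable.aestronglyMeasurable ?_) (Lp.aestronglyMeasurable g)
    fun_prop
  · rw [norm_mul]
    exact mul_le_of_le_one_left (norm_nonneg _) (norm_riesz_symbol_le j ξ)

/-- The Fourier multiplier with symbol `i ξ_j / |ξ|`. -/
def riesz (j : Fin d) (f : L2 d) : L2 d := 𝓕⁻ ((memLp_riesz j (𝓕 f : L2 d)).toLp)

theorem fourier_riesz (j : Fin d) (f : L2 d) :
    (𝓕 (riesz j f) : L2 d) =ᵐ[volume] fun ξ => I * (ξ j / ‖ξ‖ : ℝ) * (𝓕 f : L2 d) ξ := by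
  rw [riesz, FourierTransform.fourier_fourierInv_eq]
  exact (memLp_riesz j (𝓕 f : L2 d)).coeFn_toLp

theorem fourier_sum_ae {ι : Type*} [Fintype ι] (f : ι → L2 d) :
    (𝓕 (∑ j, f j) : L2 d) =ᵐ[volume] fun ξ => ∑ j, (𝓕 (f j) : L2 d) ξ := by
  have h : (𝓕 (∑ j, f j) : L2 d) = ∑ j, (𝓕 (f j) : L2 d) := FourierTransform.fourier_sum f _
  rw [h]
  exact Lp.coeFn_fun_finsetSum _ _

theorem sum_coord_sq (ξ : Space d) : ∑ j, (ξ j : ℂ) * ξ j = (‖ξ‖ : ℂ) ^ 2 := by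
  rw [← ofReal_pow, EuclideanSpace.norm_sq_eq]
  push_cast
  refine Finset.sum_congr rfl fun j _ => ?_
  rw [← pow_two, ← ofReal_pow, ← ofReal_pow, Real.norm_eq_abs, sq_abs]

theorem integral_mul_fourier_grad {u : 𝓢'(Space d, ℂ)} {j : Fin d} {g : L2 d}
    (hg : (g : 𝓢'(Space d, ℂ)) = ∂_{basisVec j} u) (ψ : 𝓢(Space d, ℂ)) :
    ∫ ξ, ψ ξ * (𝓕 g : L2 d) ξ = 2 * Real.pi * I * (𝓕 u) (coordMul j ψ) := by
  rw [← L2.apply_fourier, hg, lineDeriv_apply_fourier]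

/-- Mixed derivatives commute: tested against `ψ`, both sides are the pairing of `𝓕 u` with `ξ_j ξ_k
ψ`. -/
theorem coord_mul_fourier_grad_comm {u : 𝓢'(Space d, ℂ)} {g : Fin d → L2 d}
    (hg : ∀ j, (g j : 𝓢'(Space d, ℂ)) = ∂_{basisVec j} u) (j k : Fin d) :
    ∀ᵐ ξ : Space d, (ξ k : ℂ) * (𝓕 (g j) : L2 d) ξ = ξ j * (𝓕 (g k) : L2 d) ξ := by
  have h := ae_eq_zero_of_forall_schwartz
    ((locallyIntegrable_mul_L2 (m := fun ξ : Space d => (ξ k : ℂ)) (by fun_prop) (𝓕 (g j) : L2 d)).sub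
      (locallyIntegrable_mul_L2 (m := fun ξ : Space d => (ξ j : ℂ)) (by fun_prop) (𝓕 (g k) : L2 d)))
    fun ψ _ => by
      have e : ∀ ξ, ψ ξ * ((ξ k : ℂ) * (𝓕 (g j) : L2 d) ξ - ξ j * (𝓕 (g k) : L2 d) ξ) =
          coordMul k ψ ξ * (𝓕 (g j) : L2 d) ξ - coordMul j ψ ξ * (𝓕 (g k) : L2 d) ξ := fun ξ => by
        rw [coordMul_apply, coordMul_apply]; ring
      have e2 : coordMul j (coordMul k ψ) = coordMul k (coordMul j ψ) := by
        ext ξ; simp only [coordMul_apply]; ring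
      simp only [Pi.sub_apply, e]
      rw [integral_sub (integrable_schwartz_mul_L2 _ _) (integrable_schwartz_mul_L2 _ _),
        integral_mul_fourier_grad (hg j), integral_mul_fourier_grad (hg k), e2, sub_self]
  filter_upwards [h] with ξ hξ
  exact sub_eq_zero.1 hξ

/-- An `L²` gradient consists of the Riesz transforms of one `L²` function. -/
theorem exists_eq_riesz (hd : 1 ≤ d) {u : 𝓢'(Space d, ℂ)} {g : Fin d → L2 d}
    (hg : ∀ j, (g j : 𝓢'(Space d, ℂ)) = ∂_{basisVec j} u) : ∃ h : L2 d, ∀ j, g j = riesz j h := by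
  -- The sum of the squares of the Riesz symbols is `-1`. Hence `g_j = R_j h` for all `j` forces `h
  -- = -∑ R_j g_j`, and the curl-free condition makes this choice work.
  refine ⟨(-1 : ℂ) • ∑ j, riesz j (g j), fun k => fourier_ext ?_⟩
  filter_upwards [fourier_riesz k ((-1 : ℂ) • ∑ j, riesz j (g j)),
    fourier_smul_ae (-1) (∑ j, riesz j (g j)), fourier_sum_ae fun j => riesz j (g j),
    ae_all_iff.2 fun j => fourier_riesz j (g j),
    ae_all_iff.2 fun j => coord_mul_fourier_grad_comm hg j k, Space.ae_ne_zero hd]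
    with ξ h1 h2 h3 h4 h5 h0
  have hn : (‖ξ‖ : ℂ) ≠ 0 := by exact_mod_cast norm_ne_zero_iff.2 h0
  rw [h1, h2, h3]
  simp_rw [h4]
  have e : ∀ j, I * ((ξ j / ‖ξ‖ : ℝ) : ℂ) * (𝓕 (g j) : L2 d) ξ * (ξ k : ℂ) =
      I / ‖ξ‖ * (𝓕 (g k) : L2 d) ξ * ((ξ j : ℂ) * ξ j) := fun j => by
    rw [mul_assoc, mul_comm ((𝓕 (g j) : L2 d) ξ), h5 j]; push_cast; ring
  have e2 : (∑ j, I * ((ξ j / ‖ξ‖ : ℝ) : ℂ) * (𝓕 (g j) : L2 d) ξ) * (ξ k : ℂ) =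
      I / ‖ξ‖ * (𝓕 (g k) : L2 d) ξ * (‖ξ‖ : ℂ) ^ 2 := by
    rw [Finset.sum_mul, Finset.sum_congr rfl fun j _ => e j, ← Finset.mul_sum, sum_coord_sq]
  calc (𝓕 (g k) : L2 d) ξ = -(I / ‖ξ‖ * (I / ‖ξ‖ * (𝓕 (g k) : L2 d) ξ * (‖ξ‖ : ℂ) ^ 2)) := by
        field_simp; rw [I_sq]; ring
    _ = _ := by
        rw [← e2]; push_cast; ring

end Riesz

/-! ### The explicit solution of the first-order system -/

section Wave
variable {d : ℕ}

/-- The weak form of the first-order system `∂_t v = ∑ ∂_j W_j`, `∂_t W_j = ∂_j v`. -/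
structure IsWeakWave (v : ℝ → L2 d) (W : Fin d → ℝ → L2 d) : Prop where
  continuous_vel : Continuous v
  continuous_grad : ∀ j, Continuous (W j)
  hasDerivAt_grad : ∀ (j : Fin d) (φ : 𝓢(Space d, ℂ)) (t : ℝ),
    HasDerivAt (fun s => (W j s : 𝓢'(Space d, ℂ)) φ) ((∂_{basisVec j} (v t : 𝓢'(Space d, ℂ))) φ) t
  hasDerivAt_vel : ∀ (φ : 𝓢(Space d, ℂ)) (t : ℝ),
    HasDerivAt (fun s => (v s : 𝓢'(Space d, ℂ)) φ)
      (∑ j, (∂_{basisVec j} (W j t : 𝓢'(Space d, ℂ))) φ) t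

/-- The velocity of the wave with data `(u₀, u₁)`, `∇u₀ = (riesz j h)_j`. -/
def waveVel (h u₁ : L2 d) : ℝ → L2 d :=
  twoWave ((1 / 2 : ℂ) • (u₁ + I • h)) ((1 / 2 : ℂ) • (u₁ + (-I) • h))

/-- The gradient of the wave with data `(u₀, u₁)`, `∇u₀ = (riesz j h)_j`. -/
def waveGrad (h u₁ : L2 d) (j : Fin d) : ℝ → L2 d :=
  twoWave ((1 / 2 : ℂ) • (riesz j h + (-I) • riesz j u₁)) ((1 / 2 : ℂ) • (riesz j h + I • riesz j u₁))

theorem halfWave_at_zero (f : L2 d) : halfWave 0 f = f := by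
  refine fourier_ext ?_
  filter_upwards [fourier_halfWave 0 f] with ξ h
  rw [h]; simp

theorem waveVel_zero (h u₁ : L2 d) : waveVel h u₁ 0 = u₁ := by
  rw [waveVel, twoWave, neg_zero, halfWave_at_zero, halfWave_at_zero]
  module

theorem waveGrad_zero (h u₁ : L2 d) (j : Fin d) : waveGrad h u₁ j 0 = riesz j h := by
  rw [waveGrad, twoWave, neg_zero, halfWave_at_zero, halfWave_at_zero]
  module

theorem fourier_halfWave_comb (t : ℝ) (c k : ℂ) (a b : L2 d) :
    (𝓕 (halfWave t (c • (a + k • b))) : L2 d) =ᵐ[volume]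
      fun ξ => cexp (I * (t * ‖(2 * Real.pi) • ξ‖ : ℝ)) *
        (c * ((𝓕 a : L2 d) ξ + k * (𝓕 b : L2 d) ξ)) := by
  filter_upwards [fourier_halfWave t (c • (a + k • b)), fourier_smul_ae c (a + k • b),
    fourier_add_ae a (k • b), fourier_smul_ae k b] with ξ h1 h2 h3 h4
  rw [h1, h2, h3, h4]

/-- With `h = |D| u₀`, these are `v = cos(t|D|) u₁ - sin(t|D|) h` and `W_j = R_j (cos(t|D|) h +
sin(t|D|) u₁)`. In frequency the system reduces to `|ξ| · iξ_j/|ξ| = iξ_j` and `∑ ξ_j² = |ξ|²`. -/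
theorem isWeakWave_waveVel (hd : 1 ≤ d) (h u₁ : L2 d) :
    IsWeakWave (waveVel h u₁) (waveGrad h u₁) := by
  have hc : ∀ (j : Fin d) (ξ : Space d), ξ ≠ 0 →
      (‖ξ‖ : ℂ) * (I * ((ξ j / ‖ξ‖ : ℝ) : ℂ)) = I * ξ j := fun j ξ h0 => by
    have hn : (‖ξ‖ : ℂ) ≠ 0 := by exact_mod_cast norm_ne_zero_iff.2 h0
    push_cast; field_simp
  have hI : I * I = -1 := I_mul_I
  refine ⟨continuous_twoWave _ _, fun j => continuous_twoWave _ _, fun j φ t => ?_, fun φ t => ?_⟩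
  · obtain ⟨ψ, rfl⟩ := exists_fourier_eq_schwartz φ
    refine (hasDerivAt_twoWave_apply _ _ ψ t).congr_deriv ?_
    rw [L2.lineDeriv_apply_fourier]
    refine integral_congr_ae ?_
    rw [waveVel, twoWave]
    filter_upwards [fourier_halfWave_comb t (1 / 2) (-I) (riesz j h) (riesz j u₁),
      fourier_halfWave_comb (-t) (1 / 2) I (riesz j h) (riesz j u₁),
      fourier_halfWave_comb t (1 / 2) I u₁ h, fourier_halfWave_comb (-t) (1 / 2) (-I) u₁ h,
      fourier_add_ae (halfWave t ((1 / 2 : ℂ) • (u₁ + I • h)))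
        (halfWave (-t) ((1 / 2 : ℂ) • (u₁ + (-I) • h))),
      fourier_riesz j h, fourier_riesz j u₁, Space.ae_ne_zero hd] with ξ h1 h2 h3 h4 h5 h6 h7 h0
    rw [h1, h2, h5, h3, h4, h6, h7]
    have := hc j ξ h0
    generalize I * ((ξ j / ‖ξ‖ : ℝ) : ℂ) = q at this ⊢
    generalize cexp (I * ((t * ‖(2 * Real.pi) • ξ‖ : ℝ) : ℂ)) = E
    generalize cexp (I * ((-t * ‖(2 * Real.pi) • ξ‖ : ℝ) : ℂ)) = E'
    generalize (𝓕 u₁ : L2 d) ξ = A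
    generalize (𝓕 h : L2 d) ξ = B
    linear_combination (ψ ξ * (2 * Real.pi * I) * (E * (1 / 2 * (B - I * A)) - E' * (1 / 2 * (B + I * A)))) * this
      - ψ ξ * (2 * Real.pi * I) * ξ j * (1 / 2 * A) * (E + E') * hI
  · obtain ⟨ψ, rfl⟩ := exists_fourier_eq_schwartz φ
    refine (hasDerivAt_twoWave_apply _ _ ψ t).congr_deriv ?_
    simp_rw [L2.lineDeriv_apply_fourier]
    rw [← integral_finsetSum _ fun j _ => by
      refine ((integrable_schwartz_mul_L2 (coordMul j ψ) (𝓕 (waveGrad h u₁ j t) : L2 d)).const_mul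
        (2 * Real.pi * I)).congr (Eventually.of_forall fun ξ => ?_)
      simp only [coordMul_apply]; ring]
    refine integral_congr_ae ?_
    simp_rw [waveGrad, twoWave]
    filter_upwards [ae_all_iff.2 fun j => fourier_halfWave_comb t (1 / 2) (-I) (riesz j h) (riesz j u₁),
      ae_all_iff.2 fun j => fourier_halfWave_comb (-t) (1 / 2) I (riesz j h) (riesz j u₁),
      fourier_halfWave_comb t (1 / 2) I u₁ h, fourier_halfWave_comb (-t) (1 / 2) (-I) u₁ h,
      ae_all_iff.2 fun j => fourier_add_ae
        (halfWave t ((1 / 2 : ℂ) • (riesz j h + (-I) • riesz j u₁)))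
        (halfWave (-t) ((1 / 2 : ℂ) • (riesz j h + I • riesz j u₁))),
      ae_all_iff.2 fun j => fourier_riesz j h, ae_all_iff.2 fun j => fourier_riesz j u₁,
      Space.ae_ne_zero hd] with ξ h1 h2 h3 h4 h5 h6 h7 h0
    have hn : (‖ξ‖ : ℂ) ≠ 0 := by exact_mod_cast norm_ne_zero_iff.2 h0
    rw [h3, h4]
    simp_rw [h5, h1, h2, h6, h7]
    generalize cexp (I * ((t * ‖(2 * Real.pi) • ξ‖ : ℝ) : ℂ)) = E
    generalize cexp (I * ((-t * ‖(2 * Real.pi) • ξ‖ : ℝ) : ℂ)) = E'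
    generalize (𝓕 u₁ : L2 d) ξ = A
    generalize (𝓕 h : L2 d) ξ = B
    have e : ∀ j, ψ ξ * (2 * Real.pi * I * ξ j *
        (E * (1 / 2 * (I * ((ξ j / ‖ξ‖ : ℝ) : ℂ) * B + -I * (I * ((ξ j / ‖ξ‖ : ℝ) : ℂ) * A))) +
          E' * (1 / 2 * (I * ((ξ j / ‖ξ‖ : ℝ) : ℂ) * B + I * (I * ((ξ j / ‖ξ‖ : ℝ) : ℂ) * A))))) =
        (ψ ξ * (2 * Real.pi * I) * I / ‖ξ‖ * (1 / 2) * (E * (B - I * A) + E' * (B + I * A))) *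
          ((ξ j : ℂ) * ξ j) := fun j => by push_cast; ring
    rw [Finset.sum_congr rfl fun j _ => e j, ← Finset.mul_sum, sum_coord_sq]
    field_simp
    linear_combination ψ ξ * (A * E - A * E') * hI

end Wave

/-! ### Existence and uniqueness in the energy class -/

section WaveSolution
variable {d : ℕ}

/-- Testing an `L²` function against a Schwartz function. -/
def testAgainst (φ : 𝓢(Space d, ℂ)) : L2 d →L[ℂ] ℂ :=
  (PointwiseConvergenceCLM.evalCLM (RingHom.id ℂ) ℂ φ).comp
    (Lp.toTemperedDistributionCLM ℂ (volume : Measure (Space d)) 2)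

theorem lineDeriv_coe_apply (f : L2 d) (j : Fin d) (φ : 𝓢(Space d, ℂ)) :
    (∂_{basisVec j} (f : 𝓢'(Space d, ℂ))) φ = testAgainst (-∂_{basisVec j} φ) f :=
  TemperedDistribution.lineDerivOp_apply_apply _ _ _

theorem eq_of_hasDerivAt_eq {E : Type*} [NormedAddCommGroup E] [NormedSpace ℝ E] {f g f' : ℝ → E}
    (hf : ∀ t, HasDerivAt f (f' t) t) (hg : ∀ t, HasDerivAt g (f' t) t) (h0 : f 0 = g 0) (t : ℝ) :
    f t = g t := by
  have hd : ∀ t, HasDerivAt (f - g) 0 t := fun t => by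
    simpa using (hf t).sub (hg t)
  have h := is_const_of_deriv_eq_zero (fun t => (hd t).differentiableAt) (fun t => (hd t).deriv) t 0
  simp only [Pi.sub_apply, h0, sub_self] at h
  exact sub_eq_zero.1 h

theorem hasDerivAt_integral_of_continuous {v : ℝ → L2 d} (hv : Continuous v) (t : ℝ) :
    HasDerivAt (fun t => ∫ s in (0 : ℝ)..t, v s) (v t) t :=
  intervalIntegral.integral_hasDerivAt_right (hv.intervalIntegrable _ _)
    hv.aestronglyMeasurable.stronglyMeasurableAtFilter hv.continuousAt

theorem hasDerivAt_testAgainst {w : ℝ → L2 d} {w' : L2 d} {t : ℝ} (h : HasDerivAt w w' t)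
    (φ : 𝓢(Space d, ℂ)) : HasDerivAt (fun s => (w s : 𝓢'(Space d, ℂ)) φ)
      ((w' : 𝓢'(Space d, ℂ)) φ) t :=
  ((testAgainst φ).restrictScalars ℝ).hasFDerivAt.comp_hasDerivAt t h

theorem laplacian_apply_eq_sum (u : 𝓢'(Space d, ℂ)) (φ : 𝓢(Space d, ℂ)) :
    (Δ u) φ = ∑ j : Fin d, (∂_{basisVec j} (∂_{basisVec j} u : 𝓢'(Space d, ℂ)) : 𝓢'(Space d, ℂ)) φ := by
  rw [TemperedDistribution.laplacian_eq_sum (EuclideanSpace.basisFun (Fin d) ℝ)]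
  simp only [EuclideanSpace.basisFun_apply]
  exact map_sum (PointwiseConvergenceCLM.evalCLM (RingHom.id ℂ) ℂ φ) _ _

theorem IsWaveSolution.isWeakWave {u₀ : 𝓢'(Space d, ℂ)} {u₁ : L2 d} {u : ℝ → 𝓢'(Space d, ℂ)}
    {v : ℝ → L2 d} {W : Fin d → ℝ → L2 d} (h : IsWaveSolution u₀ u₁ u v W) : IsWeakWave v W := by
  refine ⟨h.continuous_timeDeriv, h.continuous_grad, fun j φ t => ?_, fun φ t => ?_⟩
  · simp_rw [h.grad, TemperedDistribution.lineDerivOp_apply_apply]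
    exact h.timeDeriv _ t
  · refine (h.wave φ t).congr_deriv ?_
    rw [laplacian_apply_eq_sum]
    simp_rw [h.grad]

/-- After testing, both sides have the same time derivative and the same initial value. This
recovers a potential, `u₀` plus the time primitive of the velocity, from the first-order system. -/
theorem IsWeakWave.grad_eq {u₀ : 𝓢'(Space d, ℂ)} {v : ℝ → L2 d} {W : Fin d → ℝ → L2 d}
    (h : IsWeakWave v W) (h0 : ∀ j, (W j 0 : 𝓢'(Space d, ℂ)) = ∂_{basisVec j} u₀) (j : Fin d) (t : ℝ) :
    (W j t : 𝓢'(Space d, ℂ)) =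
      ∂_{basisVec j} (u₀ + ((∫ s in (0 : ℝ)..t, v s : L2 d) : 𝓢'(Space d, ℂ))) := by
  ext φ
  rw [TemperedDistribution.lineDerivOp_apply_apply]
  refine eq_of_hasDerivAt_eq (f := fun t => (W j t : 𝓢'(Space d, ℂ)) φ)
    (g := fun t => (u₀ + ((∫ s in (0 : ℝ)..t, v s : L2 d) : 𝓢'(Space d, ℂ))) (-∂_{basisVec j} φ))
    (f' := fun t => (∂_{basisVec j} (v t : 𝓢'(Space d, ℂ))) φ)
    (fun t => h.hasDerivAt_grad j φ t) (fun t => ?_) ?_ t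
  · rw [TemperedDistribution.lineDerivOp_apply_apply]
    exact (hasDerivAt_testAgainst (hasDerivAt_integral_of_continuous h.continuous_vel t) _).const_add _
  · simp only [h0, intervalIntegral.integral_same]
    rw [TemperedDistribution.lineDerivOp_apply_apply]
    have : ((0 : L2 d) : 𝓢'(Space d, ℂ)) = 0 :=
      map_zero (Lp.toTemperedDistributionCLM ℂ (volume : Measure (Space d)) 2)
    rw [this, add_zero]

theorem IsWeakWave.isWaveSolution {u₀ : 𝓢'(Space d, ℂ)} {v : ℝ → L2 d} {W : Fin d → ℝ → L2 d}
    (h : IsWeakWave v W) (h0 : ∀ j, (W j 0 : 𝓢'(Space d, ℂ)) = ∂_{basisVec j} u₀) :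
    IsWaveSolution u₀ (v 0)
      (fun t => u₀ + ((∫ s in (0 : ℝ)..t, v s : L2 d) : 𝓢'(Space d, ℂ))) v W where
  init := by
    have : ((0 : L2 d) : 𝓢'(Space d, ℂ)) = 0 :=
      map_zero (Lp.toTemperedDistributionCLM ℂ (volume : Measure (Space d)) 2)
    simp only [intervalIntegral.integral_same]
    rw [this, add_zero]
  init_deriv := rfl
  continuous_timeDeriv := h.continuous_vel
  continuous_grad := h.continuous_grad
  grad := fun t j => h.grad_eq h0 j t
  timeDeriv := fun φ t =>
    (hasDerivAt_testAgainst (hasDerivAt_integral_of_continuous h.continuous_vel t) φ).const_add _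
  wave := fun φ t => by
    refine (h.hasDerivAt_vel φ t).congr_deriv ?_
    rw [laplacian_apply_eq_sum]
    simp_rw [h.grad_eq h0]

/-- An identity between an `L²` function and a sum of distributional derivatives becomes pointwise
in frequency, as both sides are locally integrable there. -/
theorem fourier_ae_of_eq_sum_lineDeriv {ι : Type*} [Fintype ι] {a : L2 d} {b : ι → L2 d} {k : ι → Fin d}
    (h : ∀ φ : 𝓢(Space d, ℂ), (a : 𝓢'(Space d, ℂ)) φ =
      ∑ i, (∂_{basisVec (k i)} (b i : 𝓢'(Space d, ℂ))) φ) :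
    (𝓕 a : L2 d) =ᵐ[volume] fun ξ => ∑ i, 2 * Real.pi * I * (ξ (k i) : ℂ) * (𝓕 (b i) : L2 d) ξ := by
  have hloc : LocallyIntegrable (fun ξ : Space d =>
      ∑ i, 2 * Real.pi * I * (ξ (k i) : ℂ) * (𝓕 (b i) : L2 d) ξ) volume := by
    exact locallyIntegrable_finsetSum _ fun i _ => locallyIntegrable_mul_L2 (by fun_prop) _
  have key := ae_eq_zero_of_forall_schwartz ((locallyIntegrable_L2 (𝓕 a : L2 d)).sub hloc) fun ψ _ => by
    have hi : ∀ i, Integrable (fun ξ => ψ ξ * (2 * Real.pi * I * (ξ (k i) : ℂ) * (𝓕 (b i) : L2 d) ξ))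
        volume := fun i => by
      refine ((integrable_schwartz_mul_L2 (coordMul (k i) ψ) (𝓕 (b i) : L2 d)).const_mul
        (2 * Real.pi * I)).congr (Eventually.of_forall fun ξ => ?_)
      simp only [coordMul_apply]; ring
    simp only [Pi.sub_apply, mul_sub, Finset.mul_sum]
    rw [integral_sub (integrable_schwartz_mul_L2 _ _) (integrable_finsetSum _ fun i _ => hi i),
      integral_finsetSum _ fun i _ => hi i, ← L2.apply_fourier, h]
    simp_rw [L2.lineDeriv_apply_fourier]
    exact sub_self _
  filter_upwards [key] with ξ hξ
  exact sub_eq_zero.1 hξ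

theorem IsWeakWave.sub {v v' : ℝ → L2 d} {W W' : Fin d → ℝ → L2 d} (h : IsWeakWave v W)
    (h' : IsWeakWave v' W') : IsWeakWave (v - v') (W - W') := by
  have hsub : ∀ (f g : L2 d) (φ : 𝓢(Space d, ℂ)), ((f - g : L2 d) : 𝓢'(Space d, ℂ)) φ =
      (f : 𝓢'(Space d, ℂ)) φ - (g : 𝓢'(Space d, ℂ)) φ := fun f g φ => map_sub (testAgainst φ) f g
  refine ⟨h.continuous_vel.sub h'.continuous_vel,
    fun j => (h.continuous_grad j).sub (h'.continuous_grad j), fun j φ t => ?_, fun φ t => ?_⟩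
  · simp only [Pi.sub_apply, hsub, lineDeriv_coe_apply, map_sub]
    simp only [← lineDeriv_coe_apply]
    exact (h.hasDerivAt_grad j φ t).sub (h'.hasDerivAt_grad j φ t)
  · simp only [Pi.sub_apply, hsub, lineDeriv_coe_apply, map_sub, Finset.sum_sub_distrib]
    simp only [← lineDeriv_coe_apply]
    exact (h.hasDerivAt_vel φ t).sub (h'.hasDerivAt_vel φ t)

theorem inner_L2_eq (f g : L2 d) :
    inner ℂ f g = ∫ ξ, (𝓕 g : L2 d) ξ * (starRingEnd ℂ) ((𝓕 f : L2 d) ξ) := by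
  rw [← Lp.inner_fourier_eq, MeasureTheory.L2.inner_def]
  rfl

theorem integrable_mul_conj (f g : L2 d) :
    Integrable (fun ξ => (𝓕 g : L2 d) ξ * (starRingEnd ℂ) ((𝓕 f : L2 d) ξ)) volume :=
  MeasureTheory.L2.integrable_inner (𝕜 := ℂ) (𝓕 f : L2 d) (𝓕 g : L2 d)

theorem integrable_mul_conj_add (f g f' g' : L2 d) :
    Integrable (fun ξ => (𝓕 g : L2 d) ξ * (starRingEnd ℂ) ((𝓕 f : L2 d) ξ) +
      (𝓕 g' : L2 d) ξ * (starRingEnd ℂ) ((𝓕 f' : L2 d) ξ)) volume :=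
  (integrable_mul_conj f g).add (integrable_mul_conj f' g')

/-- The usual energy `‖v‖² + ∑ ‖W_j‖²` need not be differentiable for solutions that are only
continuous in `L²`. The primitives `w` and `Z_j` are differentiable in `L²` and satisfy the
time-integrated system, so their energy can be differentiated. -/
theorem IsWeakWave.eq_zero {v : ℝ → L2 d} {W : Fin d → ℝ → L2 d} (h : IsWeakWave v W)
    (hv0 : v 0 = 0) (hW0 : ∀ j, W j 0 = 0) (t : ℝ) : v t = 0 ∧ ∀ j, W j t = 0 := by
  set w : ℝ → L2 d := fun t => ∫ s in (0 : ℝ)..t, v s with hw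
  set Z : Fin d → ℝ → L2 d := fun j t => ∫ s in (0 : ℝ)..t, W j s with hZ
  have hcoe0 : ((0 : L2 d) : 𝓢'(Space d, ℂ)) = 0 :=
    map_zero (Lp.toTemperedDistributionCLM ℂ (volume : Measure (Space d)) 2)
  have hwd : ∀ t, HasDerivAt w (v t) t := hasDerivAt_integral_of_continuous h.continuous_vel
  have hZd : ∀ j t, HasDerivAt (Z j) (W j t) t := fun j =>
    hasDerivAt_integral_of_continuous (h.continuous_grad j)
  have hw0 : w 0 = 0 := intervalIntegral.integral_same
  have hZ0 : ∀ j, Z j 0 = 0 := fun j => intervalIntegral.integral_same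
  have h1 : ∀ j t, (𝓕 (W j t) : L2 d) =ᵐ[volume]
      fun ξ => 2 * Real.pi * I * (ξ j : ℂ) * (𝓕 (w t) : L2 d) ξ := fun j t => by
    have e := h.grad_eq (u₀ := 0) (fun j => by
      ext φ; rw [hW0, hcoe0, TemperedDistribution.lineDerivOp_apply_apply]; rfl) j t
    have := fourier_ae_of_eq_sum_lineDeriv (ι := Unit) (a := W j t) (b := fun _ => w t) (k := fun _ => j)
      fun φ => by rw [e, zero_add]; simp [hw]
    simpa using this
  have h2 : ∀ t, (𝓕 (v t) : L2 d) =ᵐ[volume]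
      fun ξ => ∑ j, 2 * Real.pi * I * (ξ j : ℂ) * (𝓕 (Z j t) : L2 d) ξ := fun t => by
    refine fourier_ae_of_eq_sum_lineDeriv (k := fun j => j) fun φ => ?_
    refine eq_of_hasDerivAt_eq (f := fun t => (v t : 𝓢'(Space d, ℂ)) φ)
      (g := fun t => ∑ j, (∂_{basisVec j} (Z j t : 𝓢'(Space d, ℂ))) φ)
      (h.hasDerivAt_vel φ) (fun t => ?_) ?_ t
    · simp only [lineDeriv_coe_apply]
      exact HasDerivAt.fun_sum fun j _ => hasDerivAt_testAgainst (hZd j t) _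
    · simp only [lineDeriv_coe_apply, hZ0, map_zero, Finset.sum_const_zero, hv0]
      rw [hcoe0]; rfl
  -- Multiplication by the imaginary symbol `2πi ξ_j` is antisymmetric, so the terms pairing `w`
  -- with `Z_j` cancel at each frequency and the energy keeps its initial value zero.
  have hE : ∀ t, inner ℂ (w t) (w t) + ∑ j, inner ℂ (Z j t) (Z j t) = 0 := by
    refine eq_of_hasDerivAt_eq (f' := fun _ => 0) (fun t => ?_) (fun t => hasDerivAt_const t 0) ?_
    · refine (((hwd t).inner ℂ (hwd t)).add
        (HasDerivAt.fun_sum fun j _ => (hZd j t).inner ℂ (hZd j t))).congr_deriv ?_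
      simp only [inner_L2_eq]
      simp_rw [← integral_add (integrable_mul_conj _ _) (integrable_mul_conj _ _)]
      rw [← integral_finsetSum _ fun j _ => integrable_mul_conj_add _ _ _ _,
        ← integral_add (integrable_mul_conj_add _ _ _ _)
          (integrable_finsetSum _ fun j _ => integrable_mul_conj_add _ _ _ _)]
      refine integral_eq_zero_of_ae ?_
      filter_upwards [h2 t, ae_all_iff.2 fun j => h1 j t] with ξ e1 e2
      simp only [e1, e2, map_sum, map_mul, conj_I, conj_ofReal, Finset.sum_mul, Finset.mul_sum,
        ← Finset.sum_add_distrib, Pi.zero_apply]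
      refine Finset.sum_eq_zero fun j _ => ?_
      simp only [map_ofNat]
      ring
    · simp [hw0, hZ0]
  have hre : ∀ t, ‖w t‖ ^ 2 + ∑ j, ‖Z j t‖ ^ 2 = 0 := fun t => by
    have := hE t
    simp only [inner_self_eq_norm_sq_to_K] at this
    refine (RCLike.ofReal_eq_zero (K := ℂ)).1 ?_
    push_cast
    exact this
  have hwz : ∀ t, w t = 0 := fun t => by
    have h3 := hre t
    have h4 : 0 ≤ ∑ j, ‖Z j t‖ ^ 2 := Finset.sum_nonneg fun j _ => by positivity
    have h5 : ‖w t‖ ^ 2 = 0 := le_antisymm (by linarith) (by positivity)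
    simpa using h5
  have hZz : ∀ j t, Z j t = 0 := fun j t => by
    have h3 := hre t
    rw [hwz t, norm_zero, zero_pow two_ne_zero, zero_add,
      Finset.sum_eq_zero_iff_of_nonneg fun j _ => by positivity] at h3
    simpa using h3 j (Finset.mem_univ j)
  constructor
  · have h3 := hwd t
    rw [show w = fun _ => 0 from funext hwz] at h3
    exact h3.unique (hasDerivAt_const t 0)
  · intro j
    have h3 := hZd j t
    rw [show Z j = fun _ => 0 from funext (hZz j)] at h3
    exact h3.unique (hasDerivAt_const t 0)

theorem IsWeakWave.unique {v v' : ℝ → L2 d} {W W' : Fin d → ℝ → L2 d} (h : IsWeakWave v W)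
    (h' : IsWeakWave v' W') (hv : v 0 = v' 0) (hW : ∀ j, W j 0 = W' j 0) : v = v' ∧ W = W' := by
  have key := (h.sub h').eq_zero (by simp [hv]) (by simp [hW])
  exact ⟨funext fun t => sub_eq_zero.1 (key t).1,
    funext fun j => funext fun t => sub_eq_zero.1 ((key t).2 j)⟩

/-- The energy class solution is the explicit superposition of half-waves. -/
theorem IsWaveSolution.eq_waveVel (hd : 1 ≤ d) {u₀ : 𝓢'(Space d, ℂ)} {u₁ h : L2 d}
    {u : ℝ → 𝓢'(Space d, ℂ)} {v : ℝ → L2 d} {W : Fin d → ℝ → L2 d} (hs : IsWaveSolution u₀ u₁ u v W)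
    (hh : ∀ j, (riesz j h : 𝓢'(Space d, ℂ)) = ∂_{basisVec j} u₀) :
    v = waveVel h u₁ ∧ W = waveGrad h u₁ := by
  refine hs.isWeakWave.unique (isWeakWave_waveVel hd h u₁) ?_ fun j => ?_
  · rw [hs.init_deriv, waveVel_zero]
  · rw [waveGrad_zero]
    refine L2.coe_injective ?_
    simp only
    rw [hs.grad 0 j, hs.init, hh]

end WaveSolution

/-! ### The Fourier transform of a homogeneous Sobolev distribution -/

section AwayFromZero
variable {d : ℕ}

theorem locallyIntegrableOn_comp_smul {F : Space d → ℂ} (hF : LocallyIntegrableOn F {0}ᶜ volume)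
    {c : ℝ} (hc : c ≠ 0) : LocallyIntegrableOn (fun ξ => F (c • ξ)) {0}ᶜ volume := by
  have hlc : IsLocallyClosed ({0}ᶜ : Set (Space d)) := isOpen_compl_singleton.isLocallyClosed
  rw [locallyIntegrableOn_iff hlc] at hF ⊢
  intro K hK hKc
  have hKc' : IsCompact ((fun ξ : Space d => c • ξ) '' K) := hKc.image (continuous_const_smul c)
  have h1 := hF ((fun ξ : Space d => c • ξ) '' K) (by
    rintro _ ⟨ξ, hξ, rfl⟩
    have : ξ ≠ 0 := hK hξ
    simp [hc, this]) hKc'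
  rw [← integrable_indicator_iff hKc'.measurableSet,
    ← integrable_comp_smul_iff volume _ hc] at h1
  rw [← integrable_indicator_iff hKc.measurableSet]
  refine h1.congr (Eventually.of_forall fun ξ => ?_)
  by_cases h : ξ ∈ K
  · simp only
    rw [Set.indicator_of_mem h, Set.indicator_of_mem (Set.mem_image_of_mem _ h)]
  · simp only
    rw [Set.indicator_of_notMem h, Set.indicator_of_notMem]
    rintro ⟨η, hη, e⟩
    exact h ((smul_right_injective _ hc e) ▸ hη)

theorem integrable_mul_of_zero_notMem_tsupport {k ψ : Space d → ℂ}
    (hk : LocallyIntegrableOn k {0}ᶜ volume) (hψ : Continuous ψ) (hs : HasCompactSupport ψ)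
    (h0 : (0 : Space d) ∉ tsupport ψ) : Integrable (fun ξ => ψ ξ * k ξ) volume := by
  have hlc : IsLocallyClosed ({0}ᶜ : Set (Space d)) := isOpen_compl_singleton.isLocallyClosed
  have h1 : IntegrableOn k (tsupport ψ) volume :=
    (locallyIntegrableOn_iff hlc).1 hk _ (fun ξ hξ e => h0 (e ▸ hξ)) hs
  refine (integrableOn_iff_integrable_of_support_subset ?_).1 (h1.continuousOn_mul hψ.continuousOn hs)
  intro ξ hξ
  exact subset_tsupport ψ (left_ne_zero_of_mul hξ)

theorem tsupport_coordMul_subset (j : Fin d) (ψ : 𝓢(Space d, ℂ)) :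
    tsupport (coordMul j ψ) ⊆ tsupport ψ :=
  closure_mono fun ξ hξ => by
    rw [Function.mem_support, coordMul_apply] at hξ
    exact right_ne_zero_of_mul hξ

theorem hasCompactSupport_coordMul (j : Fin d) {ψ : 𝓢(Space d, ℂ)} (h : HasCompactSupport ψ) :
    HasCompactSupport (coordMul j ψ) :=
  h.of_isClosed_subset (isClosed_tsupport _) (tsupport_coordMul_subset j ψ)

/-- This is `|ξ| û = ĥ` and makes `∂_s 𝒯 u₀` independent of the representative `F`. Comparing the
gradient components away from the origin gives it multiplied by `ξ_j`; multiplying by `ξ_j` again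
and summing produces `|ξ|²`, which can be cancelled. -/
theorem FourierAwayFromZero.norm_mul_ae_eq (hd : 1 ≤ d) {u : 𝓢'(Space d, ℂ)} {h : L2 d}
    (hh : ∀ j, (riesz j h : 𝓢'(Space d, ℂ)) = ∂_{basisVec j} u) {F : Space d → ℂ}
    (hF : FourierAwayFromZero u F) :
    ∀ᵐ ξ : Space d, 2 * Real.pi * ‖ξ‖ * F ((2 * Real.pi) • ξ) = (𝓕 h : L2 d) ξ := by
  have hlc : IsLocallyClosed ({0}ᶜ : Set (Space d)) := isOpen_compl_singleton.isLocallyClosed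
  have hFs := locallyIntegrableOn_comp_smul hF.1 (c := 2 * Real.pi) (by positivity)
  have h1 : ∀ j : Fin d, ∀ᵐ ξ : Space d, ξ ∈ ({0}ᶜ : Set (Space d)) →
      2 * Real.pi * I * (ξ j : ℂ) * F ((2 * Real.pi) • ξ) - (𝓕 (riesz j h) : L2 d) ξ = 0 := fun j => by
    refine isOpen_compl_singleton.ae_eq_zero_of_integral_contDiff_smul_eq_zero
      ((hFs.continuousOn_mul (g := fun ξ : Space d => 2 * Real.pi * I * (ξ j : ℂ))
        (Continuous.continuousOn (by fun_prop)) hlc).sub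
        ((locallyIntegrable_L2 _).locallyIntegrableOn _)) fun g h1 h2 h3 => ?_
    set ψ := toComplexSchwartz h1 h2 with hψ
    have hsψ : HasCompactSupport ψ := h2.comp_left (g := fun r : ℝ => (r : ℂ)) ofReal_zero
    have h0ψ : (0 : Space d) ∉ tsupport ψ := fun h0 => by
      refine h3 ((closure_mono fun ξ hξ => ?_ : tsupport ψ ⊆ tsupport g) h0) rfl
      rw [Function.mem_support, hψ, toComplexSchwartz_apply] at hξ
      simpa using hξ
    have h0c : (0 : Space d) ∉ tsupport (coordMul j ψ) := fun h0 =>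
      h0ψ (tsupport_coordMul_subset j ψ h0)
    have e1 := hF.2 (coordMul j ψ) (hasCompactSupport_coordMul j hsψ) h0c
    have e2 := integral_mul_fourier_grad (hh j) ψ
    have i1 := integrable_mul_of_zero_notMem_tsupport hFs (coordMul j ψ).continuous
      (hasCompactSupport_coordMul j hsψ) h0c
    have i2 := integrable_schwartz_mul_L2 ψ (𝓕 (riesz j h) : L2 d)
    have e3 : ∀ ξ, g ξ • (2 * Real.pi * I * (ξ j : ℂ) * F ((2 * Real.pi) • ξ) -
        (𝓕 (riesz j h) : L2 d) ξ) = 2 * Real.pi * I * (coordMul j ψ ξ * F ((2 * Real.pi) • ξ)) -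
          ψ ξ * (𝓕 (riesz j h) : L2 d) ξ := fun ξ => by
      rw [coordMul_apply, Complex.real_smul, hψ, toComplexSchwartz_apply]; ring
    simp_rw [e3]
    rw [integral_sub (i1.const_mul _) i2, e2, e1, integral_const_mul]
    simp_rw [mul_comm (F _)]
    exact sub_self _
  filter_upwards [ae_all_iff.2 h1, ae_all_iff.2 fun j => fourier_riesz j h, Space.ae_ne_zero hd]
    with ξ e1 e2 h0
  have hn : (‖ξ‖ : ℂ) ≠ 0 := by exact_mod_cast norm_ne_zero_iff.2 h0
  have e3 : ∀ j, (ξ j : ℂ) * ξ j * (2 * Real.pi * F ((2 * Real.pi) • ξ)) =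
      (ξ j : ℂ) * ξ j * ((𝓕 h : L2 d) ξ / ‖ξ‖) := fun j => by
    have := e1 j h0
    rw [e2 j] at this
    refine mul_left_cancel₀ I_ne_zero ?_
    push_cast at this
    linear_combination (ξ j : ℂ) * this
  have e4 := Finset.sum_congr (rfl : (Finset.univ : Finset (Fin d)) = _) fun j _ => e3 j
  rw [← Finset.sum_mul, ← Finset.sum_mul, sum_coord_sq] at e4
  have e5 := mul_left_cancel₀ (pow_ne_zero 2 hn) e4
  rw [mul_right_comm, e5]
  field_simp

theorem contDiff_div_norm_sq {φ : Space d → ℂ} (hφ : ContDiff ℝ ((⊤ : ℕ∞) : WithTop ℕ∞) φ)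
    (h0 : (0 : Space d) ∉ tsupport φ) :
    ContDiff ℝ ((⊤ : ℕ∞) : WithTop ℕ∞) fun ξ => (((‖ξ‖ ^ 2)⁻¹ : ℝ)) • φ ξ := by
  refine contDiff_iff_contDiffAt.2 fun ξ => ?_
  by_cases h : ξ = 0
  · have e : (fun ξ => (((‖ξ‖ ^ 2)⁻¹ : ℝ)) • φ ξ) =ᶠ[𝓝 ξ] fun _ => 0 := by
      have := notMem_tsupport_iff_eventuallyEq.1 h0
      rw [h]
      filter_upwards [this] with η hη
      rw [hη]; simp
    exact contDiffAt_const.congr_of_eventuallyEq e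
  · refine ContDiffAt.smul (ContDiffAt.inv (contDiff_norm_sq ℝ).contDiffAt ?_) hφ.contDiffAt
    exact pow_ne_zero 2 (norm_ne_zero_iff.2 h)

/-- If the gradient of `u` is `(riesz j h)_j`, then `û` is a locally integrable function away from
the origin. -/
theorem exists_fourierAwayFromZero {u : 𝓢'(Space d, ℂ)} {h : L2 d}
    (hh : ∀ j, (riesz j h : 𝓢'(Space d, ℂ)) = ∂_{basisVec j} u) :
    ∃ F : Space d → ℂ, FourierAwayFromZero u F := by
  have hlc : IsLocallyClosed ({0}ᶜ : Set (Space d)) := isOpen_compl_singleton.isLocallyClosed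
  -- The only possible choice, `ĥ/|ξ|` in the normalization of `hat`.
  refine ⟨fun ξ => ((‖ξ‖⁻¹ : ℝ) : ℂ) * (𝓕 h : L2 d) ((2 * Real.pi)⁻¹ • ξ), ?_, fun φ hs h0 => ?_⟩
  · have h1 : LocallyIntegrableOn (fun ξ => (𝓕 h : L2 d) ((2 * Real.pi)⁻¹ • ξ)) {0}ᶜ volume :=
      locallyIntegrableOn_comp_smul ((locallyIntegrable_L2 (𝓕 h : L2 d)).locallyIntegrableOn _)
        (inv_ne_zero (by positivity))
    have h2 : ContinuousOn (fun ξ : Space d => ‖ξ‖⁻¹) {0}ᶜ :=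
      ContinuousOn.inv₀ continuous_norm.continuousOn fun ξ hξ => norm_ne_zero_iff.2 hξ
    have h3 : ContinuousOn (fun ξ : Space d => ((‖ξ‖⁻¹ : ℝ) : ℂ)) {0}ᶜ :=
      Complex.continuous_ofReal.comp_continuousOn h2
    exact h1.continuousOn_mul h3 hlc
  · have hsc : HasCompactSupport fun ξ => (((‖ξ‖ ^ 2)⁻¹ : ℝ)) • φ ξ :=
      hs.mono fun ξ hξ => right_ne_zero_of_smul hξ
    -- Because `φ` vanishes near the origin it can be divided by `|ξ|²`, so that `φ = ∑ ξ_j ξ_j χ`.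
    -- One factor `ξ_j` turns `u` into its gradient, where `h` is available.
    set χ : 𝓢(Space d, ℂ) := hsc.toSchwartzMap (contDiff_div_norm_sq (φ.smooth _) h0) with hχ
    have hχa : ∀ ξ, χ ξ = (((‖ξ‖ ^ 2)⁻¹ : ℝ)) • φ ξ := fun ξ => rfl
    have hφ0 : φ 0 = 0 := image_eq_zero_of_notMem_tsupport h0
    have hsum : φ = ∑ j, coordMul j (coordMul j χ) := by
      ext ξ
      rw [sum_apply]
      simp only [coordMul_apply, ← mul_assoc]
      rw [← Finset.sum_mul, sum_coord_sq, hχa, Complex.real_smul]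
      by_cases hξ : ξ = 0
      · rw [hξ, hφ0]; simp
      · have hn : (‖ξ‖ : ℂ) ≠ 0 := by exact_mod_cast norm_ne_zero_iff.2 hξ
        push_cast
        field_simp
    have e1 : ∀ j, (𝓕 u) (coordMul j (coordMul j χ)) =
        ∫ ξ, (2 * Real.pi * I)⁻¹ * (coordMul j χ ξ * (𝓕 (riesz j h) : L2 d) ξ) := fun j => by
      rw [integral_const_mul, integral_mul_fourier_grad (hh j), inv_mul_cancel_left₀]
      exact two_pi_I_ne_zero
    conv_lhs => rw [hsum, map_sum]
    simp_rw [e1]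
    rw [← integral_finsetSum _ fun j _ => (integrable_schwartz_mul_L2 _ _).const_mul _]
    refine integral_congr_ae ?_
    filter_upwards [ae_all_iff.2 fun j => fourier_riesz j h] with ξ e2
    simp_rw [e2, coordMul_apply]
    by_cases hξ : ξ = 0
    · rw [hξ, hφ0]; simp
    have hn : (‖ξ‖ : ℂ) ≠ 0 := by exact_mod_cast norm_ne_zero_iff.2 hξ
    have hpi : (Real.pi : ℂ) ≠ 0 := by exact_mod_cast Real.pi_ne_zero
    have e3 : ∀ j, (2 * Real.pi * I)⁻¹ * ((ξ j : ℂ) * χ ξ * (I * ((ξ j / ‖ξ‖ : ℝ) : ℂ) * (𝓕 h : L2 d) ξ)) =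
        (ξ j : ℂ) * ξ j * ((2 * Real.pi)⁻¹ * (χ ξ / ‖ξ‖ * (𝓕 h : L2 d) ξ)) := fun j => by
      push_cast
      field_simp
    rw [Finset.sum_congr rfl fun j _ => e3 j, ← Finset.sum_mul, sum_coord_sq, hχa, Complex.real_smul,
      smul_smul, inv_mul_cancel₀ (by positivity), one_smul, norm_smul, Real.norm_of_nonneg (by positivity)]
    push_cast
    field_simp

end AwayFromZero

/-! ### Profiles of the velocity and the gradient -/

section WaveProfile
variable {d : ℕ}

/-- The constant `c₀` is chosen so that in the unitary normalization `𝒯` carries only the factor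
`1/√2`. -/
theorem c0_mul_rpow (d : ℕ) : c0 d * (2 * Real.pi) ^ (((d : ℝ) - 1) / 2) = (Real.sqrt 2)⁻¹ := by
  have hpi : (0 : ℝ) < (2 * Real.pi) ^ (((d : ℝ) - 1) / 2) := by positivity
  rw [c0, Real.sqrt_mul (by norm_num), Real.sqrt_eq_rpow ((2 * Real.pi) ^ ((d : ℝ) - 1)),
    ← Real.rpow_mul (by positivity), show ((d : ℝ) - 1) * (1 / 2) = ((d : ℝ) - 1) / 2 by ring]
  field_simp

theorem symbolT_two_pi_mul (F : Space d → ℂ) (l : ℝ) (ω : Sph d) :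
    symbolT F (2 * Real.pi * l) ω = ((Real.sqrt 2)⁻¹ : ℝ) *
      sym (fun ξ => cexp (I * tau d) * F ((2 * Real.pi) • ξ))
        (fun ξ => cexp (-(I * tau d)) * F ((2 * Real.pi) • ξ)) l ω := by
  rw [symbolT, sym, ← c0_mul_rpow d, abs_two_pi_mul_rpow, smul_smul]
  have hiff : 2 * Real.pi * l < 0 ↔ l < 0 := by
    constructor
    · intro h; by_contra! h'; exact absurd h (not_lt.2 (by positivity))
    · intro h; exact mul_neg_of_pos_of_neg (by positivity) h
  simp only [hiff]
  split_ifs <;> · push_cast; ring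

theorem symbolT_hat_two_pi_mul (u : L2 d) (p : ℝ × Sph d) :
    symbolT (hat u) (2 * Real.pi * p.1) p.2 = ((Real.sqrt 2)⁻¹ : ℝ) * outSym u u p.1 p.2 := by
  rw [symbolT_two_pi_mul, outSym]
  congr 3 <;>
  · ext ξ
    rw [hat, smul_smul, inv_mul_cancel₀ (by positivity), one_smul]

/-- The factor `iν` is `-i|ν|` for negative and `i|ν|` for positive frequencies, and `|ν| û = ĥ`.
Hence `∂_s 𝒯 u₀` corresponds to the pair `(-ih, ih)`. -/
theorem mul_symbolT_ae (hd : 1 ≤ d) {F : Space d → ℂ} {h : L2 d}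
    (hF : ∀ᵐ ξ : Space d, 2 * Real.pi * ‖ξ‖ * F ((2 * Real.pi) • ξ) = (𝓕 h : L2 d) ξ) :
    ∀ᵐ p : ℝ × Sph d ∂(cylMeasure d),
      I * ((2 * Real.pi * p.1 : ℝ) : ℂ) * symbolT F (2 * Real.pi * p.1) p.2 =
        ((Real.sqrt 2)⁻¹ : ℝ) * outSym ((-I) • h) (I • h) p.1 p.2 := by
  have h1 : ∀ c k : ℂ, (fun ξ => c * (𝓕 (k • h) : L2 d) ξ) =ᵐ[volume] fun ξ =>
      c * (k * (2 * Real.pi * ‖ξ‖ * F ((2 * Real.pi) • ξ))) := fun c k => by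
    filter_upwards [fourier_smul_ae k h, hF] with ξ e1 e2
    rw [e1, e2]
  filter_upwards [sym_congr_ae hd (h1 (cexp (I * tau d)) (-I)) (h1 (cexp (-(I * tau d))) I)] with p hp
  rw [symbolT_two_pi_mul, outSym, hp, sym, sym]
  have hn : ‖p.1 • (p.2 : Space d)‖ = |p.1| := by
    rw [norm_smul, norm_sphere, mul_one, Real.norm_eq_abs]
  rw [hn]
  split_ifs with h
  · rw [abs_of_neg h]; push_cast; ring
  · rw [abs_of_nonneg (not_lt.1 h)]; push_cast; ring

/-- The pair `½(u₁ + ih, u₁ - ih)` is `-½` times the difference of the pairs `(-ih, ih)` of `∂_s 𝒯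
u₀` and `(u₁, u₁)` of `𝒯 u₁`. Since each of these profiles carries `1/√2`, the remaining factor is
`-1/√2`. -/
theorem outSym_waveVel_ae (hd : 1 ≤ d) (h u₁ : L2 d) :
    ∀ᵐ p : ℝ × Sph d ∂(cylMeasure d),
      outSym ((1 / 2 : ℂ) • (u₁ + I • h)) ((1 / 2 : ℂ) • (u₁ + (-I) • h)) p.1 p.2 =
        -(1 / 2) * (outSym ((-I) • h) (I • h) p.1 p.2 - outSym u₁ u₁ p.1 p.2) := by
  filter_upwards [outSym_smul_ae hd (1 / 2) (u₁ + I • h) (u₁ + (-I) • h),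
    outSym_add_ae hd u₁ u₁ (I • h) ((-I) • h),
    outSym_smul_ae hd (-1) ((-I) • h) (I • h)] with p e1 e2 e3
  rw [smul_smul, smul_smul, show (-1 : ℂ) * -I = I by ring, show (-1 : ℂ) * I = -I by ring] at e3
  rw [e1, e2, Pi.add_apply, Pi.add_apply, e3]
  ring

/-- At the frequency `lω` the Riesz symbol is `iω_j` times the sign of `l`. The sign matches the
opposite signs of `h` and of `u₁` in the two slots, so the result is `-ω_j` times the symbol of the
velocity on both half lines. -/
theorem outSym_waveGrad_ae (hd : 1 ≤ d) (h u₁ : L2 d) (j : Fin d) :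
    ∀ᵐ p : ℝ × Sph d ∂(cylMeasure d),
      outSym ((1 / 2 : ℂ) • (riesz j h + (-I) • riesz j u₁))
          ((1 / 2 : ℂ) • (riesz j h + I • riesz j u₁)) p.1 p.2 =
        -((p.2 : Space d) j : ℂ) *
          outSym ((1 / 2 : ℂ) • (u₁ + I • h)) ((1 / 2 : ℂ) • (u₁ + (-I) • h)) p.1 p.2 := by
  have hr : ∀ c k : ℂ, (fun ξ => c * (𝓕 ((1 / 2 : ℂ) • (riesz j h + k • riesz j u₁)) : L2 d) ξ)
      =ᵐ[volume] fun ξ => c * (1 / 2 * (I * (ξ j / ‖ξ‖ : ℝ) * (𝓕 h : L2 d) ξ +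
        k * (I * (ξ j / ‖ξ‖ : ℝ) * (𝓕 u₁ : L2 d) ξ))) := fun c k => by
    filter_upwards [fourier_smul_ae (1 / 2) (riesz j h + k • riesz j u₁),
      fourier_add_ae (riesz j h) (k • riesz j u₁), fourier_smul_ae k (riesz j u₁), fourier_riesz j h,
      fourier_riesz j u₁] with ξ e1 e2 e3 e4 e5
    rw [e1, e2, e3, e4, e5]
  have hv : ∀ c k : ℂ, (fun ξ => c * (𝓕 ((1 / 2 : ℂ) • (u₁ + k • h)) : L2 d) ξ)
      =ᵐ[volume] fun ξ => c * (1 / 2 * ((𝓕 u₁ : L2 d) ξ + k * (𝓕 h : L2 d) ξ)) := fun c k => by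
    filter_upwards [fourier_smul_ae (1 / 2) (u₁ + k • h), fourier_add_ae u₁ (k • h),
      fourier_smul_ae k h] with ξ e1 e2 e3
    rw [e1, e2, e3]
  filter_upwards [sym_congr_ae hd (hr (cexp (I * tau d)) (-I)) (hr (cexp (-(I * tau d))) I),
    sym_congr_ae hd (hv (cexp (I * tau d)) I) (hv (cexp (-(I * tau d))) (-I)), ae_fst_ne_zero]
    with p e1 e2 h0
  rw [outSym, outSym, e1, e2, sym, sym]
  have hn : ‖p.1 • (p.2 : Space d)‖ = |p.1| := by
    rw [norm_smul, norm_sphere, mul_one, Real.norm_eq_abs]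
  rw [hn]
  have hI := I_mul_I
  split_ifs with h
  · have e3 : ((p.1 • (p.2 : Space d)) j / |p.1| : ℝ) = -(p.2 : Space d) j := by
      rw [abs_of_neg h, PiLp.smul_apply, smul_eq_mul]; field_simp
    rw [e3]; push_cast
    linear_combination (((|p.1| ^ (((d : ℝ) - 1) / 2) : ℝ) : ℂ) * cexp (I * tau d) * (1 / 2) *
      ((p.2 : Space d) j : ℂ) * (𝓕 u₁ : L2 d) (p.1 • (p.2 : Space d))) * hI
  · have e3 : ((p.1 • (p.2 : Space d)) j / |p.1| : ℝ) = (p.2 : Space d) j := by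
      rw [abs_of_nonneg (not_lt.1 h), PiLp.smul_apply, smul_eq_mul]; field_simp
    rw [e3]; push_cast
    linear_combination (((|p.1| ^ (((d : ℝ) - 1) / 2) : ℝ) : ℂ) * cexp (-(I * tau d)) * (1 / 2) *
      ((p.2 : Space d) j : ℂ) * (𝓕 u₁ : L2 d) (p.1 • (p.2 : Space d))) * hI

theorem sqrt_two_inv_mul_self :
    (((Real.sqrt 2)⁻¹ : ℝ) : ℂ) * (((Real.sqrt 2)⁻¹ : ℝ) : ℂ) = 1 / 2 := by
  rw [← ofReal_mul, ← mul_inv, Real.mul_self_sqrt (by norm_num)]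
  norm_num

theorem IsT.hasPF {u₁ : L2 d} {P : ℝ × Sph d → ℂ} (h : IsT u₁ P) :
    HasPF P fun l ω => ((Real.sqrt 2)⁻¹ : ℝ) * outSym u₁ u₁ l ω :=
  (hasPartialFourier_iff.1 h).congr_right' (Eventually.of_forall fun p => (symbolT_hat_two_pi_mul u₁ p).symm)

theorem exists_isT (hd : 1 ≤ d) (u₁ : L2 d) : ∃ P : ℝ × Sph d → ℂ, IsT u₁ P := by
  obtain ⟨p, hp⟩ := exists_isOutgoing hd u₁ u₁
  exact ⟨_, hasPartialFourier_iff.2 ((hp.1.const_mul _).congr_right'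
    (Eventually.of_forall fun q => symbolT_hat_two_pi_mul u₁ q))⟩

theorem IsDerivT.hasPF (hd : 1 ≤ d) {u₀ : 𝓢'(Space d, ℂ)} {h : L2 d}
    (hh : ∀ j, (riesz j h : 𝓢'(Space d, ℂ)) = ∂_{basisVec j} u₀) {P : ℝ × Sph d → ℂ}
    (hP : IsDerivT u₀ P) :
    HasPF P fun l ω => ((Real.sqrt 2)⁻¹ : ℝ) * outSym ((-I) • h) (I • h) l ω := by
  obtain ⟨F, hF, hP⟩ := hP
  refine (hasPartialFourier_iff.1 hP).congr_right' ?_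
  filter_upwards [mul_symbolT_ae hd (hF.norm_mul_ae_eq hd hh)] with p e
  rw [← e]

theorem exists_isDerivT (hd : 1 ≤ d) {u₀ : 𝓢'(Space d, ℂ)} {h : L2 d}
    (hh : ∀ j, (riesz j h : 𝓢'(Space d, ℂ)) = ∂_{basisVec j} u₀) :
    ∃ P : ℝ × Sph d → ℂ, IsDerivT u₀ P := by
  obtain ⟨F, hF⟩ := exists_fourierAwayFromZero hh
  obtain ⟨p, hp⟩ := exists_isOutgoing hd ((-I) • h) (I • h)
  exact ⟨_, F, hF, hasPartialFourier_iff.2 ((hp.1.const_mul _).congr_right'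
    (mul_symbolT_ae hd (hF.norm_mul_ae_eq hd hh)))⟩

theorem hasPF_waveVel (hd : 1 ≤ d) {h u₁ : L2 d} {P₀ P₁ : ℝ × Sph d → ℂ}
    (h0 : HasPF P₀ fun l ω => ((Real.sqrt 2)⁻¹ : ℝ) * outSym ((-I) • h) (I • h) l ω)
    (h1 : HasPF P₁ fun l ω => ((Real.sqrt 2)⁻¹ : ℝ) * outSym u₁ u₁ l ω) :
    HasPF (fun q => -((Real.sqrt 2)⁻¹ : ℝ) * (P₀ q - P₁ q))
      (outSym ((1 / 2 : ℂ) • (u₁ + I • h)) ((1 / 2 : ℂ) • (u₁ + (-I) • h))) := by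
  refine ((h0.sub h1).const_mul (-((Real.sqrt 2)⁻¹ : ℝ))).congr_right' ?_
  filter_upwards [outSym_waveVel_ae hd h u₁] with p e
  rw [e, ← sqrt_two_inv_mul_self, Pi.sub_apply, Pi.sub_apply]
  ring

theorem hasPF_waveGrad (hd : 1 ≤ d) {h u₁ : L2 d} {P : ℝ × Sph d → ℂ}
    (hP : HasPF P (outSym ((1 / 2 : ℂ) • (u₁ + I • h)) ((1 / 2 : ℂ) • (u₁ + (-I) • h)))) (j : Fin d) :
    HasPF (fun q => -((q.2 : Space d) j : ℂ) * P q)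
      (outSym ((1 / 2 : ℂ) • (riesz j h + (-I) • riesz j u₁))
        ((1 / 2 : ℂ) • (riesz j h + I • riesz j u₁))) :=
  (hP.mul_dir (a := fun ω => -((ω : Space d) j : ℂ)) (by fun_prop)).congr_right'
    (outSym_waveGrad_ae hd h u₁ j)

end WaveProfile

/-! ### From components to vectors -/

section Vector
variable {d n : ℕ}

theorem eLpNorm_euclidean_le (μ : Measure (Space d)) {F : Space d → EuclideanSpace ℂ (Fin n)}
    (hF : ∀ i, AEStronglyMeasurable (fun x => F x i) μ) :
    eLpNorm F 2 μ ≤ ∑ i, eLpNorm (fun x => F x i) 2 μ := by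
  have h1 : eLpNorm F 2 μ ≤ eLpNorm (∑ i, fun x => ‖F x i‖) 2 μ := by
    refine eLpNorm_mono_real fun x => ?_
    rw [Finset.sum_apply, EuclideanSpace.norm_eq]
    refine Real.sqrt_le_iff.2 ⟨Finset.sum_nonneg fun i _ => norm_nonneg _, ?_⟩
    exact Finset.sum_sq_le_sq_sum_of_nonneg fun i _ => norm_nonneg _
  refine h1.trans ((eLpNorm_sum_le (fun i _ => (hF i).norm) (by norm_num)).trans ?_)
  exact Finset.sum_le_sum fun i _ => (eLpNorm_norm _).le

theorem TendstoZeroL2.of_components {F : ℝ → Space d → EuclideanSpace ℂ (Fin n)}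
    (h : ∀ i, TendstoZeroL2 fun t x => F t x i) : TendstoZeroL2 F := by
  refine ⟨fun t => MemLp.of_eval_piLp fun i => (h i).1 t, ?_⟩
  have h1 : Tendsto (fun t => ∑ i, eLpNorm (fun x => F t x i) 2 volume) atTop (𝓝 0) := by
    have := tendsto_finsetSum Finset.univ fun i (_ : i ∈ Finset.univ) => (h i).2
    simpa using this
  exact tendsto_of_tendsto_of_tendsto_of_le_of_le tendsto_const_nhds h1 (fun _ => zero_le) fun t =>
    eLpNorm_euclidean_le volume fun i => ((h i).1 t).1

/-- This form without upper limits lets finitely many components be combined by intersecting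
eventual statements. -/
theorem tendsto_limsup_normOffCone_iff {G : Type*} [NormedAddCommGroup G] {F : ℝ → Space d → G}
    {l : Filter ℝ} :
    Tendsto (fun R : ℝ => limsup (fun t => normOffCone F R t) l) atTop (𝓝 0) ↔
      ∀ ε > 0, ∀ᶠ R in atTop, ∀ᶠ t in l, normOffCone F R t ≤ ε := by
  rw [ENNReal.tendsto_nhds_zero]
  constructor
  · intro h ε hε
    obtain ⟨δ, h1, h2⟩ := exists_between hε
    filter_upwards [h δ h1] with R hR
    filter_upwards [eventually_lt_of_limsup_lt (hR.trans_lt h2)] with t ht using ht.le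
  · intro h ε hε
    filter_upwards [h ε hε] with R hR
    exact limsup_le_of_le (h := hR)

theorem ConcentratesOnCone.of_components {F : ℝ → Space d → EuclideanSpace ℂ (Fin n)}
    (hm : ∀ i t, AEStronglyMeasurable (fun x => F t x i) volume)
    (h : ∀ i, ConcentratesOnCone fun t x => F t x i) : ConcentratesOnCone F := by
  have key : ∀ l : Filter ℝ, (∀ i, Tendsto (fun R : ℝ => limsup (fun t =>
      normOffCone (fun t x => F t x i) R t) l) atTop (𝓝 0)) →
      Tendsto (fun R : ℝ => limsup (fun t => normOffCone F R t) l) atTop (𝓝 0) := fun l hl => by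
    rw [tendsto_limsup_normOffCone_iff]
    intro ε hε
    have h1 : ∀ i, ∀ᶠ R in atTop, ∀ᶠ t in l, normOffCone (fun t x => F t x i) R t ≤ ε / n := fun i =>
      tendsto_limsup_normOffCone_iff.1 (hl i) _ (ENNReal.div_pos hε.ne' (by simp))
    filter_upwards [eventually_all.2 h1] with R hR
    filter_upwards [eventually_all.2 hR] with t ht
    refine (eLpNorm_euclidean_le _ fun i => (hm i t).restrict).trans ?_
    refine (Finset.sum_le_sum fun i _ => ht i).trans ?_
    rw [Finset.sum_const, Finset.card_univ, Fintype.card_fin, nsmul_eq_mul]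
    exact ENNReal.mul_div_le
  exact ⟨key _ fun i => (h i).1, key _ fun i => (h i).2⟩

end Vector

/-! ### The wave equation -/

section WaveTheorem
variable {d : ℕ}

theorem concentratesOnCone_spaceTimeGrad (hd : 1 ≤ d) (h u₁ : L2 d) :
    ConcentratesOnCone (spaceTimeGrad (waveVel h u₁) (waveGrad h u₁)) := by
  refine ConcentratesOnCone.of_components (fun i t => ?_) fun i => ?_
  · refine Fin.cases ?_ (fun j => ?_) i
    · exact (Lp.memLp (waveVel h u₁ t)).1
    · exact (Lp.memLp (waveGrad h u₁ j t)).1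
  · refine Fin.cases ?_ (fun j => ?_) i
    · exact concentratesOnCone_twoWave hd _ _
    · exact concentratesOnCone_twoWave hd _ _

theorem coneMap_snd (hd : 1 ≤ d) (t : ℝ) {x : Space d} (hx : x ≠ 0) (j : Fin d) :
    ((coneMap hd t x).2 : Space d) j = x j / ‖x‖ := by
  have h1 := alongCone_eq hd (fun q => ((q.2 : Space d) j : ℂ)) t hx
  simp only [alongCone, hx, dite_false, direction] at h1
  have h2 := ofReal_injective h1
  rw [← h2, PiLp.smul_apply, smul_eq_mul]
  ring

/-- The velocity profile is `-(1/√2)(P₀ - P₁)` and the `j`-th gradient profile is `-ω_j` times it,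
with `ω = x/|x|` on the cone; these are the components of `(-1, x/|x|)`. -/
theorem tendstoZeroL2_spaceTimeGrad (hd : 1 ≤ d) {h u₁ : L2 d} {P₀ P₁ : ℝ × Sph d → ℂ}
    (h0 : HasPF P₀ fun l ω => ((Real.sqrt 2)⁻¹ : ℝ) * outSym ((-I) • h) (I • h) l ω)
    (h1 : HasPF P₁ fun l ω => ((Real.sqrt 2)⁻¹ : ℝ) * outSym u₁ u₁ l ω) :
    TendstoZeroL2 fun (t : ℝ) (x : Space d) =>
      spaceTimeGrad (waveVel h u₁) (waveGrad h u₁) t x -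
        (1 / ((Real.sqrt 2 * ‖x‖ ^ (((d : ℝ) - 1) / 2) : ℝ) : ℂ) *
          (alongCone P₀ t x - alongCone P₁ t x)) • coneVector x := by
  have hv := hasPF_waveVel hd h0 h1
  refine TendstoZeroL2.of_components fun i => Fin.cases ?_ (fun j => ?_) i
  · refine ((hv.isOutgoing hd).tendstoZeroL2 hd).congr fun t => ?_
    filter_upwards [Space.ae_ne_zero hd] with x hx
    simp only [spaceTimeGrad, coneVector, PiLp.sub_apply, PiLp.smul_apply, Fin.cons_zero, smul_eq_mul,
      coneWave, alongCone_eq hd _ _ hx, waveVel, Real.rpow_neg (norm_nonneg x)]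
    push_cast
    ring
  · refine (((hasPF_waveGrad hd hv j).isOutgoing hd).tendstoZeroL2 hd).congr fun t => ?_
    filter_upwards [Space.ae_ne_zero hd] with x hx
    simp only [spaceTimeGrad, coneVector, PiLp.sub_apply, PiLp.smul_apply, Fin.cons_succ, smul_eq_mul,
      coneWave, alongCone_eq hd _ _ hx, waveGrad, Real.rpow_neg (norm_nonneg x), coneMap_snd hd t hx]
    push_cast
    ring

end WaveTheorem

end RadiationField
end

/-! ### The main theorem -/

open RadiationField
theorem theorem1 (d : ℕ) (hd : 1 ≤ d) :
    -- the half-wave equation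
    (∀ f : L2 d,
      (∃ P : ℝ × Sph d → ℂ, IsMinusProfile f P) ∧
      (∀ P : ℝ × Sph d → ℂ, IsMinusProfile f P →
        TendstoZeroL2 fun (t : ℝ) (x : Space d) =>
          halfWave t f x -
            cexp (I * tau d) / (((2 * Real.pi * ‖x‖) ^ (((d : ℝ) - 1) / 2) : ℝ) : ℂ) *
              alongCone P t x) ∧
      ConcentratesOnCone fun (t : ℝ) (x : Space d) => halfWave t f x) ∧
    -- the wave equation
    (∀ (u₀ : 𝓢'(Space d, ℂ)) (u₁ : L2 d), MemHDotOne u₀ →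
      (∃ P₀ : ℝ × Sph d → ℂ, IsDerivT u₀ P₀) ∧
      (∃ P₁ : ℝ × Sph d → ℂ, IsT u₁ P₁) ∧
      (∃ (u : ℝ → 𝓢'(Space d, ℂ)) (v : ℝ → L2 d) (W : Fin d → ℝ → L2 d),
        IsWaveSolution u₀ u₁ u v W) ∧
      ∀ (u : ℝ → 𝓢'(Space d, ℂ)) (v : ℝ → L2 d) (W : Fin d → ℝ → L2 d),
        IsWaveSolution u₀ u₁ u v W →
        (∀ P₀ P₁ : ℝ × Sph d → ℂ, IsDerivT u₀ P₀ → IsT u₁ P₁ →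
          TendstoZeroL2 fun (t : ℝ) (x : Space d) =>
            spaceTimeGrad v W t x -
              (1 / ((Real.sqrt 2 * ‖x‖ ^ (((d : ℝ) - 1) / 2) : ℝ) : ℂ) *
                (alongCone P₀ t x - alongCone P₁ t x)) • coneVector x) ∧
        ConcentratesOnCone (spaceTimeGrad v W)) := by
  refine ⟨fun f => ⟨exists_isMinusProfile hd f, fun P hP => hP.tendstoZeroL2 hd,
    concentratesOnCone_halfWave hd f⟩, fun u₀ u₁ hu₀ => ?_⟩
  choose g hg using hu₀
  obtain ⟨h, hgh⟩ := exists_eq_riesz hd hg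
  have hh : ∀ j, (riesz j h : 𝓢'(Space d, ℂ)) = ∂_{basisVec j} u₀ := fun j => by
    rw [← hgh j]; exact hg j
  have hsol : ∃ u, IsWaveSolution u₀ u₁ u (waveVel h u₁) (waveGrad h u₁) := by
    have := (isWeakWave_waveVel hd h u₁).isWaveSolution (u₀ := u₀) fun j => by rw [waveGrad_zero, hh]
    rw [waveVel_zero] at this
    exact ⟨_, this⟩
  refine ⟨exists_isDerivT hd hh, exists_isT hd u₁, hsol.imp fun _ hu => ⟨_, _, hu⟩, fun u v W hs => ?_⟩
  -- By uniqueness an arbitrary energy solution is the explicit one, for which profiles and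
  -- concentration are known.
  obtain ⟨rfl, rfl⟩ := hs.eq_waveVel hd hh
  exact ⟨fun P₀ P₁ h0 h1 => tendstoZeroL2_spaceTimeGrad hd (h0.hasPF hd hh) h1.hasPF,
    concentratesOnCone_spaceTimeGrad hd h u₁⟩
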